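/- **Calculus.** Terms, taken up to $\alpha$-equivalence, are $t,s,u ::= x \mid \lambda x.t \mid v\,s \mid t[x/u]$ with values $v ::= x \mid \lambda x.t$. Reduction is the closure under all contexts of $(\lambda x.t)u \mapsto_{\mathsf m} t[x/u]$ and $t[x/vL] \mapsto_{\mathsf e} t\{x/v\}L$, where $L$ is a possibly empty list of explicit substitutions. For a redex (occurrence) $R$ of $t$, $R : t \to_a t'$ means that $R$ has kind $a\in\{\mathsf m,\mathsf e\}$ and that contracting it gives $t'$. **Nets.** Nets are hypergraphs, without isolated nodes, whose nodes are of type $e$ or $m$, with a root $e$-node and with named free variables ($e$-nodes that are not the source of a link); they are considered up to isomorphism preserving labels, boxes, root and names. The links are $!$ (source $e$, target $m$), $\mathsf d$ (source $m$, target $e$), $\mathsf w$ (no source, target $e$), $\otimes$ (source $e$, targets an $m$- and an $e$-node) and $\wp$ (sources an $m$-node and an $e$-node, its variable; target an $e$-node), and each $\wp$-link has a box, a subhypergraph rooted at its target, of which its variable is a free variable. For a finite set $X$ of variables, $[\![t]\!]_X$ is $[\![t]\!]$ with a $\mathsf w$-link added on every $x\in X\setminus \mathrm{fv}(t)$, where: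 $[\![x]\!]$ is a $!$ on a $\mathsf d$ on $x$; $[\![\lambda x.t]\!]$ is a $!$ on a $\wp$ with variable $x$ and box $[\![t]\!]_{\mathrm{fv}(t)\cup\{x\}}$; $[\![v\,s]\!]$ is a $\otimes$ whose $m$-target is the source of the $\mathsf d$ (if $v$ is a variable) or of the $\wp$ with its box (if $v$ is an abstraction) of $[\![v]\!]$ and whose $e$-target is the root of $[\![s]\!]$; $[\![t[x/u]]\!]$ is the union of $[\![t]\!]_{\mathrm{fv}(t)\cup\{x\}}$ and $[\![u]\!]$ with $x$ identified with the root of $[\![u]\!]$. Equally named free variables are always identified. **Cut elimination.** A redex of a net is either ($\mathsf m$) an $m$-node that is a target of a $\otimes$-link and a source of a $\wp$-link, or ($\mathsf e$) an $e$-node that is the source of a $!$-link and the target of at least one link, and only of $\mathsf d$- and $\mathsf w$-links. An $\mathsf m$-step removes the two links and the node, opens the box, identifies the source of the $\otimes$ with the root of the box and the $e$-target of the $\otimes$ with the variable of the $\wp$. An $\mathsf e$-step removes the $!$, the links on the cut node, and the content $H$ of the $!$ (the $\mathsf d$-link below it, or the $\wp$-link below it with its box). Every removed $\mathsf d$-link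 is replaced by a copy of $H$ lying in the same boxes as that link, the copies sharing the targets of $H$. If the removed link is a $\mathsf w$-link, then every target of $H$ that is not the target of a remaining link receives a $\mathsf w$-link, which lies in exactly those boxes to which its node is internal or of whose $\wp$-link its node is the variable. For a redex $S$ of $G$, $S : G\to_a G'$ means that $S$ has kind $a$ and that eliminating it gives $G'$. **Theorem (dynamic isomorphism).** Let $t$ be a term and $X$ a finite set of variables with $\mathrm{fv}(t)\subseteq X$. The translation induces a bijection $\varphi$ between the redexes of $t$ and the redexes of $[\![t]\!]_X$: a redex $(\lambda x.s)u$ is sent to the $m$-node between the corresponding $\otimes$ and $\wp$, and a redex $s[x/vL]$ is sent to the $e$-node that is the root of the translation of $vL$, with which $x$ is identified. For every redex $R$ of $t$, every $a\in\{\mathsf m,\mathsf e\}$ and every net $G'$, $$\varphi(R) : [\![t]\!]_X \to_a G' \iff \text{there is a term } t' \text{ with } R : t\to_a t' \text{ and } [\![t']\!]_X = G'.$$ Consequently the unfoldings (the trees of reduction sequences) of the reduction graphs of $t$ and of $[\![t]\!]_X$ are isomorphic, preserving the kinds of steps, with corresponding vertices being a term $s$ with $\mathrm{fv}(s)\subseteq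 X$ and its net $[\![s]\!]_X$. -/

import Mathlib

/-! ## The value substitution kernel

Terms are taken up to `α`-equivalence, represented with de Bruijn indices: the variable names are
the natural numbers, and each of `lam t`, `appLam t s`, `sub t u` binds the variable `0` of `t`. -/

/-- Terms `t ::= x | λx.t | v s | t[x/u]`, where `v ::= x | λx.t`.  The two possible shapes `x s`
and `(λx.t) s` of an application are the constructors `appVar` and `appLam`. -/
inductive Term : Type
  | var (x : ℕ)
  | lam (t : Term)
  | appVar (x : ℕ) (s : Term)
  | appLam (t s : Term)
  | sub (t u : Term)

/-- Values `v ::= x | λx.t`. -/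
inductive Value : Type
  | var (x : ℕ)
  | lam (t : Term)

/-- A value is a term. -/
def Value.toTerm : Value → Term
  | .var x => .var x
  | .lam t => .lam t

/-- The application `v s`. -/
def Value.app : Value → Term → Term
  | .var x, s => .appVar x s
  | .lam t, s => .appLam t s

/-- The renaming `f`, under a binder. -/
def upRen (f : ℕ → ℕ) : ℕ → ℕ
  | 0 => 0
  | k + 1 => f k + 1

namespace Term

/-- Capture-avoiding renaming of the free variables. -/
def rename : (ℕ → ℕ) → Term → Term
  | f, var x => var (f x)
  | f, lam t => lam (rename (upRen f) t)
  | f, appVar x s => appVar (f x) (rename f s)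
  | f, appLam t s => appLam (rename (upRen f) t) (rename f s)
  | f, sub t u => sub (rename (upRen f) t) (rename f u)

/-- The free variables. The free variables of an abstraction are those of its body other than `0`,
shifted down by one. -/
def fv : Term → Finset ℕ
  | var x => {x}
  | lam t => (t.fv.erase 0).image Nat.pred
  | appVar x s => insert x s.fv
  | appLam t s => (t.fv.erase 0).image Nat.pred ∪ s.fv
  | sub t u => (t.fv.erase 0).image Nat.pred ∪ u.fv

end Term

/-- Renaming in a value. -/
def Value.rename (f : ℕ → ℕ) : Value → Value
  | .var x => .var (f x)
  | .lam t => .lam (t.rename (upRen f))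

/-- The substitution `σ`, under a binder. -/
def upSubst (σ : ℕ → Value) : ℕ → Value
  | 0 => .var 0
  | k + 1 => (σ k).rename Nat.succ

/-- The substitution of `v` for the variable `0` (whose binder disappears). -/
def instSubst (v : Value) : ℕ → Value
  | 0 => v
  | k + 1 => .var k

namespace Term

/-- Capture-avoiding simultaneous substitution of values for the free variables. -/
def subst : (ℕ → Value) → Term → Term
  | σ, var x => (σ x).toTerm
  | σ, lam t => lam (subst (upSubst σ) t)
  | σ, appVar x s => (σ x).app (subst σ s)
  | σ, appLam t s => appLam (subst (upSubst σ) t) (subst σ s)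
  | σ, sub t u => sub (subst (upSubst σ) t) (subst σ u)

/-- `t.subs [u₁, …, uₖ]` is `t[x₁/u₁]…[xₖ/uₖ]`. -/
def subs (t : Term) (L : List Term) : Term := L.foldl sub t

end Term

/-- The two kinds of steps. -/
inductive Kind : Type
  | m
  | e
  deriving DecidableEq

/-- The redexes (redex occurrences, in any context) of a term. -/
inductive Term.Redex : Term → Type
  /-- the redex `(λx.t) u` -/
  | mRoot (t u : Term) : Redex (.appLam t u)
  /-- the redex `t[x/vL]`; `v` and `L` are determined by the term `u = vL` -/
  | eRoot (t u : Term) (v : Value) (L : List Term) (h : u = v.toTerm.subs L) : Redex (.sub t u)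
  | lam {t : Term} (R : Redex t) : Redex (.lam t)
  | appVar (x : ℕ) {s : Term} (R : Redex s) : Redex (.appVar x s)
  | appLamLeft {t : Term} (s : Term) (R : Redex t) : Redex (.appLam t s)
  | appLamRight (t : Term) {s : Term} (R : Redex s) : Redex (.appLam t s)
  | subLeft {t : Term} (u : Term) (R : Redex t) : Redex (.sub t u)
  | subRight (t : Term) {u : Term} (R : Redex u) : Redex (.sub t u)

namespace Term.Redex

/-- The kind of a redex. -/
def kind : {t : Term} → t.Redex → Kind
  | _, mRoot _ _ => .m
  | _, eRoot _ _ _ _ _ => .e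
  | _, lam R => R.kind
  | _, appVar _ R => R.kind
  | _, appLamLeft _ R => R.kind
  | _, appLamRight _ R => R.kind
  | _, subLeft _ R => R.kind
  | _, subRight _ R => R.kind

/-- The term obtained by contracting a redex:
`(λx.t) u ↦ t[x/u]` and `t[x/vL] ↦ t{x/v}L`.  In the second rule the free variables of `t`
other than `x` are shifted over the binders of `L`. -/
def contract : {t : Term} → t.Redex → Term
  | _, mRoot t u => .sub t u
  | _, eRoot t _ v L _ =>
      ((t.rename (upRen (· + L.length))).subst (instSubst v)).subs L
  | _, lam R => .lam R.contract
  | _, appVar x R => .appVar x R.contract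
  | _, appLamLeft s R => .appLam R.contract s
  | _, appLamRight t R => .appLam t R.contract
  | _, subLeft u R => .sub R.contract u
  | _, subRight t R => .sub t R.contract

/-- `R : t →ₐ t'`. -/
def Reduces {t : Term} (R : t.Redex) (a : Kind) (t' : Term) : Prop :=
  R.kind = a ∧ R.contract = t'

end Term.Redex

/-! ## Nets -/

/-- A link, with its label and its source and target nodes.  `N` is the type of the `e`-nodes and
`M` the type of the `m`-nodes.
* `bang s t`: source the `e`-node `s`, target the `m`-node `t`; principal node `s`.
* `der s t`: source the `m`-node `s`, target the `e`-node `t`; principal node `t`.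
* `weak t`: no source, target the `e`-node `t`; principal node `t`.
* `par s x b`: sources the `m`-node `s` and the `e`-node `x` (the variable), target the `e`-node
  `b` (the root of the box); principal node `s`.
* `tens s f a`: source the `e`-node `s`, targets the `m`-node `f` and the `e`-node `a`; principal
  node `f`. -/
inductive Link (N M : Type) : Type
  | bang (s : N) (t : M)
  | der (s : M) (t : N)
  | weak (t : N)
  | par (s : M) (x : N) (b : N)
  | tens (s : N) (f : M) (a : N)

namespace Link

variable {N M N' M' : Type}

/-- Relabelling of the nodes of a link. -/
def map (f : N → N') (g : M → M') : Link N M → Link N' M'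
  | bang s t => bang (f s) (g t)
  | der s t => der (g s) (f t)
  | weak t => weak (f t)
  | par s x b => par (g s) (f x) (f b)
  | tens s h a => tens (f s) (g h) (f a)

/-- The `e`-node `n` is a source of the link. -/
def ESource (n : N) : Link N M → Prop
  | bang s _ => n = s
  | der _ _ => False
  | weak _ => False
  | par _ x _ => n = x
  | tens s _ _ => n = s

/-- The `e`-node `n` is a target of the link. -/
def ETarget (n : N) : Link N M → Prop
  | bang _ _ => False
  | der _ t => n = t
  | weak t => n = t
  | par _ _ b => n = b
  | tens _ _ a => n = a

/-- The `m`-node `a` is a source of the link. -/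
def MSource (a : M) : Link N M → Prop
  | bang _ _ => False
  | der s _ => a = s
  | weak _ => False
  | par s _ _ => a = s
  | tens _ _ _ => False

/-- The `m`-node `a` is a target of the link. -/
def MTarget (a : M) : Link N M → Prop
  | bang _ t => a = t
  | der _ _ => False
  | weak _ => False
  | par _ _ _ => False
  | tens _ f _ => a = f

/-- The link is a dereliction or a weakening, that is, its `e`-target is its principal node. -/
def ETargetPrincipal : Link N M → Prop
  | der _ _ => True
  | weak _ => True
  | _ => False

end Link

/-- The hypergraphs with boxes underlying nets.  The `e`-nodes are the free variables, which are
named by natural numbers (`Sum.inl x`), and the others (`Sum.inr n`); the root is one of the latter.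
Nets have no isolated nodes: the nodes of the hypergraph are, by definition, those elements of
`ℕ ⊕ E` and of `M` that are a source or a target of some link.  Likewise, a box has no isolated
nodes and is given by the set of its links; `box l` is the box of `l` if `l` is a `par`-link, and it
is empty otherwise. -/
structure Net where
  E : Type
  M : Type
  L : Type
  link : L → Link (ℕ ⊕ E) M
  box : L → Set L
  root : E

namespace Net

/-- The `e`-nodes that are not free variables. -/
def eNodes (G : Net) : Set G.E :=
  {n | ∃ l, (G.link l).ESource (.inr n) ∨ (G.link l).ETarget (.inr n)}

/-- The `m`-nodes. -/
def mNodes (G : Net) : Set G.M :=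
  {a | ∃ l, (G.link l).MSource a ∨ (G.link l).MTarget a}

/-- Isomorphisms of nets: bijections between the links and between the nodes, preserving labels,
sources, targets, boxes, the root and the names of the free variables.  (The map on nodes matters
only on the actual nodes; there it is injective by `injE` and `injM`, and onto by `link_eq`.) -/
structure Iso (G G' : Net) where
  onL : G.L ≃ G'.L
  onE : G.E → G'.E
  onM : G.M → G'.M
  injE : Set.InjOn onE G.eNodes
  injM : Set.InjOn onM G.mNodes
  link_eq : ∀ l, G'.link (onL l) = (G.link l).map (Sum.map id onE) onM
  box_iff : ∀ l k, onL k ∈ G'.box (onL l) ↔ k ∈ G.box l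
  root_eq : onE G.root = G'.root

/-- `G` and `G'` are isomorphic, that is, the same net up to the identity of the internal nodes and
of the links. -/
def Equal (G G' : Net) : Prop := Nonempty (Iso G G')

/-- `G` together with a free weakening on each free variable in `W`. -/
def weaken (G : Net) (W : Finset ℕ) : Net where
  E := G.E
  M := G.M
  L := G.L ⊕ {y // y ∈ W}
  link := Sum.elim G.link (fun y => .weak (.inl y.1))
  box := Sum.elim (fun l => Sum.inl '' G.box l) (fun _ => ∅)
  root := G.root

/-! ### The translation -/

/-- Sends the free variable `0` to the node `x`, the free variable `k + 1` to the free variable `k`,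
and the other nodes along `f`. -/
def bind {E E' : Type} (x : E') (f : E → E') : ℕ ⊕ E → ℕ ⊕ E'
  | .inl 0 => .inr x
  | .inl (k + 1) => .inl k
  | .inr n => .inr (f n)

/-- A `bang` on a dereliction on `x`. -/
def varNet (x : ℕ) : Net where
  E := Unit
  M := Unit
  L := Bool
  link
    | true => .bang (.inr ()) ()
    | false => .der () (.inl x)
  box _ := ∅
  root := ()

/-- A `bang` on a `par` whose box is `G` and whose variable is the free variable `0` of `G`. The new
`e`-nodes are the root (`inl true`) and the variable (`inl false`). -/
def lamNet (G : Net) : Net where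
  E := Bool ⊕ G.E
  M := Unit ⊕ G.M
  L := Bool ⊕ G.L
  link
    | .inl true => .bang (.inr (.inl true)) (.inl ())
    | .inl false => .par (.inl ()) (.inr (.inl false)) (.inr (.inr G.root))
    | .inr l => (G.link l).map (bind (.inl false) .inr) .inr
  box
    | .inl true => ∅
    | .inl false => Set.range .inr
    | .inr l => .inr '' G.box l
  root := .inl true

/-- A `tens` on a dereliction on `x` and on the root of `S`. -/
def appVarNet (x : ℕ) (S : Net) : Net where
  E := Unit ⊕ S.E
  M := Unit ⊕ S.M
  L := Bool ⊕ S.L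
  link
    | .inl true => .tens (.inr (.inl ())) (.inl ()) (.inr (.inr S.root))
    | .inl false => .der (.inl ()) (.inl x)
    | .inr l => (S.link l).map (Sum.map id .inr) .inr
  box
    | .inl _ => ∅
    | .inr l => .inr '' S.box l
  root := .inl ()

/-- A `tens` on a `par`, whose box is `G` and whose variable is the free variable `0` of `G`, and on
the root of `S`. The new `e`-nodes are the root (`inl true`) and the variable (`inl false`). -/
def appLamNet (G S : Net) : Net where
  E := Bool ⊕ (G.E ⊕ S.E)
  M := Unit ⊕ (G.M ⊕ S.M)
  L := Bool ⊕ (G.L ⊕ S.L)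
  link
    | .inl true => .tens (.inr (.inl true)) (.inl ()) (.inr (.inr (.inr S.root)))
    | .inl false => .par (.inl ()) (.inr (.inl false)) (.inr (.inr (.inl G.root)))
    | .inr (.inl l) => (G.link l).map (bind (.inl false) (.inr ∘ .inl)) (.inr ∘ .inl)
    | .inr (.inr l) => (S.link l).map (Sum.map id (.inr ∘ .inr)) (.inr ∘ .inr)
  box
    | .inl true => ∅
    | .inl false => Set.range (.inr ∘ .inl)
    | .inr (.inl l) => (.inr ∘ .inl) '' G.box l
    | .inr (.inr l) => (.inr ∘ .inr) '' S.box l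
  root := .inl true

/-- `G` and `S`, where the free variable `0` of `G` is identified with the root of `S`. -/
def subNet (G S : Net) : Net where
  E := G.E ⊕ S.E
  M := G.M ⊕ S.M
  L := G.L ⊕ S.L
  link
    | .inl l => (G.link l).map (bind (.inr S.root) .inl) .inl
    | .inr l => (S.link l).map (Sum.map id .inr) .inr
  box
    | .inl l => .inl '' G.box l
    | .inr l => .inr '' S.box l
  root := .inl G.root

end Net

namespace Term

/-- The translation `⟦t⟧`. In the clauses with a binder the bound variable receives a weakening if
it does not occur. -/
def net : Term → Net
  | var x => Net.varNet x
  | lam t => Net.lamNet (t.net.weaken ({0} \ t.fv))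
  | appVar x s => Net.appVarNet x s.net
  | appLam t s => Net.appLamNet (t.net.weaken ({0} \ t.fv)) s.net
  | sub t u => Net.subNet (t.net.weaken ({0} \ t.fv)) u.net

/-- The translation `⟦t⟧_X`: `⟦t⟧` with a free weakening on each variable of `X` that is not free
in `t`. -/
def netX (t : Term) (X : Finset ℕ) : Net := t.net.weaken (X \ t.fv)

end Term

/-! ### Cut elimination -/

namespace Net

/-- A multiplicative redex: an `m`-node whose incoming link is a `tens` and whose outgoing link is
a `par`. In a net the node determines the other data. -/
structure MCut (G : Net) where
  node : G.M
  tens : G.L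
  par : G.L
  r : ℕ ⊕ G.E
  arg : ℕ ⊕ G.E
  x : ℕ ⊕ G.E
  body : ℕ ⊕ G.E
  tens_eq : G.link tens = .tens r node arg
  par_eq : G.link par = .par node x body

/-- An exponential redex: an `e`-node with incoming links, all of which are derelictions or
weakenings, and whose outgoing link is a `bang`.  `below` is the link on the `m`-target of the
`bang`. In a net the node determines the other data. -/
structure ECut (G : Net) where
  node : G.E
  bang : G.L
  m : G.M
  below : G.L
  bang_eq : G.link bang = .bang (.inr node) m
  below_src : (G.link below).MSource m
  incoming : ∃ l, (G.link l).ETarget (.inr node)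
  principal : ∀ l, (G.link l).ETarget (.inr node) → (G.link l).ETargetPrincipal

open Classical in
/-- The `m`-step: the two links and their common `m`-node are removed, the box is opened, the source
of the `tens` is identified with the root of the box, and the argument with the variable of the
`par`. -/
noncomputable def MCut.contract {G : Net} (c : G.MCut) : Net where
  E := G.E
  M := G.M
  L := {l : G.L // l ≠ c.tens ∧ l ≠ c.par}
  link l := (G.link l.1).map
    (fun n => if n = c.x then c.arg else if n = c.body then c.r else n) id
  box l := {k | k.1 ∈ G.box l.1}
  root := G.root

namespace ECut

variable {G : Net} (c : G.ECut)

/-- The links of the content `H` of the `bang`: a dereliction, or a `par` with its box. -/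
def H : Set G.L := {l | l = c.below ∨ l ∈ G.box c.below}

/-- The links untouched by the step: all but the `bang`, the links on the cut node, and `H`. -/
def Kept (l : G.L) : Prop := l ≠ c.bang ∧ ¬ (G.link l).ETarget (.inr c.node) ∧ l ∉ c.H

/-- The derelictions on the cut node, each with its source. -/
def D : Type := {p : G.L × G.M // G.link p.1 = .der p.2 (.inr c.node)}

/-- The `e`-node `n` belongs to `H` and is not a target of `H`. -/
def InnerE (n : ℕ ⊕ G.E) : Prop := ∃ l ∈ c.H, (G.link l).ESource n

/-- The `e`-node `n` is a target of `H`. -/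
def OuterE (n : ℕ ⊕ G.E) : Prop := (∃ l ∈ c.H, (G.link l).ETarget n) ∧ ¬ c.InnerE n

/-- The `e`-nodes that receive a weakening: if the cut is with a weakening, so that `H` is erased,
the targets of `H` that are not the target of a remaining link. -/
def W : Type :=
  {n : ℕ ⊕ G.E // IsEmpty c.D ∧ c.OuterE n ∧ ∀ l, c.Kept l → ¬ (G.link l).ETarget n}

open Classical in
/-- The `e`-nodes of the copy of `H` for the dereliction `d`: the targets of `H` are shared between
all the copies, the other nodes are duplicated. -/
noncomputable def copyE (d : c.D) : ℕ ⊕ G.E → ℕ ⊕ (G.E × Option G.L)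
  | .inl x => .inl x
  | .inr n => .inr (n, if c.InnerE (.inr n) then some d.1.1 else none)

open Classical in
/-- The `m`-nodes of the copy of `H` for the dereliction `d`: the source of `H` becomes the source
of `d`, the other nodes are duplicated. -/
noncomputable def copyM (d : c.D) (a : G.M) : G.M × Option G.L :=
  if a = c.m then (d.1.2, none) else (a, some d.1.1)

/-- The `e`-step: the `bang`, its content `H`, and the links on the cut node are removed. Each
dereliction `d` on the cut node is replaced by a copy of `H`, which lies in the same boxes as `d`.
If the cut is with a weakening, the nodes in `W` receive a weakening, which lies in a box exactly if
its node is internal to the box or is the variable of the `par` of the box.  A node `(n, none)` is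
the node `n` of `G`, and `(n, some d)` is its copy for `d`. -/
noncomputable def contract : Net where
  E := G.E × Option G.L
  M := G.M × Option G.L
  L := {l : G.L // c.Kept l} ⊕ ((c.D × {l : G.L // l ∈ c.H}) ⊕ c.W)
  link
    | .inl l => (G.link l.1).map (Sum.map id (·, none)) (·, none)
    | .inr (.inl (d, l)) => (G.link l.1).map (c.copyE d) (c.copyM d)
    | .inr (.inr n) => .weak (Sum.map id (·, none) n.1)
  box
    | .inl q => {k | match k with
        | .inl l => l.1 ∈ G.box q.1
        | .inr (.inl (d, _)) => d.1.1 ∈ G.box q.1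
        | .inr (.inr n) => (∃ l ∈ G.box q.1, (G.link l).ESource n.1) ∨
            ∃ a b, G.link q.1 = .par a n.1 b}
    | .inr (.inl (d, q)) => {k | ∃ l : {l : G.L // l ∈ c.H}, k = .inr (.inl (d, l)) ∧ l.1 ∈ G.box q.1}
    | .inr (.inr _) => ∅
  root := (G.root, none)

end ECut

/-- The redexes of a net. -/
inductive Redex (G : Net) : Type
  | m (c : G.MCut)
  | e (c : G.ECut)

namespace Redex

variable {G : Net}

/-- The node of a cut, an `m`-node or an `e`-node. -/
def node : G.Redex → G.M ⊕ G.E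
  | m c => .inl c.node
  | e c => .inr c.node

/-- The kind of a redex. -/
def kind : G.Redex → Kind
  | m _ => .m
  | e _ => .e

/-- The net obtained by eliminating the cut. -/
noncomputable def contract : G.Redex → Net
  | m c => c.contract
  | e c => c.contract

/-- `S : G →ₐ G'`, nets being considered up to isomorphism. -/
def Reduces (S : G.Redex) (a : Kind) (G' : Net) : Prop := S.kind = a ∧ S.contract.Equal G'

end Redex

end Net

/-! ### The correspondence -/

/-- The node of `⟦t⟧` (equivalently, of `⟦t⟧_X`) that the translation associates with a redex of
`t`: the `m`-node between the translations of the application and of the abstraction of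
`(λx.t) u`, and the `e`-node that is the variable `x` of `t[x/vL]`. -/
def Term.Redex.node : {t : Term} → t.Redex → t.net.M ⊕ t.net.E
  | _, mRoot _ _ => .inl (.inl ())
  | _, eRoot _ u _ _ _ => .inr (.inr u.net.root)
  | _, lam R => Sum.map .inr .inr R.node
  | _, appVar _ R => Sum.map .inr .inr R.node
  | _, appLamLeft _ R => Sum.map (.inr ∘ .inl) (.inr ∘ .inl) R.node
  | _, appLamRight _ R => Sum.map (.inr ∘ .inr) (.inr ∘ .inr) R.node
  | _, subLeft _ R => Sum.map .inl .inl R.node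
  | _, subRight _ R => Sum.map .inr .inr R.node

/-- The unfoldings (trees of reduction sequences) of the reduction graphs of `t` and `G` are
isomorphic, in such a way that corresponding vertices are a term `s` and its net `⟦s⟧_X`: there is
a relation containing the pair of the roots which, at each related pair, comes with a
kind-preserving bijection of the outgoing edges whose end points are again related. -/
def UnfoldingsIso (X : Finset ℕ) (t : Term) (G : Net) : Prop :=
  ∃ S : Term → Net → Prop, S t G ∧ ∀ s H, S s H →
    s.fv ⊆ X ∧ (s.netX X).Equal H ∧
    ∃ φ : s.Redex ≃ H.Redex, ∀ R, (φ R).kind = R.kind ∧ S R.contract (φ R).contract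

/-!
Weakenings are what makes the nets of terms awkward: they come and go under reduction, and their
places depend on all of the remaining links.  The proof therefore works with the *skeleton*
`Term.skel t`, which is `⟦t⟧` without weakenings, and with embeddings of nets (`Net.Emb`), which
preserve links, boxes and root and reach every link of the target other than its weakenings.

That nothing is lost in this way is due to the condition `Net.Sat`: a node carries a weakening
exactly if it is a free variable or an inner node other than the root and no other link has it as a
target, and the boxes of a weakening are those of its node.  So weakenings are determined by the
other links, and two nets that satisfy `Sat` and embed the same net without weakenings are
isomorphic (`Net.Sat.equal`).  The nets of terms satisfy the stronger invariant `Net.WF`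
(`Term.wf_netX`), by which contraction leads to a net that satisfies `Sat` again
(`Net.WF.sat_contract_bang`, `Net.MCut.sat_contract`); it is here that the clause on the weakenings
created by an exponential step is used.

It remains to show that, up to embedding, the skeleton of the contractum of a redex `R` is obtained
from the skeleton of the term by contracting the cut that corresponds to `R`
(`Term.Redex.simulated`).

* A multiplicative step at the root does to nets what it does to terms.
* An exponential step replaces the derelictions on the cut node by copies of a content.  So does
  substitution of a value: `Net.subst` replaces the derelictions on free variables by contents, it
  computes the skeleton of a substituted term (`Term.skel_subst`), and it agrees with contraction at
  the root of `t[x/v]` (`Net.rootBangEmb`).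
* The list `L` in `t[x/vL]` is taken out by an associativity isomorphism of explicit substitutions
  (`Net.subAssocIso`).
* Contraction commutes with filling a one-hole context of nets (`Net.Ctx.plugContract`), since the
  steps involved affect neither the root nor the free variables (`Net.Cut.Proper`), through which
  alone the context is connected to the net in its hole.

A redex of a well-formed net is determined by its node (`Net.WF.redex_ext`).  The map from redexes
of `t` to nodes is injective (`Term.Redex.node_injective`), and by induction on `t` every cut node
of its skeleton lies in the range (`Term.Redex.exists_node_eq`); this gives the bijection.  For the
unfoldings, the relation between a term `s` and the nets isomorphic to `⟦s⟧` is a bisimulation,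
because redexes and their contracta are transported along isomorphisms of nets
(`Net.Emb.mapRedex`).
-/

-- The nets that these definitions build are compared by unfolding them, also in `simp`.
attribute [reducible] Net.weaken Net.varNet Net.lamNet Net.appVarNet Net.appLamNet Net.subNet
  Net.MCut.contract Net.ECut.contract Net.ECut.D Net.ECut.W

/-! ### Links and embeddings of nets -/

namespace Link

variable {N M N' M' N'' M'' : Type}

/-- The link is a weakening. -/
def IsWeak : Link N M → Prop
  | weak _ => True
  | _ => False

/-- The link is a dereliction. -/
def IsDer : Link N M → Prop
  | der _ _ => True
  | _ => False

/-- The link is a `par`. -/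
def IsPar : Link N M → Prop
  | par _ _ _ => True
  | _ => False

/-- The node `n` is the variable of the `par`-link. -/
def ParVar (n : N) : Link N M → Prop
  | par _ x _ => n = x
  | _ => False

attribute [simp] ESource.eq_1 ESource.eq_2 ESource.eq_3 ESource.eq_4 ESource.eq_5
  ETarget.eq_1 ETarget.eq_2 ETarget.eq_3 ETarget.eq_4 ETarget.eq_5
  MSource.eq_1 MSource.eq_2 MSource.eq_3 MSource.eq_4 MSource.eq_5
  MTarget.eq_1 MTarget.eq_2 MTarget.eq_3 MTarget.eq_4 MTarget.eq_5
  ETargetPrincipal.eq_1 ETargetPrincipal.eq_2 ETargetPrincipal.eq_3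
  IsWeak.eq_1 IsWeak.eq_2 IsDer.eq_1 IsDer.eq_2 IsPar.eq_1 IsPar.eq_2 ParVar.eq_1 ParVar.eq_2

theorem map_map (f : N → N') (g : M → M') (f' : N' → N'') (g' : M' → M'') (l : Link N M) :
    (l.map f g).map f' g' = l.map (f' ∘ f) (g' ∘ g) := by
  cases l <;> rfl

theorem map_congr {f f' : N → N'} {g g' : M → M'} {l : Link N M}
    (hf : ∀ n, l.ESource n ∨ l.ETarget n → f n = f' n)
    (hg : ∀ a, l.MSource a ∨ l.MTarget a → g a = g' a) : l.map f g = l.map f' g' := by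
  cases l <;> simp_all [map, ESource, ETarget, MSource, MTarget]

theorem eSource_map {f : N → N'} {g : M → M'} {l : Link N M} {n : N'} :
    (l.map f g).ESource n ↔ ∃ p, l.ESource p ∧ n = f p := by
  cases l <;> simp [map, ESource]

theorem eTarget_map {f : N → N'} {g : M → M'} {l : Link N M} {n : N'} :
    (l.map f g).ETarget n ↔ ∃ p, l.ETarget p ∧ n = f p := by
  cases l <;> simp [map, ETarget]

theorem mSource_map {f : N → N'} {g : M → M'} {l : Link N M} {a : M'} :
    (l.map f g).MSource a ↔ ∃ b, l.MSource b ∧ a = g b := by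
  cases l <;> simp [map, MSource]

theorem mTarget_map {f : N → N'} {g : M → M'} {l : Link N M} {a : M'} :
    (l.map f g).MTarget a ↔ ∃ b, l.MTarget b ∧ a = g b := by
  cases l <;> simp [map, MTarget]

theorem parVar_map {f : N → N'} {g : M → M'} {l : Link N M} {n : N'} :
    (l.map f g).ParVar n ↔ ∃ p, l.ParVar p ∧ n = f p := by
  cases l <;> simp [map, ParVar]

@[simp] theorem isWeak_map {f : N → N'} {g : M → M'} {l : Link N M} :
    (l.map f g).IsWeak ↔ l.IsWeak := by
  cases l <;> simp [map, IsWeak]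

@[simp] theorem isDer_map {f : N → N'} {g : M → M'} {l : Link N M} :
    (l.map f g).IsDer ↔ l.IsDer := by
  cases l <;> simp [map, IsDer]

@[simp] theorem isPar_map {f : N → N'} {g : M → M'} {l : Link N M} :
    (l.map f g).IsPar ↔ l.IsPar := by
  cases l <;> simp [map, IsPar]

@[simp] theorem eTargetPrincipal_map {f : N → N'} {g : M → M'} {l : Link N M} :
    (l.map f g).ETargetPrincipal ↔ l.ETargetPrincipal := by
  cases l <;> simp [map, ETargetPrincipal]

theorem map_eq_bang {f : N → N'} {g : M → M'} {l : Link N M} {s t} :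
    l.map f g = bang s t ↔ ∃ s' t', l = bang s' t' ∧ f s' = s ∧ g t' = t := by
  cases l <;> simp [map]

theorem map_eq_der {f : N → N'} {g : M → M'} {l : Link N M} {s t} :
    l.map f g = der s t ↔ ∃ s' t', l = der s' t' ∧ g s' = s ∧ f t' = t := by
  cases l <;> simp [map]

theorem map_eq_par {f : N → N'} {g : M → M'} {l : Link N M} {s x b} :
    l.map f g = par s x b ↔
      ∃ s' x' b', l = par s' x' b' ∧ g s' = s ∧ f x' = x ∧ f b' = b := by
  cases l <;> simp [map]

theorem map_eq_tens {f : N → N'} {g : M → M'} {l : Link N M} {s a b} :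
    l.map f g = tens s a b ↔
      ∃ s' a' b', l = tens s' a' b' ∧ f s' = s ∧ g a' = a ∧ f b' = b := by
  cases l <;> simp [map]

theorem isWeak_iff {l : Link N M} : l.IsWeak ↔ ∃ n, l = weak n := by
  cases l <;> simp [IsWeak]

theorem parVar_iff {l : Link N M} {n : N} : l.ParVar n ↔ ∃ a b, l = par a n b := by
  cases l <;> simp [ParVar, eq_comm]

theorem ParVar.eSource {l : Link N M} {n : N} (h : l.ParVar n) : l.ESource n := by
  cases l <;> simp_all [ParVar, ESource]

theorem ParVar.isPar {l : Link N M} {n : N} (h : l.ParVar n) : l.IsPar := by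
  cases l <;> simp_all [ParVar, IsPar]

theorem ESource.not_isWeak {l : Link N M} {n : N} (h : l.ESource n) : ¬ l.IsWeak := by
  cases l <;> simp_all [ESource, IsWeak]

theorem ESource.not_principal {l : Link N M} {n : N} (h : l.ESource n) : ¬ l.ETargetPrincipal := by
  cases l <;> simp_all [ESource, ETargetPrincipal]

theorem MSource.not_isWeak {l : Link N M} {n : M} (h : l.MSource n) : ¬ l.IsWeak := by
  cases l <;> simp_all [MSource, IsWeak]

theorem MTarget.not_isWeak {l : Link N M} {n : M} (h : l.MTarget n) : ¬ l.IsWeak := by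
  cases l <;> simp_all [MTarget, IsWeak]

theorem IsPar.not_isWeak {l : Link N M} (h : l.IsPar) : ¬ l.IsWeak := by
  cases l <;> simp_all [IsPar, IsWeak]

theorem IsWeak.not_isDer {l : Link N M} (h : l.IsWeak) : ¬ l.IsDer := by
  cases l <;> simp_all [IsDer, IsWeak]

theorem IsWeak.principal {l : Link N M} (h : l.IsWeak) : l.ETargetPrincipal := by
  cases l <;> simp_all [ETargetPrincipal, IsWeak]

theorem ESource.unique {l : Link N M} {n n' : N} (h : l.ESource n) (h' : l.ESource n') :
    n = n' := by
  cases l <;> simp_all [ESource]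

theorem ETarget.unique {l : Link N M} {n n' : N} (h : l.ETarget n) (h' : l.ETarget n') :
    n = n' := by
  cases l <;> simp_all [ETarget]

end Link

namespace Net

/-- The `e`-nodes, including the free variables. -/
def IsNode (G : Net) (n : ℕ ⊕ G.E) : Prop := ∃ l, (G.link l).ESource n ∨ (G.link l).ETarget n

/-- The `e`-node `n` lies in the box of `q`: it is internal to the box, or it is the variable
of `q`. -/
def InBox (G : Net) (q : G.L) (n : ℕ ⊕ G.E) : Prop :=
  (∃ k ∈ G.box q, (G.link k).ESource n) ∨ (G.link q).ParVar n

/-- Embeddings of nets: injections on the links and on the nodes, preserving labels, sources,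
targets, boxes, the root and the names of the free variables, such that all links outside of the
image are weakenings. -/
structure Emb (G G' : Net) where
  onL : G.L → G'.L
  onE : G.E → G'.E
  onM : G.M → G'.M
  injL : Function.Injective onL
  injE : Set.InjOn onE G.eNodes
  injM : Set.InjOn onM G.mNodes
  link_eq : ∀ l, G'.link (onL l) = (G.link l).map (Sum.map id onE) onM
  box_iff : ∀ l k, onL k ∈ G'.box (onL l) ↔ k ∈ G.box l
  root_eq : onE G.root = G'.root
  cover : ∀ l', (∃ l, onL l = l') ∨ (G'.link l').IsWeak

namespace Emb

variable {G G' G'' : Net}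

/-- An embedding on nodes. -/
def onN (f : Emb G G') : ℕ ⊕ G.E → ℕ ⊕ G'.E := Sum.map id f.onE

@[simp] theorem onN_inl (f : Emb G G') (x : ℕ) : f.onN (.inl x) = .inl x := rfl

@[simp] theorem onN_inr (f : Emb G G') (x : G.E) : f.onN (.inr x) = .inr (f.onE x) := rfl

theorem link_onL (f : Emb G G') (l : G.L) : G'.link (f.onL l) = (G.link l).map f.onN f.onM :=
  f.link_eq l

theorem onN_inj (f : Emb G G') {n n' : ℕ ⊕ G.E} (h : G.IsNode n) (h' : G.IsNode n')
    (e : f.onN n = f.onN n') : n = n' := by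
  cases n <;> cases n' <;> simp_all
  exact f.injE h h' e

theorem onM_inj (f : Emb G G') {a b : G.M} (h : a ∈ G.mNodes) (h' : b ∈ G.mNodes)
    (e : f.onM a = f.onM b) : a = b := f.injM h h' e

theorem eSource_iff (f : Emb G G') {n : ℕ ⊕ G.E} (h : G.IsNode n) (l : G.L) :
    (G'.link (f.onL l)).ESource (f.onN n) ↔ (G.link l).ESource n := by
  rw [link_onL, Link.eSource_map]
  constructor
  · rintro ⟨p, hp, e⟩
    rwa [f.onN_inj h ⟨l, .inl hp⟩ e]
  · exact fun h => ⟨n, h, rfl⟩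

theorem eTarget_iff (f : Emb G G') {n : ℕ ⊕ G.E} (h : G.IsNode n) (l : G.L) :
    (G'.link (f.onL l)).ETarget (f.onN n) ↔ (G.link l).ETarget n := by
  rw [link_onL, Link.eTarget_map]
  constructor
  · rintro ⟨p, hp, e⟩
    rwa [f.onN_inj h ⟨l, .inr hp⟩ e]
  · exact fun h => ⟨n, h, rfl⟩

theorem parVar_iff (f : Emb G G') {n : ℕ ⊕ G.E} (h : G.IsNode n) (l : G.L) :
    (G'.link (f.onL l)).ParVar (f.onN n) ↔ (G.link l).ParVar n := by
  rw [link_onL, Link.parVar_map]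
  constructor
  · rintro ⟨p, hp, e⟩
    rwa [f.onN_inj h ⟨l, .inl hp.eSource⟩ e]
  · exact fun h => ⟨n, h, rfl⟩

theorem inBox_iff (f : Emb G G') {n : ℕ ⊕ G.E} (h : G.IsNode n) (q : G.L) :
    G'.InBox (f.onL q) (f.onN n) ↔ G.InBox q n := by
  unfold InBox
  rw [f.parVar_iff h]
  refine or_congr_left ⟨?_, ?_⟩
  · rintro ⟨k, hk, hs⟩
    rcases f.cover k with ⟨k, rfl⟩ | hw
    · exact ⟨k, (f.box_iff _ _).1 hk, (f.eSource_iff h k).1 hs⟩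
    · exact absurd hw hs.not_isWeak
  · rintro ⟨k, hk, hs⟩
    exact ⟨f.onL k, (f.box_iff _ _).2 hk, (f.eSource_iff h k).2 hs⟩

theorem exists_of_not_isWeak (f : Emb G G') {l : G'.L} (h : ¬ (G'.link l).IsWeak) :
    ∃ k, f.onL k = l := (f.cover l).resolve_right h

theorem onE_mem (f : Emb G G') {n : G.E} (h : n ∈ G.eNodes) : f.onE n ∈ G'.eNodes := by
  obtain ⟨l, h⟩ := h
  refine ⟨f.onL l, ?_⟩
  rw [link_onL, Link.eSource_map, Link.eTarget_map]
  exact h.imp (fun h => ⟨_, h, rfl⟩) (fun h => ⟨_, h, rfl⟩)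

theorem onM_mem (f : Emb G G') {n : G.M} (h : n ∈ G.mNodes) : f.onM n ∈ G'.mNodes := by
  obtain ⟨l, h⟩ := h
  refine ⟨f.onL l, ?_⟩
  rw [link_onL, Link.mSource_map, Link.mTarget_map]
  exact h.imp (fun h => ⟨_, h, rfl⟩) (fun h => ⟨_, h, rfl⟩)

/-- The composition of embeddings. -/
def trans (f : Emb G G') (g : Emb G' G'') : Emb G G'' where
  onL := g.onL ∘ f.onL
  onE := g.onE ∘ f.onE
  onM := g.onM ∘ f.onM
  injL := g.injL.comp f.injL
  injE := g.injE.comp f.injE fun _ h => f.onE_mem h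
  injM := g.injM.comp f.injM fun _ h => f.onM_mem h
  link_eq l := by
    simp only [Function.comp, g.link_eq, f.link_eq, Link.map_map]
    congr 1
    funext x; cases x <;> rfl
  box_iff l k := by simp [g.box_iff, f.box_iff]
  root_eq := by simp [f.root_eq, g.root_eq]
  cover l := by
    rcases g.cover l with ⟨l, rfl⟩ | h
    · rcases f.cover l with ⟨l, rfl⟩ | h
      · exact .inl ⟨l, rfl⟩
      · right; rw [g.link_onL]; simpa using h
    · exact .inr h

/-- The identity embedding. -/
def refl (G : Net) : Emb G G where
  onL := id
  onE := id
  onM := id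
  injL := Function.injective_id
  injE := Set.injOn_id _
  injM := Set.injOn_id _
  link_eq l := by cases h : G.link l <;> simp [Link.map, h]
  box_iff _ _ := .rfl
  root_eq := rfl
  cover l := .inl ⟨l, rfl⟩

/-- An embedding that is onto on the links is an isomorphism. -/
noncomputable def toIso (f : Emb G G') (h : Function.Surjective f.onL) : Iso G G' where
  onL := Equiv.ofBijective f.onL ⟨f.injL, h⟩
  onE := f.onE
  onM := f.onM
  injE := f.injE
  injM := f.injM
  link_eq := f.link_eq
  box_iff := f.box_iff
  root_eq := f.root_eq

end Emb

/-- An isomorphism is an embedding. -/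
def Iso.toEmb {G G' : Net} (f : Iso G G') : Emb G G' where
  onL := f.onL
  onE := f.onE
  onM := f.onM
  injL := f.onL.injective
  injE := f.injE
  injM := f.injM
  link_eq := f.link_eq
  box_iff := f.box_iff
  root_eq := f.root_eq
  cover l := .inl ⟨f.onL.symm l, by simp⟩

theorem Equal.trans {G G' G'' : Net} (h : G.Equal G') (h' : G'.Equal G'') : G.Equal G'' := by
  obtain ⟨f⟩ := h
  obtain ⟨g⟩ := h'
  exact ⟨(f.toEmb.trans g.toEmb).toIso (g.onL.surjective.comp f.onL.surjective)⟩

theorem Equal.refl (G : Net) : G.Equal G := ⟨(Emb.refl G).toIso fun l => ⟨l, rfl⟩⟩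

end Net

/-! ### Contraction along embeddings -/

namespace Net

/-- The data of an exponential cut, without conditions on the links on the cut node: an `e`-node
that is the source of a `bang`, and the link on the `m`-target of that `bang`. -/
structure BangCut (G : Net) where
  node : G.E
  bang : G.L
  m : G.M
  below : G.L
  bang_eq : G.link bang = .bang (.inr node) m
  below_src : (G.link below).MSource m

/-- The `bang` and the link below it of an exponential redex. -/
def ECut.toBangCut {G : Net} (c : G.ECut) : G.BangCut where
  node := c.node
  bang := c.bang
  m := c.m
  below := c.below
  bang_eq := c.bang_eq
  below_src := c.below_src

namespace BangCut

variable {G : Net} (c : G.BangCut)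

/-- The links of the content of the `bang`. -/
def H : Set G.L := {l | l = c.below ∨ l ∈ G.box c.below}

/-- The links that are neither the `bang`, nor on the cut node, nor in its content. -/
def Kept (l : G.L) : Prop := l ≠ c.bang ∧ ¬ (G.link l).ETarget (.inr c.node) ∧ l ∉ c.H

/-- The derelictions on the cut node, each with its source. -/
abbrev D : Type := {p : G.L × G.M // G.link p.1 = .der p.2 (.inr c.node)}

/-- The `e`-node `n` belongs to the content of the `bang` and is not one of its targets. -/
def InnerE (n : ℕ ⊕ G.E) : Prop := ∃ l ∈ c.H, (G.link l).ESource n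

/-- The `e`-node `n` is a target of the content of the `bang`. -/
def OuterE (n : ℕ ⊕ G.E) : Prop := (∃ l ∈ c.H, (G.link l).ETarget n) ∧ ¬ c.InnerE n

/-- The `e`-nodes that receive a weakening in the `e`-step. -/
def W : Set (ℕ ⊕ G.E) :=
  {n | IsEmpty c.D ∧ c.OuterE n ∧ ∀ l, c.Kept l → ¬ (G.link l).ETarget n}

open Classical in
/-- The `e`-nodes of the copy of the content for the dereliction `d`. -/
noncomputable def copyE (d : c.D) : ℕ ⊕ G.E → ℕ ⊕ (G.E × Option G.L)
  | .inl x => .inl x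
  | .inr n => .inr (n, if c.InnerE (.inr n) then some d.1.1 else none)

open Classical in
/-- The `m`-nodes of the copy of the content for the dereliction `d`. -/
noncomputable def copyM (d : c.D) (a : G.M) : G.M × Option G.L :=
  if a = c.m then (d.1.2, none) else (a, some d.1.1)

/-- The `e`-step, where the nodes in the given set `W` receive a weakening. -/
noncomputable abbrev contract (W : Set (ℕ ⊕ G.E)) : Net where
  E := G.E × Option G.L
  M := G.M × Option G.L
  L := {l : G.L // c.Kept l} ⊕ ((c.D × {l : G.L // l ∈ c.H}) ⊕ W)
  link
    | .inl l => (G.link l.1).map (Sum.map id (·, none)) (·, none)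
    | .inr (.inl (d, l)) => (G.link l.1).map (c.copyE d) (c.copyM d)
    | .inr (.inr n) => .weak (Sum.map id (·, none) n.1)
  box
    | .inl q => {k | match k with
        | .inl l => l.1 ∈ G.box q.1
        | .inr (.inl (d, _)) => d.1.1 ∈ G.box q.1
        | .inr (.inr n) => (∃ l ∈ G.box q.1, (G.link l).ESource n.1) ∨
            ∃ a b, G.link q.1 = .par a n.1 b}
    | .inr (.inl (d, q)) =>
      {k | ∃ l : {l : G.L // l ∈ c.H}, k = .inr (.inl (d, l)) ∧ l.1 ∈ G.box q.1}
    | .inr (.inr _) => ∅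
  root := (G.root, none)

/-- The `e`-step of a redex puts weakenings on the nodes in `BangCut.W`. -/
theorem contract_toBangCut (c : G.ECut) : c.contract = c.toBangCut.contract c.toBangCut.W := by
  unfold ECut.contract contract
  congr 1
  · funext l
    rcases l with l | l | l <;> rfl
  · funext l
    rcases l with l | l | l
    · funext k
      rcases k with k | k | k <;> rfl
    · rfl
    · rfl

section
variable (W : Set (ℕ ⊕ G.E))

/-- The link of the contracted net that a remaining link becomes. -/
def kept {W : Set (ℕ ⊕ G.E)} (l : G.L) (h : c.Kept l) : (c.contract W).L := .inl ⟨l, h⟩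

/-- The copy for the dereliction `d` of the link `l` of the content. -/
def copy {W : Set (ℕ ⊕ G.E)} (d : c.D) (l : G.L) (h : l ∈ c.H) : (c.contract W).L :=
  .inr (.inl (d, ⟨l, h⟩))

/-- The weakening on a node of `W`. -/
def wk {W : Set (ℕ ⊕ G.E)} (n : ℕ ⊕ G.E) (h : n ∈ W) : (c.contract W).L := .inr (.inr ⟨n, h⟩)

variable {W} {c}

theorem contract_cases {P : (c.contract W).L → Prop} (h₁ : ∀ l h, P (c.kept l h))
    (h₂ : ∀ d l h, P (c.copy d l h)) (h₃ : ∀ n h, P (c.wk n h)) (l) : P l := by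
  rcases l with ⟨l, h⟩ | ⟨d, ⟨l, h⟩⟩ | ⟨n, h⟩
  exacts [h₁ l h, h₂ d l h, h₃ n h]

/-- A node of `G`, as a node of the contracted net. -/
def old : ℕ ⊕ G.E → ℕ ⊕ (G.E × Option G.L) := Sum.map id (·, none)

@[simp] theorem old_inl (x : ℕ) : old (G := G) (.inl x) = .inl x := rfl
@[simp] theorem old_inr (x : G.E) : old (G := G) (.inr x) = .inr (x, none) := rfl

theorem old_injective : Function.Injective (old (G := G)) := by
  intro a b h
  cases a <;> cases b <;> simp_all

theorem link_kept (l h) :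
    (c.contract W).link (c.kept l h) = (G.link l).map old (·, none) := rfl
theorem link_copy (d l h) :
    (c.contract W).link (c.copy d l h) = (G.link l).map (c.copyE d) (c.copyM d) := rfl
theorem link_wk (n h) : (c.contract W).link (c.wk n h) = .weak (old n) := rfl

theorem kept_mem_kept (q hq l hl) :
    c.kept l hl ∈ (c.contract W).box (c.kept q hq) ↔ l ∈ G.box q := .rfl
theorem copy_mem_kept (q hq d l hl) :
    c.copy d l hl ∈ (c.contract W).box (c.kept q hq) ↔ d.1.1 ∈ G.box q := .rfl
theorem wk_mem_kept (q hq n hn) :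
    c.wk n hn ∈ (c.contract W).box (c.kept q hq) ↔ G.InBox q n := by
  unfold InBox
  rw [Link.parVar_iff]
  exact .rfl
theorem kept_mem_copy (d q hq l hl) :
    ¬ c.kept l hl ∈ (c.contract W).box (c.copy d q hq) := by
  rintro ⟨l, h, _⟩
  cases h
theorem copy_mem_copy (d q hq d' l hl) :
    c.copy d' l hl ∈ (c.contract W).box (c.copy d q hq) ↔ d' = d ∧ l ∈ G.box q := by
  constructor
  · rintro ⟨l, h, h'⟩
    cases h
    exact ⟨rfl, h'⟩
  · rintro ⟨rfl, h⟩
    exact ⟨⟨l, hl⟩, rfl, h⟩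
theorem wk_mem_copy (d q hq n hn) :
    ¬ c.wk n hn ∈ (c.contract W).box (c.copy d q hq) := by
  rintro ⟨l, h, _⟩
  cases h
theorem mem_wk (n hn l) : ¬ l ∈ (c.contract W).box (c.wk n hn) := by
  rintro ⟨⟩

theorem copyE_of_inner {d : c.D} {n : G.E} (h : c.InnerE (.inr n)) :
    c.copyE d (.inr n) = .inr (n, some d.1.1) := by
  simp [copyE, h]

theorem copyE_of_not_inner {d : c.D} {n : ℕ ⊕ G.E} (h : ¬ c.InnerE n) :
    c.copyE d n = old n := by
  cases n <;> simp_all [copyE]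

theorem kept_inj {l h l' h'} : (c.kept l h : (c.contract W).L) = c.kept l' h' ↔ l = l' := by
  constructor
  · intro e; cases e; rfl
  · rintro rfl; rfl

theorem copy_inj {d l h d' l' h'} :
    (c.copy d l h : (c.contract W).L) = c.copy d' l' h' ↔ d = d' ∧ l = l' := by
  constructor
  · intro e; cases e; exact ⟨rfl, rfl⟩
  · rintro ⟨rfl, rfl⟩; rfl

theorem wk_inj {n h n' h'} : (c.wk n h : (c.contract W).L) = c.wk n' h' ↔ n = n' := by
  constructor
  · intro e; cases e; rfl
  · rintro rfl; rfl

theorem D.ext {d d' : c.D} (h : d.1.1 = d'.1.1) : d = d' := by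
  obtain ⟨⟨l, m⟩, hd⟩ := d
  obtain ⟨⟨l', m'⟩, hd'⟩ := d'
  simp only at h hd hd'
  subst h
  rw [hd] at hd'
  cases hd'
  rfl

theorem node_isNode (c : G.BangCut) : G.IsNode (.inr c.node) :=
  ⟨c.bang, .inl (by rw [c.bang_eq]; rfl)⟩

theorem m_mem (c : G.BangCut) : c.m ∈ G.mNodes :=
  ⟨c.bang, .inr (by rw [c.bang_eq]; rfl)⟩

end

end BangCut

namespace Emb

variable {G G' : Net} (f : Emb G G')

/-- The image of a cut under an embedding. -/
def mapBang (c : G.BangCut) : G'.BangCut where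
  node := f.onE c.node
  bang := f.onL c.bang
  m := f.onM c.m
  below := f.onL c.below
  bang_eq := by rw [f.link_onL, c.bang_eq]; rfl
  below_src := by rw [f.link_onL, Link.mSource_map]; exact ⟨_, c.below_src, rfl⟩

variable (c : G.BangCut)

theorem mem_mapBang_H (l : G.L) : f.onL l ∈ (f.mapBang c).H ↔ l ∈ c.H := by
  simp [BangCut.H, mapBang, f.box_iff, f.injL.eq_iff]

theorem kept_mapBang (l : G.L) : (f.mapBang c).Kept (f.onL l) ↔ c.Kept l := by
  unfold BangCut.Kept
  rw [f.mem_mapBang_H, show (f.mapBang c).bang = f.onL c.bang from rfl, f.injL.ne_iff,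
    show (Sum.inr (f.mapBang c).node : ℕ ⊕ G'.E) = f.onN (.inr c.node) from rfl,
    f.eTarget_iff c.node_isNode]

theorem innerE_mapBang {n : ℕ ⊕ G.E} (h : G.IsNode n) :
    (f.mapBang c).InnerE (f.onN n) ↔ c.InnerE n := by
  constructor
  · rintro ⟨l, hl, hs⟩
    obtain ⟨l, rfl⟩ := f.exists_of_not_isWeak hs.not_isWeak
    exact ⟨l, (f.mem_mapBang_H c l).1 hl, (f.eSource_iff h l).1 hs⟩
  · rintro ⟨l, hl, hs⟩
    exact ⟨f.onL l, (f.mem_mapBang_H c l).2 hl, (f.eSource_iff h l).2 hs⟩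

/-- The image of a dereliction on the cut node. -/
def mapD (d : c.D) : (f.mapBang c).D :=
  ⟨(f.onL d.1.1, f.onM d.1.2), by rw [f.link_onL, d.2]; rfl⟩

theorem mapD_injective : Function.Injective (f.mapD c) := fun _ _ h =>
  BangCut.D.ext (f.injL (congrArg (fun d => d.1.1) h))

theorem mapD_surjective : Function.Surjective (f.mapD c) := by
  rintro ⟨⟨l, m⟩, hd⟩
  obtain ⟨l, rfl⟩ := f.exists_of_not_isWeak (l := l)
    (by simp only at hd; rw [hd]; simp [Link.IsWeak])
  simp only at hd
  rw [f.link_onL, Link.map_eq_der] at hd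
  obtain ⟨s, t, h, rfl, e⟩ := hd
  rw [show (Sum.inr (f.mapBang c).node : ℕ ⊕ G'.E) = f.onN (.inr c.node) from rfl] at e
  have := f.onN_inj ⟨l, .inr (by rw [h]; rfl)⟩ c.node_isNode e
  subst this
  exact ⟨⟨(l, s), h⟩, rfl⟩

/-- An embedding of nets induces an embedding of the contracted nets.  The elements of `W` have to
be nodes, since embeddings are injective only on those. -/
noncomputable def contractBang {W : Set (ℕ ⊕ G.E)} {W' : Set (ℕ ⊕ G'.E)}
    (hW : ∀ n ∈ W, f.onN n ∈ W' ∧ G.IsNode n) :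
    Emb (c.contract W) ((f.mapBang c).contract W') where
  onL
    | .inl l => .inl ⟨f.onL l.1, (f.kept_mapBang c l.1).2 l.2⟩
    | .inr (.inl (d, l)) => .inr (.inl (f.mapD c d, ⟨f.onL l.1, (f.mem_mapBang_H c l.1).2 l.2⟩))
    | .inr (.inr n) => .inr (.inr ⟨f.onN n.1, (hW n.1 n.2).1⟩)
  onE p := (f.onE p.1, p.2.map f.onL)
  onM p := (f.onM p.1, p.2.map f.onL)
  injL := by
    rintro (l | ⟨d, l⟩ | n) (l' | ⟨d', l'⟩ | n') h
    · simp only [Sum.inl.injEq, Subtype.mk.injEq] at h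
      rw [Subtype.ext (f.injL h)]
    · cases h
    · cases h
    · cases h
    · simp only [Sum.inl.injEq, Sum.inr.injEq, Prod.mk.injEq, Subtype.mk.injEq] at h
      rw [Subtype.ext (f.injL h.2), f.mapD_injective c h.1]
    · cases h
    · cases h
    · cases h
    · simp only [Sum.inr.injEq, Subtype.mk.injEq] at h
      rw [Subtype.ext (f.onN_inj (hW _ n.2).2 (hW _ n'.2).2 h)]
  injE := by
    have key : ∀ p : G.E × Option G.L, p ∈ (c.contract W).eNodes → p.1 ∈ G.eNodes := by
      rintro p ⟨l, h⟩
      induction l using BangCut.contract_cases with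
      | h₁ l hl =>
        rw [BangCut.link_kept, Link.eSource_map, Link.eTarget_map] at h
        rcases h with ⟨n, hn, e⟩ | ⟨n, hn, e⟩ <;> cases n <;> cases e
        · exact ⟨l, .inl hn⟩
        · exact ⟨l, .inr hn⟩
      | h₂ d l hl =>
        rw [BangCut.link_copy, Link.eSource_map, Link.eTarget_map] at h
        rcases h with ⟨n, hn, e⟩ | ⟨n, hn, e⟩ <;> cases n <;> cases e
        · exact ⟨l, .inl hn⟩
        · exact ⟨l, .inr hn⟩
      | h₃ n hn =>
        rw [BangCut.link_wk] at h
        rcases h with h | h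
        · exact h.elim
        · cases n with
          | inl => cases h
          | inr n => cases h; obtain ⟨l, h⟩ := (hW _ hn).2; exact ⟨l, h⟩
    rintro ⟨p, o⟩ hp ⟨q, o'⟩ hq h
    simp only [Prod.mk.injEq] at h
    exact Prod.ext (f.injE (key _ hp) (key _ hq) h.1) (Option.map_injective f.injL h.2)
  injM := by
    have key : ∀ p : G.M × Option G.L, p ∈ (c.contract W).mNodes → p.1 ∈ G.mNodes := by
      rintro p ⟨l, h⟩
      induction l using BangCut.contract_cases with
      | h₁ l hl =>
        rw [BangCut.link_kept, Link.mSource_map, Link.mTarget_map] at h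
        rcases h with ⟨n, hn, rfl⟩ | ⟨n, hn, rfl⟩
        · exact ⟨l, .inl hn⟩
        · exact ⟨l, .inr hn⟩
      | h₂ d l hl =>
        rw [BangCut.link_copy, Link.mSource_map, Link.mTarget_map] at h
        have : ∀ n, (G.link l).MSource n ∨ (G.link l).MTarget n →
            (c.copyM d n).1 ∈ G.mNodes := by
          intro n hn
          unfold BangCut.copyM
          split_ifs
          · exact ⟨d.1.1, .inl (by rw [d.2]; rfl)⟩
          · exact ⟨l, hn⟩
        rcases h with ⟨n, hn, rfl⟩ | ⟨n, hn, rfl⟩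
        · exact this _ (.inl hn)
        · exact this _ (.inr hn)
      | h₃ n hn =>
        rw [BangCut.link_wk] at h
        exact h.elim False.elim False.elim
    rintro ⟨p, o⟩ hp ⟨q, o'⟩ hq h
    simp only [Prod.mk.injEq] at h
    exact Prod.ext (f.injM (key _ hp) (key _ hq) h.1) (Option.map_injective f.injL h.2)
  link_eq l := by
    rcases l with l | ⟨d, l⟩ | n
    · simp only [BangCut.contract, f.link_eq, Link.map_map]
      congr 1
      funext x; cases x <;> rfl
    · simp only [BangCut.contract, f.link_eq, Link.map_map]
      apply Link.map_congr
      · rintro (x | x) hx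
        · rfl
        · simp only [Function.comp, Sum.map_inr, BangCut.copyE]
          have := f.innerE_mapBang c (n := .inr x) ⟨_, hx⟩
          rw [f.onN_inr] at this
          by_cases h : c.InnerE (.inr x)
          · simp [h, this.2 h, mapD]
          · simp [h, mt this.1 h]
      · intro a ha
        simp only [Function.comp, BangCut.copyM]
        rw [show (f.mapBang c).m = f.onM c.m from rfl]
        by_cases h : a = c.m
        · simp [h, mapD]
        · simp [h, mt (f.injM ⟨_, ha⟩ c.m_mem) h, mapD]
    · rcases n with ⟨n | n, hn⟩ <;> rfl
  box_iff q k := by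
    rcases q with q | ⟨d, q⟩ | n <;> rcases k with l | ⟨d', l⟩ | n'
    · exact f.box_iff _ _
    · exact f.box_iff _ _
    · exact ((f.mapBang c).wk_mem_kept (W := W') (f.onL q.1) _ (f.onN n'.1) _).trans
        ((f.inBox_iff (hW _ n'.2).2 _).trans (c.wk_mem_kept q.1 q.2 n'.1 n'.2).symm)
    · exact iff_of_false ((f.mapBang c).kept_mem_copy _ _ _ _ _) (c.kept_mem_copy _ _ _ _ _)
    · refine ((f.mapBang c).copy_mem_copy (W := W') _ _ _ _ _ _).trans
        (Iff.trans ?_ (c.copy_mem_copy d q.1 q.2 d' l.1 l.2).symm)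
      rw [(f.mapD_injective c).eq_iff, f.box_iff]
    · exact iff_of_false ((f.mapBang c).wk_mem_copy _ _ _ _ _) (c.wk_mem_copy _ _ _ _ _)
    all_goals exact iff_of_false (by rintro ⟨⟩) (by rintro ⟨⟩)
  root_eq := by simp [BangCut.contract, f.root_eq]
  cover l := by
    induction l using BangCut.contract_cases with
    | h₁ l hl =>
      rcases f.cover l with ⟨l, rfl⟩ | h
      · exact .inl ⟨c.kept l ((f.kept_mapBang c l).1 hl), rfl⟩
      · right; rw [BangCut.link_kept]; simpa using h
    | h₂ d l hl =>
      rcases f.cover l with ⟨l, rfl⟩ | h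
      · obtain ⟨d, rfl⟩ := f.mapD_surjective c d
        exact .inl ⟨c.copy d l ((f.mem_mapBang_H c l).1 hl), rfl⟩
      · right; rw [BangCut.link_copy]; simpa using h
    | h₃ n hn => right; trivial

theorem contractBang_surjective {W : Set (ℕ ⊕ G.E)} {W' : Set (ℕ ⊕ G'.E)}
    (hW : ∀ n ∈ W, f.onN n ∈ W' ∧ G.IsNode n) (hf : Function.Surjective f.onL)
    (hW' : ∀ n' ∈ W', ∃ n ∈ W, f.onN n = n') :
    Function.Surjective (f.contractBang c hW).onL := by
  intro l
  induction l using BangCut.contract_cases with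
  | h₁ l hl =>
    obtain ⟨l, rfl⟩ := hf l
    exact ⟨c.kept l ((f.kept_mapBang c l).1 hl), rfl⟩
  | h₂ d l hl =>
    obtain ⟨l, rfl⟩ := hf l
    obtain ⟨d, rfl⟩ := f.mapD_surjective c d
    exact ⟨c.copy d l ((f.mem_mapBang_H c l).1 hl), rfl⟩
  | h₃ n hn =>
    obtain ⟨n, hn', rfl⟩ := hW' n hn
    exact ⟨c.wk n hn', rfl⟩

/-- The image of a multiplicative redex under an embedding. -/
def mapMCut (c : G.MCut) : G'.MCut where
  node := f.onM c.node
  tens := f.onL c.tens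
  par := f.onL c.par
  r := f.onN c.r
  arg := f.onN c.arg
  x := f.onN c.x
  body := f.onN c.body
  tens_eq := by rw [f.link_onL, c.tens_eq]; rfl
  par_eq := by rw [f.link_onL, c.par_eq]; rfl

end Emb

namespace MCut

variable {G : Net} (c : G.MCut)

open Classical in
/-- The identification of nodes in the `m`-step. -/
noncomputable def relabel (n : ℕ ⊕ G.E) : ℕ ⊕ G.E :=
  if n = c.x then c.arg else if n = c.body then c.r else n

theorem relabel_of_eq_x {n} (h : n = c.x) : c.relabel n = c.arg := if_pos h

theorem relabel_of_eq_body {n} (h : n ≠ c.x) (h' : n = c.body) : c.relabel n = c.r := by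
  rw [relabel, if_neg h, if_pos h']

theorem relabel_of_ne {n} (h : n ≠ c.x) (h' : n ≠ c.body) : c.relabel n = n := by
  rw [relabel, if_neg h, if_neg h']

theorem link_contract (l : c.contract.L) :
    c.contract.link l = (G.link l.1).map c.relabel id := rfl

theorem x_isNode : G.IsNode c.x := ⟨c.par, .inl (by rw [c.par_eq]; rfl)⟩
theorem body_isNode : G.IsNode c.body := ⟨c.par, .inr (by rw [c.par_eq]; rfl)⟩
theorem arg_isNode : G.IsNode c.arg := ⟨c.tens, .inr (by rw [c.tens_eq]; rfl)⟩
theorem r_isNode : G.IsNode c.r := ⟨c.tens, .inl (by rw [c.tens_eq]; rfl)⟩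

theorem relabel_isNode {n} (h : G.IsNode n) : G.IsNode (c.relabel n) := by
  unfold relabel
  split_ifs
  exacts [c.arg_isNode, c.r_isNode, h]

theorem isNode_of_contract {n : ℕ ⊕ G.E} (h : c.contract.IsNode n) : G.IsNode n := by
  obtain ⟨l, h⟩ := h
  rw [link_contract, Link.eSource_map, Link.eTarget_map] at h
  rcases h with ⟨p, hp, rfl⟩ | ⟨p, hp, rfl⟩
  · exact c.relabel_isNode ⟨_, .inl hp⟩
  · exact c.relabel_isNode ⟨_, .inr hp⟩

theorem mNodes_of_contract {n : G.M} (h : n ∈ c.contract.mNodes) : n ∈ G.mNodes := by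
  obtain ⟨l, h⟩ := h
  rw [link_contract, Link.mSource_map, Link.mTarget_map] at h
  rcases h with ⟨p, hp, rfl⟩ | ⟨p, hp, rfl⟩
  · exact ⟨_, .inl hp⟩
  · exact ⟨_, .inr hp⟩

end MCut

namespace Emb

variable {G G' : Net} (f : Emb G G') (c : G.MCut)

theorem relabel_mapMCut {n : ℕ ⊕ G.E} (h : G.IsNode n) :
    (f.mapMCut c).relabel (f.onN n) = f.onN (c.relabel n) := by
  have h₁ : f.onN n = f.onN c.x ↔ n = c.x :=
    ⟨f.onN_inj h c.x_isNode, congrArg _⟩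
  have h₂ : f.onN n = f.onN c.body ↔ n = c.body :=
    ⟨f.onN_inj h c.body_isNode, congrArg _⟩
  by_cases hx : n = c.x
  · rw [MCut.relabel_of_eq_x _ (h₁.2 hx), c.relabel_of_eq_x hx]
    rfl
  · by_cases hb : n = c.body
    · rw [MCut.relabel_of_eq_body _ (mt h₁.1 hx) (h₂.2 hb), c.relabel_of_eq_body hx hb]
      rfl
    · rw [MCut.relabel_of_ne _ (mt h₁.1 hx) (mt h₂.1 hb), c.relabel_of_ne hx hb]

/-- An embedding of nets induces an embedding of the contracted nets. -/
noncomputable def contractM : Emb c.contract (f.mapMCut c).contract where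
  onL l := ⟨f.onL l.1, by
    simpa [mapMCut, f.injL.eq_iff] using l.2⟩
  onE := f.onE
  onM := f.onM
  injL l l' h := Subtype.ext (f.injL (congrArg Subtype.val h))
  injE a ha b hb h := f.injE (c.isNode_of_contract (n := .inr a) ha)
    (c.isNode_of_contract (n := .inr b) hb) h
  injM a ha b hb h := f.injM (c.mNodes_of_contract ha) (c.mNodes_of_contract hb) h
  link_eq l := by
    rw [MCut.link_contract, MCut.link_contract, f.link_onL, Link.map_map, Link.map_map]
    exact Link.map_congr (fun n hn => f.relabel_mapMCut c ⟨_, hn⟩) (fun _ _ => rfl)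
  box_iff _ _ := f.box_iff _ _
  root_eq := f.root_eq
  cover l := by
    obtain ⟨l, hl⟩ := l
    rcases f.cover l with ⟨l, rfl⟩ | h
    · exact .inl ⟨⟨l, by simpa [mapMCut, f.injL.eq_iff] using hl⟩, rfl⟩
    · right; rw [MCut.link_contract]; simpa using h

theorem contractM_surjective (hf : Function.Surjective f.onL) :
    Function.Surjective (f.contractM c).onL := by
  rintro ⟨l, hl⟩
  obtain ⟨l, rfl⟩ := hf l
  exact ⟨⟨l, by simpa [mapMCut, f.injL.eq_iff] using hl⟩, rfl⟩

end Emb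

end Net

/-! ### Nets are determined by their links other than weakenings -/

namespace Net

/-- The weakenings of `G` are those that the other links force: with free variables `X`, an `e`-node
is a target exactly if it is a free variable or a source other than the root; a weakening is
the only link on its node and lies in the boxes in which its node lies. -/
structure Sat (G : Net) (X : Finset ℕ) : Prop where
  weak_unique : ∀ {l l' n}, (G.link l).IsWeak → (G.link l).ETarget n →
    (G.link l').ETarget n → l' = l
  target_free : ∀ {x}, (∃ l, (G.link l).ETarget (.inl x)) ↔ x ∈ X
  target_inner : ∀ {p}, (∃ l, (G.link l).ETarget (.inr p)) ↔
    p ≠ G.root ∧ ∃ l, (G.link l).ESource (.inr p)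
  weak_box : ∀ {l n}, (G.link l).IsWeak → (G.link l).ETarget n → ∀ q, l ∈ G.box q ↔ G.InBox q n
  box_weak : ∀ {l}, (G.link l).IsWeak → ∀ k, k ∉ G.box l
  root_src : ∃ l, (G.link l).ESource (.inr G.root)

namespace Sat

variable {G₀ G G' : Net} {X : Finset ℕ}

/-- If both nets satisfy `Sat`, then a node that carries a weakening in one of them also does so in
the other: whether a node is a target does not depend on the net, and the links other than
weakenings are common. -/
theorem exists_weak (f : Emb G₀ G) (f' : Emb G₀ G') (hw : ∀ l, ¬ (G₀.link l).IsWeak)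
    (hr : G₀.root ∈ G₀.eNodes) (h : G.Sat X) (h' : G'.Sat X) {n : ℕ ⊕ G₀.E}
    (hn : ∀ p, n = .inr p → p ∈ G₀.eNodes) {l : G.L} (hl : (G.link l).IsWeak)
    (hln : (G.link l).ETarget (f.onN n)) :
    ∃ l', (G'.link l').IsWeak ∧ (G'.link l').ETarget (f'.onN n) := by
  have : ∃ l', (G'.link l').ETarget (f'.onN n) := by
    rcases n with x | p
    · exact h'.target_free.2 (h.target_free.1 ⟨l, hln⟩)
    · have hp : p ∈ G₀.eNodes := hn p rfl
      obtain ⟨h₁, l₁, h₂⟩ := h.target_inner.1 ⟨l, hln⟩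
      refine h'.target_inner.2 ⟨fun e => h₁ ?_, ?_⟩
      · rw [← f'.root_eq] at e
        rw [f'.injE hp hr e, f.root_eq]
      · obtain ⟨k, rfl⟩ := f.exists_of_not_isWeak h₂.not_isWeak
        exact ⟨f'.onL k, (f'.eSource_iff hp k).2 ((f.eSource_iff (n := .inr p) hp k).1 h₂)⟩
  obtain ⟨l', hl'⟩ := this
  by_cases hw' : (G'.link l').IsWeak
  · exact ⟨l', hw', hl'⟩
  · obtain ⟨k, rfl⟩ := f'.exists_of_not_isWeak hw'
    rw [f'.link_onL, Link.eTarget_map] at hl'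
    obtain ⟨m, hm, e⟩ := hl'
    have : m = n := by
      rcases n with x | p
      · rcases m with y | q
        · exact congrArg _ (Sum.inl.inj e).symm
        · cases e
      · exact (f'.onN_inj (hn p rfl) ⟨k, .inr hm⟩ e).symm
    subst this
    have hk : (G.link (f.onL k)).ETarget (f.onN m) := (f.eTarget_iff ⟨k, .inr hm⟩ k).2 hm
    have := h.weak_unique hl hln hk
    subst this
    rw [f.link_onL, Link.isWeak_map] at hl
    exact absurd hl (hw k)

/-- A node that is only on weakenings is a free variable, so that all nodes are in the image. -/
theorem exists_preimage (f : Emb G₀ G) (h : G.Sat X) {n : ℕ ⊕ G.E} (hn : G.IsNode n) :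
    ∃ m, (∀ p, m = .inr p → p ∈ G₀.eNodes) ∧ f.onN m = n := by
  rcases n with x | p
  · exact ⟨.inl x, by simp, rfl⟩
  · have : ∃ l, (G.link l).ESource (.inr p) := by
      obtain ⟨l, hl | hl⟩ := hn
      · exact ⟨l, hl⟩
      · exact (h.target_inner.1 ⟨l, hl⟩).2
    obtain ⟨l, hl⟩ := this
    obtain ⟨k, rfl⟩ := f.exists_of_not_isWeak hl.not_isWeak
    rw [f.link_onL, Link.eSource_map] at hl
    obtain ⟨m, hm, e⟩ := hl
    exact ⟨m, fun p hp => ⟨k, .inl (hp ▸ hm)⟩, e.symm⟩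

theorem onN_eq (f : Emb G₀ G) {m m' : ℕ ⊕ G₀.E} (h : ∀ p, m = .inr p → p ∈ G₀.eNodes)
    (h' : ∀ p, m' = .inr p → p ∈ G₀.eNodes) (e : f.onN m = f.onN m') : m = m' := by
  rcases m with x | p <;> rcases m' with y | q
  · exact congrArg _ (Sum.inl.inj e)
  · cases e
  · cases e
  · rw [f.injE (h p rfl) (h' q rfl) (Sum.inr.inj e)]

theorem nonempty_M (h : G.Sat X) : Nonempty G.M := by
  obtain ⟨l, hl⟩ := h.root_src
  cases e : G.link l <;> rw [e] at hl <;> first | exact ⟨‹_›⟩ | exact hl.elim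

/-- Two nets with the same free variables that satisfy `Sat` are equal if their links other than
weakenings form the same net. -/
theorem equal (f : Emb G₀ G) (f' : Emb G₀ G') (hw : ∀ l, ¬ (G₀.link l).IsWeak)
    (hr : G₀.root ∈ G₀.eNodes) (h : G.Sat X) (h' : G'.Sat X) : G.Equal G' := by
  classical
  have hM := h'.nonempty_M
  -- The maps on the nodes, with an arbitrary value at the elements that are not nodes.
  let g : G.E → G'.E := fun p =>
    if hp : ∃ p₀ ∈ G₀.eNodes, f.onE p₀ = p then f'.onE hp.choose else G'.root
  have hg : ∀ p₀ ∈ G₀.eNodes, g (f.onE p₀) = f'.onE p₀ := by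
    intro p₀ hp₀
    have hp : ∃ p₁ ∈ G₀.eNodes, f.onE p₁ = f.onE p₀ := ⟨p₀, hp₀, rfl⟩
    simp only [g, dif_pos hp]
    rw [f.injE hp.choose_spec.1 hp₀ hp.choose_spec.2]
  let gM : G.M → G'.M := fun a =>
    if ha : ∃ a₀ ∈ G₀.mNodes, f.onM a₀ = a then f'.onM ha.choose else hM.some
  have hgM : ∀ a₀ ∈ G₀.mNodes, gM (f.onM a₀) = f'.onM a₀ := by
    intro p₀ hp₀
    have hp : ∃ p₁ ∈ G₀.mNodes, f.onM p₁ = f.onM p₀ := ⟨p₀, hp₀, rfl⟩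
    simp only [gM, dif_pos hp]
    rw [f.injM hp.choose_spec.1 hp₀ hp.choose_spec.2]
  let gN : ℕ ⊕ G.E → ℕ ⊕ G'.E := Sum.map id g
  have hgN : ∀ m : ℕ ⊕ G₀.E, (∀ p, m = .inr p → p ∈ G₀.eNodes) → gN (f.onN m) = f'.onN m := by
    rintro (x | p) hm
    · rfl
    · exact congrArg _ (hg p (hm p rfl))
  -- A link of the common part goes to its copy, a weakening to the weakening on the same node.
  have hF : ∀ l, ∃ l', (∃ k, f.onL k = l ∧ f'.onL k = l') ∨ ((G.link l).IsWeak ∧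
      (G'.link l').IsWeak ∧ ∃ m, (∀ p, m = .inr p → p ∈ G₀.eNodes) ∧
        (G.link l).ETarget (f.onN m) ∧ (G'.link l').ETarget (f'.onN m)) := by
    intro l
    rcases f.cover l with ⟨k, rfl⟩ | hl
    · exact ⟨f'.onL k, .inl ⟨k, rfl, rfl⟩⟩
    · obtain ⟨n, e⟩ := Link.isWeak_iff.1 hl
      have hn : (G.link l).ETarget n := by rw [e]; rfl
      obtain ⟨m, hm, rfl⟩ := exists_preimage f h ⟨l, .inr hn⟩
      obtain ⟨l', h₁, h₂⟩ := exists_weak f f' hw hr h h' hm hl hn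
      exact ⟨l', .inr ⟨hl, h₁, m, hm, hn, h₂⟩⟩
  choose F hF using hF
  have hFk : ∀ k, F (f.onL k) = f'.onL k := by
    intro k
    rcases hF (f.onL k) with ⟨k', e, e'⟩ | ⟨hl, _⟩
    · rw [← e', f.injL e]
    · rw [f.link_onL, Link.isWeak_map] at hl
      exact absurd hl (hw k)
  have hinj : Function.Injective F := by
    intro l₁ l₂ e
    rcases hF l₁ with ⟨k₁, rfl, e₁⟩ | ⟨h₁, h₁', m₁, hm₁, ht₁, ht₁'⟩ <;>
      rcases hF l₂ with ⟨k₂, rfl, e₂⟩ | ⟨h₂, h₂', m₂, hm₂, ht₂, ht₂'⟩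
    · rw [← e₁, ← e₂] at e
      rw [f'.injL e]
    · rw [← e, ← e₁, f'.link_onL, Link.isWeak_map] at h₂'
      exact absurd h₂' (hw k₁)
    · rw [e, ← e₂, f'.link_onL, Link.isWeak_map] at h₁'
      exact absurd h₁' (hw k₂)
    · rw [e] at ht₁'
      have := onN_eq f' hm₁ hm₂ (ht₁'.unique ht₂')
      subst this
      exact h.weak_unique h₂ ht₂ ht₁
  have hsurj : Function.Surjective F := by
    intro l'
    rcases f'.cover l' with ⟨k, rfl⟩ | hl'
    · exact ⟨f.onL k, hFk k⟩
    · obtain ⟨n, e⟩ := Link.isWeak_iff.1 hl'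
      have hn : (G'.link l').ETarget n := by rw [e]; rfl
      obtain ⟨m, hm, rfl⟩ := exists_preimage f' h' ⟨l', .inr hn⟩
      obtain ⟨l, h₁, h₂⟩ := exists_weak f' f hw hr h' h hm hl' hn
      refine ⟨l, ?_⟩
      rcases hF l with ⟨k, rfl, _⟩ | ⟨_, _, m', hm', h₃, h₄⟩
      · rw [f.link_onL, Link.isWeak_map] at h₁
        exact absurd h₁ (hw k)
      · have := onN_eq f hm hm' (h₂.unique h₃)
        subst this
        exact h'.weak_unique hl' hn h₄
  refine ⟨⟨Equiv.ofBijective F ⟨hinj, hsurj⟩, g, gM, ?_, ?_, ?_, ?_, ?_⟩⟩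
  · intro p hp q hq e
    obtain ⟨p₀, hp₀, rfl⟩ : ∃ p₀ ∈ G₀.eNodes, f.onE p₀ = p := by
      obtain ⟨m, hm, e⟩ := exists_preimage f h (n := .inr p) hp
      rcases m with x | p₀
      · cases e
      · exact ⟨p₀, hm _ rfl, Sum.inr.inj e⟩
    obtain ⟨q₀, hq₀, rfl⟩ : ∃ p₀ ∈ G₀.eNodes, f.onE p₀ = q := by
      obtain ⟨m, hm, e⟩ := exists_preimage f h (n := .inr q) hq
      rcases m with x | p₀
      · cases e
      · exact ⟨p₀, hm _ rfl, Sum.inr.inj e⟩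
    rw [hg _ hp₀, hg _ hq₀] at e
    rw [f'.injE hp₀ hq₀ e]
  · have key : ∀ a ∈ G.mNodes, ∃ a₀ ∈ G₀.mNodes, f.onM a₀ = a := by
      rintro a ⟨l, hl⟩
      obtain ⟨k, rfl⟩ := f.exists_of_not_isWeak (hl.elim Link.MSource.not_isWeak
        Link.MTarget.not_isWeak)
      rw [f.link_onL, Link.mSource_map, Link.mTarget_map] at hl
      rcases hl with ⟨b, hb, e⟩ | ⟨b, hb, e⟩
      · exact ⟨b, ⟨k, .inl hb⟩, e.symm⟩
      · exact ⟨b, ⟨k, .inr hb⟩, e.symm⟩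
    intro p hp q hq e
    obtain ⟨p₀, hp₀, rfl⟩ := key p hp
    obtain ⟨q₀, hq₀, rfl⟩ := key q hq
    rw [hgM _ hp₀, hgM _ hq₀] at e
    rw [f'.injM hp₀ hq₀ e]
  · intro l
    change G'.link (F l) = (G.link l).map gN gM
    rcases hF l with ⟨k, rfl, e⟩ | ⟨h₁, h₂, m, hm, h₃, h₄⟩
    · rw [← e, f.link_onL, f'.link_onL, Link.map_map]
      refine Link.map_congr (fun n hn => ?_) (fun a ha => ?_)
      · exact (hgN n fun p hp => ⟨k, hp ▸ hn⟩).symm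
      · exact (hgM a ⟨k, ha⟩).symm
    · obtain ⟨n, e⟩ := Link.isWeak_iff.1 h₁
      obtain ⟨n', e'⟩ := Link.isWeak_iff.1 h₂
      rw [e] at h₃ ⊢
      rw [e'] at h₄ ⊢
      have h₃ : f.onN m = n := h₃
      have h₄ : f'.onN m = n' := h₄
      rw [← h₃, ← h₄, ← hgN m hm]
      rfl
  · intro q l
    change F l ∈ G'.box (F q) ↔ _
    rcases hF q with ⟨k, rfl, e⟩ | ⟨h₁, h₂, _⟩
    · rw [← e]
      rcases hF l with ⟨k', rfl, e'⟩ | ⟨h₁, h₂, m, hm, h₃, h₄⟩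
      · rw [← e', f.box_iff, f'.box_iff]
      · rw [h.weak_box h₁ h₃, h'.weak_box h₂ h₄]
        -- A node on a weakening may be a free variable that does not occur in the common part; it
        -- is in no box.
        have hin : G₀.IsNode m ∨ ∃ x, m = .inl x := by
          rcases m with x | p
          · exact .inr ⟨x, rfl⟩
          · exact .inl (hm p rfl)
        by_cases hm' : G₀.IsNode m
        · rw [f.inBox_iff hm', f'.inBox_iff hm']
        · obtain ⟨x, rfl⟩ := hin.resolve_left hm'
          have aux : ∀ {G₁ : Net} (f₁ : Emb G₀ G₁) (q : G₀.L), ¬ G₁.InBox (f₁.onL q) (.inl x) := by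
            rintro G₁ f₁ q (⟨l, _, hl⟩ | hl)
            · obtain ⟨l, rfl⟩ := f₁.exists_of_not_isWeak hl.not_isWeak
              rw [f₁.link_onL, Link.eSource_map] at hl
              obtain ⟨n | n, h₁, h₂⟩ := hl
              · cases h₂; exact hm' ⟨l, .inl h₁⟩
              · cases h₂
            · rw [f₁.link_onL, Link.parVar_map] at hl
              obtain ⟨n | n, h₁, h₂⟩ := hl
              · cases h₂; exact hm' ⟨_, .inl h₁.eSource⟩
              · cases h₂
          exact iff_of_false (aux f' _) (aux f _)
    · exact iff_of_false (h'.box_weak h₂ _) (h.box_weak h₁ _)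
  · rw [← f.root_eq, hg _ hr, f'.root_eq]

end Sat

end Net

/-! ### Contraction preserves the placement of the weakenings -/

namespace Net

namespace BangCut

variable {G : Net} (c : G.BangCut)

/-- The inner nodes of the content are those in the box of the link below the `bang`; if that link
is a dereliction, there are none. -/
theorem innerE_iff {n} : c.InnerE n ↔ G.InBox c.below n := by
  constructor
  · rintro ⟨l, rfl | hl, hs⟩
    · right
      have hm := c.below_src
      cases e : G.link c.below <;> rw [e] at hs hm <;>
        first | exact hm.elim | exact hs.elim | exact hs
    · exact .inl ⟨l, hl, hs⟩
  · rintro (⟨l, hl, hs⟩ | hp)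
    · exact ⟨l, .inr hl, hs⟩
    · exact ⟨c.below, .inl rfl, hp.eSource⟩

/-- A node with a source that is neither the cut node nor inside of the content keeps its source. -/
theorem kept_of_source
    (hc : ∀ l, (G.link l).ETarget (.inr c.node) → (G.link l).ETargetPrincipal)
    {n l} (hn : n ≠ .inr c.node) (hi : ¬ c.InnerE n) (hl : (G.link l).ESource n) : c.Kept l := by
  refine ⟨?_, fun ht => hl.not_principal (hc l ht), fun hH => hi ⟨l, hH, hl⟩⟩
  rintro rfl
  rw [c.bang_eq] at hl
  exact hn hl

/-- The nodes outside of the content are still targets after the `e`-step. -/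
theorem exists_target {n l} (hn : n ≠ .inr c.node) (hi : ¬ c.InnerE n)
    (hl : (G.link l).ETarget n) : ∃ l', ((c.contract c.W).link l').ETarget (BangCut.old n) := by
  by_cases hk : ∃ k, c.Kept k ∧ (G.link k).ETarget n
  · obtain ⟨k, hk, ht⟩ := hk
    refine ⟨c.kept k hk, ?_⟩
    rw [BangCut.link_kept, Link.eTarget_map]
    exact ⟨n, ht, rfl⟩
  · have hlH : l ∈ c.H := by
      by_contra hH
      refine hk ⟨l, ⟨?_, fun ht => hn (hl.unique ht), hH⟩, hl⟩
      rintro rfl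
      rw [c.bang_eq] at hl
      exact hl
    rcases isEmpty_or_nonempty c.D with hD | ⟨⟨d⟩⟩
    · exact ⟨c.wk n ⟨hD, ⟨⟨l, hlH, hl⟩, hi⟩, fun k hk' ht => hk ⟨k, hk', ht⟩⟩, rfl⟩
    · refine ⟨c.copy d l hlH, ?_⟩
      rw [BangCut.link_copy, Link.eTarget_map]
      exact ⟨n, hl, (BangCut.copyE_of_not_inner hi).symm⟩

end BangCut

/-- The structural properties of the nets of terms with free variables `X` that cut elimination
relies on. -/
structure WF (G : Net) (X : Finset ℕ) : Prop where
  target_free : ∀ {x}, (∃ l, (G.link l).ETarget (.inl x)) ↔ x ∈ X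
  target_inner : ∀ {p}, (∃ l, (G.link l).ETarget (.inr p)) ↔
    p ≠ G.root ∧ ∃ l, (G.link l).ESource (.inr p)
  root_src : ∃ l, (G.link l).ESource (.inr G.root)
  /-- A link lies in all the boxes in which its target lies, apart from the box that it opens. -/
  mem_of_inBox : ∀ {l n q}, (G.link l).ETarget n → G.InBox q n →
    l ∈ G.box q ∨ (l = q ∧ (G.link l).IsPar)
  /-- Only derelictions exit boxes. -/
  inBox_of_mem : ∀ {l n q}, (G.link l).ETarget n → ¬ (G.link l).IsDer →
    l ∈ G.box q ∨ (l = q ∧ (G.link l).IsPar) → G.InBox q n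
  /-- The links above and below an `m`-node lie in the same boxes. -/
  mBox : ∀ {a l l'}, (G.link l).MTarget a → (G.link l').MSource a →
    ∀ q, l ∈ G.box q ↔ l' ∈ G.box q
  irrefl : ∀ {l}, l ∉ G.box l
  isPar_of_mem : ∀ {k l}, k ∈ G.box l → (G.link l).IsPar
  eSource_unique : ∀ {n l l'}, (G.link l).ESource n → (G.link l').ESource n → l = l'
  mSource_unique : ∀ {a l l'}, (G.link l).MSource a → (G.link l').MSource a → l = l'
  mTarget_unique : ∀ {a l l'}, (G.link l).MTarget a → (G.link l').MTarget a → l = l'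
  no_free : ∀ {x l}, ¬ (G.link l).ESource (.inl x)
  /-- Only derelictions share their target. -/
  target_unique : ∀ {n l l'}, (G.link l).ETarget n → ¬ (G.link l).IsDer →
    (G.link l').ETarget n → l' = l
  free_principal : ∀ {x l}, (G.link l).ETarget (.inl x) → (G.link l).ETargetPrincipal
  root_not_inBox : ∀ {q}, ¬ G.InBox q (.inr G.root)
  no_loop : ∀ {l n}, (G.link l).ESource n → ¬ (G.link l).ETarget n
  /-- No dereliction in what is below a `bang` or a `tens` is on the source of that link. -/
  acyclic : ∀ {l k h m n}, (G.link l).ESource n → (G.link l).MTarget m → (G.link k).MSource m →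
    (h = k ∨ h ∈ G.box k) → (G.link h).IsDer → ¬ (G.link h).ETarget n

namespace WF

variable {G : Net} {X : Finset ℕ}

theorem weak_box (h : G.WF X) {l n} (hl : (G.link l).IsWeak) (hn : (G.link l).ETarget n) (q) :
    l ∈ G.box q ↔ G.InBox q n := by
  refine ⟨fun hq => h.inBox_of_mem hn hl.not_isDer (.inl hq), fun hq => ?_⟩
  rcases h.mem_of_inBox hn hq with hq | ⟨_, hp⟩
  · exact hq
  · exact absurd hl hp.not_isWeak

theorem toSat (h : G.WF X) : G.Sat X where
  weak_unique hl hn hn' := h.target_unique hn hl.not_isDer hn'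
  target_free := h.target_free
  target_inner := h.target_inner
  weak_box hl hn q := h.weak_box hl hn q
  box_weak hl _ hk := (h.isPar_of_mem hk).not_isWeak hl
  root_src := h.root_src

section Bang

variable (c : G.BangCut)

/-- All the links on an inner node of the content belong to the content. -/
theorem mem_H_of_target (h : G.WF X) {n l} (hn : c.InnerE n) (hl : (G.link l).ETarget n) :
    l ∈ c.H := by
  rcases h.mem_of_inBox hl ((c.innerE_iff).1 hn) with h | ⟨h, _⟩
  · exact .inr h
  · exact .inl h

theorem inner_of_weak (h : G.WF X) {n l} (hw : (G.link l).IsWeak) (hn : (G.link l).ETarget n)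
    (hl : l ∈ c.H) : c.InnerE n := by
  rcases hl with rfl | hl
  · exact absurd hw c.below_src.not_isWeak
  · exact (c.innerE_iff).2 ((h.weak_box hw hn _).1 hl)

theorem eSource_node (h : G.WF X) {l} (hl : (G.link l).ESource (.inr c.node)) : l = c.bang :=
  h.eSource_unique hl (by rw [c.bang_eq]; rfl)

theorem bang_notMem_H (h : G.WF X) : c.bang ∉ c.H := by
  rintro (e | hb)
  · have := c.below_src
    rw [← e, c.bang_eq] at this
    exact this
  · exact h.irrefl ((h.mBox (a := c.m) (by rw [c.bang_eq]; rfl) c.below_src _).1 hb)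

/-- The content of the `bang` is not on the cut node. -/
theorem not_target_of_mem_H (h : G.WF X) {l} (hl : l ∈ c.H) :
    ¬ (G.link l).ETarget (.inr c.node) := by
  intro ht
  by_cases hd : (G.link l).IsDer
  · exact h.acyclic (m := c.m)
      (by rw [c.bang_eq]; rfl) (by rw [c.bang_eq]; rfl) c.below_src hl hd ht
  · have : G.InBox c.below (.inr c.node) := by
      apply h.inBox_of_mem ht hd
      rcases hl with rfl | hl
      · right
        have hm := c.below_src
        refine ⟨rfl, ?_⟩
        cases e : G.link c.below <;> rw [e] at hd hm <;>
          first | exact hm.elim | exact (hd trivial).elim | trivial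
      · exact .inl hl
    obtain ⟨k, hk, hs⟩ := (c.innerE_iff).2 this
    rw [h.eSource_node c hs] at hk
    exact h.bang_notMem_H c hk

theorem source_of_kept (h : G.WF X) {n l} (hl : c.Kept l) (hs : (G.link l).ESource n) :
    n ≠ .inr c.node ∧ ¬ c.InnerE n := by
  refine ⟨?_, ?_⟩
  · rintro rfl
    exact hl.1 (h.eSource_node c hs)
  · rintro ⟨k, hk, hs'⟩
    rw [h.eSource_unique hs' hs] at hk
    exact hl.2.2 hk

theorem target_of_kept (h : G.WF X) {n l} (hl : c.Kept l) (ht : (G.link l).ETarget n) :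
    n ≠ .inr c.node ∧ ¬ c.InnerE n :=
  ⟨by rintro rfl; exact hl.2.1 ht, fun hi => hl.2.2 (h.mem_H_of_target c hi ht)⟩

/-- The weakenings after the `e`-step are those that the other links force.  A target of the content
keeps a link unless the content is erased and all its links were in the content, and then it
receives a weakening; inner nodes, with the links on them, are copied as a whole. -/
theorem sat_contract_bang (h : G.WF X)
    (hc : ∀ l, (G.link l).ETarget (.inr c.node) → (G.link l).ETargetPrincipal)
    (hr : c.node ≠ G.root) : (c.contract c.W).Sat X where
  weak_unique {l l' n} hw ht ht' := by
    induction l using BangCut.contract_cases with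
    | h₁ l hl =>
      rw [BangCut.link_kept, Link.isWeak_map] at hw
      rw [BangCut.link_kept, Link.eTarget_map] at ht
      obtain ⟨p, hp, rfl⟩ := ht
      obtain ⟨_, hi⟩ := h.target_of_kept c hl hp
      induction l' using BangCut.contract_cases with
      | h₁ l' hl' =>
        rw [BangCut.link_kept, Link.eTarget_map] at ht'
        obtain ⟨p', hp', e⟩ := ht'
        rw [← BangCut.old_injective e] at hp'
        rw [BangCut.kept_inj]
        exact h.target_unique hp hw.not_isDer hp'
      | h₂ d l' hl' =>
        rw [BangCut.link_copy, Link.eTarget_map] at ht'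
        obtain ⟨p', hp', e⟩ := ht'
        by_cases hi' : c.InnerE p'
        · rcases p' with x | p'
          · obtain ⟨k, _, hk⟩ := hi'
            exact (h.no_free hk).elim
          · rw [BangCut.copyE_of_inner hi'] at e
            rcases p with _ | p <;> cases e
        · rw [BangCut.copyE_of_not_inner hi'] at e
          rw [← BangCut.old_injective e] at hp'
          rw [h.target_unique hp hw.not_isDer hp'] at hl'
          exact (hl.2.2 hl').elim
      | h₃ n hn =>
        rw [← BangCut.old_injective (show BangCut.old p = BangCut.old n from ht')] at hn
        exact (hn.2.2 l hl hp).elim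
    | h₂ d l hl =>
      rw [BangCut.link_copy, Link.isWeak_map] at hw
      rw [BangCut.link_copy, Link.eTarget_map] at ht
      obtain ⟨p, hp, rfl⟩ := ht
      have hi := h.inner_of_weak c hw hp hl
      rcases p with x | p
      · obtain ⟨k, _, hk⟩ := hi
        exact (h.no_free hk).elim
      rw [BangCut.copyE_of_inner hi] at ht'
      induction l' using BangCut.contract_cases with
      | h₁ l' hl' =>
        rw [BangCut.link_kept, Link.eTarget_map] at ht'
        obtain ⟨p' | p', hp', e⟩ := ht' <;> cases e
      | h₂ d' l' hl' =>
        rw [BangCut.link_copy, Link.eTarget_map] at ht'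
        obtain ⟨p' | p', hp', e⟩ := ht'
        · cases e
        · by_cases hi' : c.InnerE (.inr p')
          · rw [BangCut.copyE_of_inner hi'] at e
            simp only [Sum.inr.injEq, Prod.mk.injEq, Option.some.injEq] at e
            obtain ⟨rfl, e⟩ := e
            rw [BangCut.copy_inj]
            exact ⟨BangCut.D.ext e.symm, h.target_unique hp hw.not_isDer hp'⟩
          · rw [BangCut.copyE_of_not_inner hi'] at e
            cases e
      | h₃ n hn =>
        have e : Sum.inr (p, some d.1.1) = BangCut.old n := ht'
        rcases n with n | n <;> cases e
    | h₃ m hm =>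
      have e : n = BangCut.old m := ht
      subst e
      induction l' using BangCut.contract_cases with
      | h₁ l' hl' =>
        rw [BangCut.link_kept, Link.eTarget_map] at ht'
        obtain ⟨p', hp', e⟩ := ht'
        rw [← BangCut.old_injective e] at hp'
        exact (hm.2.2 l' hl' hp').elim
      | h₂ d' l' hl' => exact (hm.1.false d').elim
      | h₃ n hn =>
        rw [BangCut.wk_inj]
        exact (BangCut.old_injective (show BangCut.old m = BangCut.old n from ht')).symm
  target_free {x} := by
    constructor
    · rintro ⟨l, hl⟩
      rw [← h.target_free]
      induction l using BangCut.contract_cases with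
      | h₁ l _ =>
        rw [BangCut.link_kept, Link.eTarget_map] at hl
        obtain ⟨p | p, hp, e⟩ := hl <;> cases e
        exact ⟨l, hp⟩
      | h₂ d l _ =>
        rw [BangCut.link_copy, Link.eTarget_map] at hl
        obtain ⟨p | p, hp, e⟩ := hl <;> cases e
        exact ⟨l, hp⟩
      | h₃ n hn =>
        have e : Sum.inl x = BangCut.old n := hl
        rcases n with n | n <;> cases e
        obtain ⟨_, ⟨⟨k, _, hk⟩, _⟩, _⟩ := hn
        exact ⟨k, hk⟩
    · intro hx
      obtain ⟨l, hl⟩ := h.target_free.2 hx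
      refine c.exists_target (n := .inl x) (by simp) ?_ hl
      rintro ⟨k, _, hk⟩
      exact h.no_free hk
  target_inner {p} := by
    obtain ⟨p, o⟩ := p
    constructor
    · rintro ⟨l, hl⟩
      have key : ∀ {l}, (G.link l).ETarget (.inr p) → p ≠ c.node → ¬ c.InnerE (.inr p) →
          o = none → (p, o) ≠ (c.contract c.W).root ∧
            ∃ l, ((c.contract c.W).link l).ESource (.inr (p, o)) := by
        rintro l hl' hn hi rfl
        obtain ⟨hpr, k, hk⟩ := h.target_inner.1 ⟨l, hl'⟩
        refine ⟨fun e => hpr (congrArg Prod.fst e),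
          c.kept k (c.kept_of_source hc (by simpa using hn) hi hk), ?_⟩
        rw [BangCut.link_kept, Link.eSource_map]
        exact ⟨_, hk, rfl⟩
      induction l using BangCut.contract_cases with
      | h₁ l hl' =>
        rw [BangCut.link_kept, Link.eTarget_map] at hl
        obtain ⟨p | p, hp, e⟩ := hl <;> cases e
        obtain ⟨h₁, h₂⟩ := h.target_of_kept c hl' hp
        exact key hp (by simpa using h₁) h₂ rfl
      | h₂ d l hl' =>
        rw [BangCut.link_copy, Link.eTarget_map] at hl
        obtain ⟨q | q, hp, e⟩ := hl
        · cases e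
        · by_cases hi : c.InnerE (.inr q)
          · rw [BangCut.copyE_of_inner hi] at e
            cases e
            refine ⟨fun e => ?_, ?_⟩
            · cases congrArg Prod.snd e
            · obtain ⟨k, hk, hs⟩ := hi
              refine ⟨c.copy d k hk, ?_⟩
              rw [BangCut.link_copy, Link.eSource_map]
              exact ⟨_, hs, (BangCut.copyE_of_inner ⟨k, hk, hs⟩).symm⟩
          · rw [BangCut.copyE_of_not_inner hi] at e
            cases e
            refine key hp ?_ hi rfl
            rintro rfl
            exact h.not_target_of_mem_H c hl' hp
      | h₃ n hn =>
        have e : Sum.inr (p, o) = BangCut.old n := hl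
        rcases n with n | n <;> cases e
        obtain ⟨_, ⟨⟨k, hk, ht⟩, hi⟩, _⟩ := hn
        refine key ht ?_ hi rfl
        rintro rfl
        exact h.not_target_of_mem_H c hk ht
    · rintro ⟨hpr, l, hl⟩
      induction l using BangCut.contract_cases with
      | h₁ l hl' =>
        rw [BangCut.link_kept, Link.eSource_map] at hl
        obtain ⟨p | p, hp, e⟩ := hl <;> cases e
        obtain ⟨h₁, h₂⟩ := h.source_of_kept c hl' hp
        obtain ⟨k, hk⟩ := h.target_inner.2 ⟨fun e => hpr (by rw [e]), l, hp⟩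
        exact c.exists_target h₁ h₂ hk
      | h₂ d l hl' =>
        rw [BangCut.link_copy, Link.eSource_map] at hl
        obtain ⟨q | q, hp, e⟩ := hl
        · cases e
        · have hi : c.InnerE (.inr q) := ⟨l, hl', hp⟩
          rw [BangCut.copyE_of_inner hi] at e
          cases e
          have hpr : p ≠ G.root := by
            rintro rfl
            exact h.root_not_inBox ((c.innerE_iff).1 hi)
          obtain ⟨k, hk⟩ := h.target_inner.2 ⟨hpr, l, hp⟩
          refine ⟨c.copy d k (h.mem_H_of_target c hi hk), ?_⟩
          rw [BangCut.link_copy, Link.eTarget_map]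
          exact ⟨_, hk, (BangCut.copyE_of_inner hi).symm⟩
      | h₃ n hn => exact hl.elim
  weak_box {l n} hw ht q := by
    -- The boxes of an old node, of the copies, and of the new weakenings.
    have key : ∀ (p : ℕ ⊕ G.E) (hi : ¬ c.InnerE p) (hpn : p ≠ .inr c.node) (q hq),
        (c.contract c.W).InBox (c.kept q hq) (BangCut.old p) ↔ G.InBox q p := by
      intro p hi hpn q hq
      constructor
      · rintro (⟨k, hk, hs⟩ | hp)
        · induction k using BangCut.contract_cases with
          | h₁ k hk' =>
            rw [BangCut.link_kept, Link.eSource_map] at hs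
            obtain ⟨p', hp, e⟩ := hs
            rw [BangCut.old_injective e]
            exact .inl ⟨k, hk, hp⟩
          | h₂ d k hk' =>
            rw [BangCut.link_copy, Link.eSource_map] at hs
            obtain ⟨p', hp, e⟩ := hs
            rcases p' with x | p'
            · exact (h.no_free hp).elim
            · rw [BangCut.copyE_of_inner ⟨k, hk', hp⟩] at e
              rcases p with p | p <;> cases e
          | h₃ n hn => exact hs.elim
        · rw [BangCut.link_kept, Link.parVar_map] at hp
          obtain ⟨p', hp, e⟩ := hp
          rw [BangCut.old_injective e]
          exact .inr hp
      · rintro (⟨k, hk, hs⟩ | hp)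
        · left
          refine ⟨c.kept k (c.kept_of_source hc hpn hi hs), hk, ?_⟩
          rw [BangCut.link_kept, Link.eSource_map]
          exact ⟨p, hs, rfl⟩
        · right
          rw [BangCut.link_kept, Link.parVar_map]
          exact ⟨p, hp, rfl⟩
    have key' : ∀ (p : ℕ ⊕ G.E) d q hq,
        ¬ (c.contract c.W).InBox (c.copy d q hq) (BangCut.old p) := by
      have aux : ∀ (p : ℕ ⊕ G.E) d l hl,
          ¬ ((c.contract c.W).link (c.copy d l hl)).ESource (BangCut.old p) := by
        intro p d l hl hs
        rw [BangCut.link_copy, Link.eSource_map] at hs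
        obtain ⟨p', hp, e⟩ := hs
        rcases p' with x | p'
        · exact (h.no_free hp).elim
        · rw [BangCut.copyE_of_inner ⟨l, hl, hp⟩] at e
          rcases p with p | p <;> cases e
      rintro p d q hq (⟨k, hk, hs⟩ | hp)
      · induction k using BangCut.contract_cases with
        | h₁ k hk' => exact BangCut.kept_mem_copy _ _ _ _ _ hk
        | h₂ d k hk' => exact aux _ _ _ _ hs
        | h₃ n hn => exact hs
      · exact aux _ _ _ _ hp.eSource
    have key'' : ∀ (p : ℕ ⊕ (G.E × Option G.L)) m hm, ¬ (c.contract c.W).InBox (c.wk m hm) p := by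
      rintro p m hm (⟨k, hk, hs⟩ | hp)
      · exact BangCut.mem_wk _ _ _ hk
      · exact hp
    induction l using BangCut.contract_cases with
    | h₁ l hl =>
      rw [BangCut.link_kept, Link.isWeak_map] at hw
      rw [BangCut.link_kept, Link.eTarget_map] at ht
      obtain ⟨p, hp, rfl⟩ := ht
      obtain ⟨hpn, hi⟩ := h.target_of_kept c hl hp
      induction q using BangCut.contract_cases with
      | h₁ q hq =>
        rw [key p hi hpn, BangCut.kept_mem_kept]
        exact h.weak_box hw hp q
      | h₂ d q hq => exact iff_of_false (BangCut.kept_mem_copy _ _ _ _ _) (key' _ _ _ _)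
      | h₃ n hn => exact iff_of_false (BangCut.mem_wk _ _ _) (key'' _ _ _)
    | h₂ d l hl =>
      rw [BangCut.link_copy, Link.isWeak_map] at hw
      rw [BangCut.link_copy, Link.eTarget_map] at ht
      obtain ⟨p, hp, rfl⟩ := ht
      have hi := h.inner_of_weak c hw hp hl
      rcases p with x | p
      · obtain ⟨k, _, hk⟩ := hi
        exact (h.no_free hk).elim
      have aux : ∀ {d' k hk}, ((c.contract c.W).link (c.copy d' k hk)).ESource
          (c.copyE d (.inr p)) ↔ d' = d ∧ (G.link k).ESource (.inr p) := by
        intro d' k hk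
        rw [BangCut.link_copy, Link.eSource_map]
        constructor
        · rintro ⟨p', hp', e⟩
          rcases p' with x | p'
          · exact (h.no_free hp').elim
          · rw [BangCut.copyE_of_inner hi, BangCut.copyE_of_inner ⟨k, hk, hp'⟩] at e
            simp only [Sum.inr.injEq, Prod.mk.injEq, Option.some.injEq] at e
            rw [e.1]
            exact ⟨BangCut.D.ext e.2.symm, hp'⟩
        · rintro ⟨rfl, hp'⟩
          exact ⟨_, hp', rfl⟩
      have aux' : ∀ {k hk}, ¬ ((c.contract c.W).link (c.kept k hk)).ESource
          (c.copyE d (.inr p)) := by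
        intro k hk hs
        rw [BangCut.link_kept, Link.eSource_map, BangCut.copyE_of_inner hi] at hs
        obtain ⟨p' | p', hp, e⟩ := hs <;> cases e
      induction q using BangCut.contract_cases with
      | h₁ q hq =>
        rw [BangCut.copy_mem_kept]
        constructor
        · intro hd
          obtain ⟨k, hk, hs⟩ := hi
          exact .inl ⟨c.copy d k hk, hd, aux.2 ⟨rfl, hs⟩⟩
        · rintro (⟨k, hk, hs⟩ | hp)
          · induction k using BangCut.contract_cases with
            | h₁ k hk' => exact (aux' hs).elim
            | h₂ d' k hk' =>
              obtain ⟨rfl, hs⟩ := aux.1 hs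
              exact hk
            | h₃ n hn => exact hs.elim
          · exact (aux' hp.eSource).elim
      | h₂ d' q hq =>
        rw [BangCut.copy_mem_copy, h.weak_box hw hp]
        constructor
        · rintro ⟨rfl, ⟨k, hk, hs⟩ | hp⟩
          · have hk' : k ∈ c.H := by
              obtain ⟨k', hk', hs'⟩ := hi
              rwa [h.eSource_unique hs hs']
            exact .inl ⟨c.copy d k hk', (BangCut.copy_mem_copy _ _ _ _ _ _).2 ⟨rfl, hk⟩,
              aux.2 ⟨rfl, hs⟩⟩
          · right
            rw [BangCut.link_copy, Link.parVar_map]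
            exact ⟨_, hp, rfl⟩
        · rintro (⟨k, hk, hs⟩ | hp)
          · induction k using BangCut.contract_cases with
            | h₁ k hk' => exact (aux' hs).elim
            | h₂ d'' k hk' =>
              obtain ⟨rfl, hks⟩ := aux.1 hs
              obtain ⟨rfl, hkq⟩ := (BangCut.copy_mem_copy _ _ _ _ _ _).1 hk
              exact ⟨rfl, .inl ⟨k, hkq, hks⟩⟩
            | h₃ n hn => exact hs.elim
          · obtain ⟨rfl, hs⟩ := aux.1 hp.eSource
            refine ⟨rfl, .inr ?_⟩
            rw [BangCut.link_copy, Link.parVar_map] at hp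
            obtain ⟨p', hp', e⟩ := hp
            rwa [hs.unique hp'.eSource]
      | h₃ n hn => exact iff_of_false (BangCut.mem_wk _ _ _) (key'' _ _ _)
    | h₃ m hm =>
      have e : n = BangCut.old m := ht
      subst e
      induction q using BangCut.contract_cases with
      | h₁ q hq =>
        have hmn : m ≠ .inr c.node := by
          rintro rfl
          obtain ⟨_, ⟨⟨l, hl, hlt⟩, hi⟩, _⟩ := hm
          exact h.not_target_of_mem_H c hl hlt
        rw [key m hm.2.1.2 hmn, BangCut.wk_mem_kept]
      | h₂ d q hq => exact (hm.1.false d).elim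
      | h₃ n hn => exact iff_of_false (BangCut.mem_wk _ _ _) (key'' _ _ _)
  box_weak {l} hw k := by
    intro hk
    induction l using BangCut.contract_cases with
    | h₁ l hl =>
      rw [BangCut.link_kept, Link.isWeak_map] at hw
      have : ∀ k, k ∉ G.box l := fun k hk => (h.isPar_of_mem hk).not_isWeak hw
      induction k using BangCut.contract_cases with
      | h₁ k _ => exact this _ hk
      | h₂ d k _ => exact this _ hk
      | h₃ n _ =>
        rcases (BangCut.wk_mem_kept _ _ _ _).1 hk with ⟨k, hk, _⟩ | hp
        · exact this _ hk
        · exact hp.isPar.not_isWeak hw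
    | h₂ d l hl =>
      rw [BangCut.link_copy, Link.isWeak_map] at hw
      have : ∀ k, k ∉ G.box l := fun k hk => (h.isPar_of_mem hk).not_isWeak hw
      induction k using BangCut.contract_cases with
      | h₁ k _ => exact BangCut.kept_mem_copy _ _ _ _ _ hk
      | h₂ d k _ => exact this _ ((BangCut.copy_mem_copy _ _ _ _ _ _).1 hk).2
      | h₃ n _ => exact BangCut.wk_mem_copy _ _ _ _ _ hk
    | h₃ n hn => exact BangCut.mem_wk _ _ _ hk
  root_src := by
    obtain ⟨l, hl⟩ := h.root_src
    refine ⟨c.kept l (c.kept_of_source hc (by simpa using hr.symm) ?_ hl), ?_⟩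
    · exact fun hi => h.root_not_inBox ((c.innerE_iff).1 hi)
    · rw [BangCut.link_kept, Link.eSource_map]
      exact ⟨_, hl, rfl⟩

end Bang

end WF

end Net

namespace Net

namespace MCut

variable {G : Net} {X : Finset ℕ} (c : G.MCut)

theorem eSource_tens {n} : (G.link c.tens).ESource n ↔ n = c.r := by rw [c.tens_eq]; rfl
theorem eTarget_tens {n} : (G.link c.tens).ETarget n ↔ n = c.arg := by rw [c.tens_eq]; rfl
theorem eSource_par {n} : (G.link c.par).ESource n ↔ n = c.x := by rw [c.par_eq]; rfl
theorem eTarget_par {n} : (G.link c.par).ETarget n ↔ n = c.body := by rw [c.par_eq]; rfl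
theorem parVar_par {n} : (G.link c.par).ParVar n ↔ n = c.x := by rw [c.par_eq]; rfl
theorem isPar_par : (G.link c.par).IsPar := by rw [c.par_eq]; trivial
theorem not_isPar_tens : ¬ (G.link c.tens).IsPar := by rw [c.tens_eq]; exact id
theorem not_isDer_tens : ¬ (G.link c.tens).IsDer := by rw [c.tens_eq]; exact id
theorem not_isDer_par : ¬ (G.link c.par).IsDer := by rw [c.par_eq]; exact id

theorem tens_mem_iff (h : G.WF X) (q) : c.tens ∈ G.box q ↔ c.par ∈ G.box q :=
  h.mBox (a := c.node) (by rw [c.tens_eq]; rfl) (by rw [c.par_eq]; rfl) q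

theorem inBox_arg (h : G.WF X) (q) : G.InBox q c.arg ↔ c.tens ∈ G.box q := by
  constructor
  · intro hq
    rcases h.mem_of_inBox (c.eTarget_tens.2 rfl) hq with h | ⟨_, h⟩
    · exact h
    · exact (c.not_isPar_tens h).elim
  · exact fun hq => h.inBox_of_mem (c.eTarget_tens.2 rfl) c.not_isDer_tens (.inl hq)

theorem inBox_body (h : G.WF X) (q) : G.InBox q c.body ↔ c.par ∈ G.box q ∨ c.par = q := by
  constructor
  · exact fun hq => (h.mem_of_inBox (c.eTarget_par.2 rfl) hq).imp_right And.left
  · exact fun hq => h.inBox_of_mem (c.eTarget_par.2 rfl) c.not_isDer_par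
      (hq.imp_right fun h => ⟨h, c.isPar_par⟩)

theorem inBox_r (h : G.WF X) (q) : G.InBox q c.r ↔ c.tens ∈ G.box q := by
  constructor
  · rintro (⟨k, hk, hs⟩ | hp)
    · rwa [h.eSource_unique (c.eSource_tens.2 rfl) hs]
    · rw [h.eSource_unique hp.eSource (c.eSource_tens.2 rfl)] at hp
      exact (c.not_isPar_tens hp.isPar).elim
  · exact fun hq => .inl ⟨_, hq, c.eSource_tens.2 rfl⟩

theorem inBox_x (h : G.WF X) (q) : G.InBox q c.x ↔ c.par ∈ G.box q ∨ c.par = q := by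
  constructor
  · rintro (⟨k, hk, hs⟩ | hp)
    · rw [h.eSource_unique (c.eSource_par.2 rfl) hs]
      exact .inl hk
    · exact .inr (h.eSource_unique (c.eSource_par.2 rfl) hp.eSource)
  · rintro (hq | rfl)
    · exact .inl ⟨_, hq, c.eSource_par.2 rfl⟩
    · exact .inr (c.parVar_par.2 rfl)

theorem par_notMem (h : G.WF X) : c.tens ∉ G.box c.par := fun hq =>
  h.irrefl ((c.tens_mem_iff h _).1 hq)

theorem arg_ne_x (h : G.WF X) : c.arg ≠ c.x := fun e =>
  c.par_notMem h ((c.inBox_arg h _).1 (e ▸ (c.inBox_x h _).2 (.inr rfl)))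

theorem r_ne_x (h : G.WF X) : c.r ≠ c.x := fun e =>
  c.par_notMem h ((c.inBox_r h _).1 (e ▸ (c.inBox_x h _).2 (.inr rfl)))

theorem arg_ne_body (h : G.WF X) : c.arg ≠ c.body := fun e =>
  c.par_notMem h ((c.inBox_arg h _).1 (e ▸ (c.inBox_body h _).2 (.inr rfl)))

theorem r_ne_body (h : G.WF X) : c.r ≠ c.body := fun e =>
  c.par_notMem h ((c.inBox_r h _).1 (e ▸ (c.inBox_body h _).2 (.inr rfl)))

theorem x_inr (h : G.WF X) : ∃ x, c.x = .inr x := by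
  rcases e : c.x with x | x
  · exact (h.no_free (c.eSource_par.2 e.symm)).elim
  · exact ⟨x, rfl⟩

theorem r_inr (h : G.WF X) : ∃ x, c.r = .inr x := by
  rcases e : c.r with x | x
  · exact (h.no_free (c.eSource_tens.2 e.symm)).elim
  · exact ⟨x, rfl⟩

theorem arg_inr (h : G.WF X) : ∃ x, c.arg = .inr x := by
  rcases e : c.arg with x | x
  · have := h.free_principal (c.eTarget_tens.2 e.symm)
    rw [c.tens_eq] at this
    exact this.elim
  · exact ⟨x, rfl⟩

theorem body_inr (h : G.WF X) : ∃ x, c.body = .inr x := by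
  rcases e : c.body with x | x
  · have := h.free_principal (c.eTarget_par.2 e.symm)
    rw [c.par_eq] at this
    exact this.elim
  · exact ⟨x, rfl⟩

theorem x_ne_body (h : G.WF X) : c.x ≠ c.body := fun e =>
  h.no_loop (c.eSource_par.2 rfl) (e ▸ c.eTarget_par.2 rfl)

theorem r_ne_arg (h : G.WF X) : c.r ≠ c.arg := fun e =>
  h.no_loop (c.eSource_tens.2 rfl) (e ▸ c.eTarget_tens.2 rfl)

theorem relabel_x : c.relabel c.x = c.arg := c.relabel_of_eq_x rfl

theorem relabel_body (h : G.WF X) : c.relabel c.body = c.r :=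
  c.relabel_of_eq_body (c.x_ne_body h).symm rfl

theorem relabel_eq_arg (h : G.WF X) {n} (hn : c.relabel n = c.arg) : n = c.arg ∨ n = c.x := by
  by_cases hx : n = c.x
  · exact .inr hx
  · by_cases hb : n = c.body
    · rw [c.relabel_of_eq_body hx hb] at hn
      exact (c.r_ne_arg h hn).elim
    · rw [c.relabel_of_ne hx hb] at hn
      exact .inl hn

theorem relabel_eq_r (h : G.WF X) {n} (hn : c.relabel n = c.r) : n = c.r ∨ n = c.body := by
  by_cases hx : n = c.x
  · rw [c.relabel_of_eq_x hx] at hn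
    exact (c.r_ne_arg h hn.symm).elim
  · by_cases hb : n = c.body
    · exact .inr hb
    · rw [c.relabel_of_ne hx hb] at hn
      exact .inl hn

theorem relabel_eq {n p} (hn : c.relabel n = p) (hr : p ≠ c.r) (ha : p ≠ c.arg) :
    n = p ∧ p ≠ c.x ∧ p ≠ c.body := by
  subst hn
  by_cases hx : n = c.x
  · exact (ha (c.relabel_of_eq_x hx)).elim
  · by_cases hb : n = c.body
    · exact (hr (c.relabel_of_eq_body hx hb)).elim
    · rw [c.relabel_of_ne hx hb]
      exact ⟨rfl, hx, hb⟩

theorem eSource_contract {l : c.contract.L} {n : ℕ ⊕ G.E} :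
    (c.contract.link l).ESource n ↔ ∃ p, (G.link l.1).ESource p ∧ n = c.relabel p := by
  rw [link_contract, Link.eSource_map]

theorem eTarget_contract {l : c.contract.L} {n : ℕ ⊕ G.E} :
    (c.contract.link l).ETarget n ↔ ∃ p, (G.link l.1).ETarget p ∧ n = c.relabel p := by
  rw [link_contract, Link.eTarget_map]

/-- The target of a remaining link is not the root of the opened box, which is the target of the
`par`, nor the argument, which is the target of the `tens`. -/
theorem target_ne (h : G.WF X) {l : G.L} (hl : l ≠ c.tens ∧ l ≠ c.par) {n}
    (hn : (G.link l).ETarget n) : n ≠ c.arg ∧ n ≠ c.body := by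
  constructor
  · rintro rfl
    exact hl.1 (h.target_unique (c.eTarget_tens.2 rfl) c.not_isDer_tens hn)
  · rintro rfl
    exact hl.2 (h.target_unique (c.eTarget_par.2 rfl) c.not_isDer_par hn)

theorem source_ne (h : G.WF X) {l : G.L} (hl : l ≠ c.tens ∧ l ≠ c.par) {n}
    (hn : (G.link l).ESource n) : n ≠ c.r ∧ n ≠ c.x := by
  constructor
  · rintro rfl
    exact hl.1 (h.eSource_unique hn (c.eSource_tens.2 rfl))
  · rintro rfl
    exact hl.2 (h.eSource_unique hn (c.eSource_par.2 rfl))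

/-- The boxes in which a node lies after the `m`-step.  The root of the opened box and its variable
lie, apart from that box, in the boxes of the `par`; these are also the boxes of the `tens`, in
which its source and the argument lie. -/
theorem inBox_contract (h : G.WF X) {n : ℕ ⊕ G.E} (hn : ∃ l, (G.link l).ETarget n)
    (hb : n ≠ c.body) (q : c.contract.L) :
    c.contract.InBox q (c.relabel n) ↔ G.InBox q.1 n := by
  have hq : c.par ≠ q.1 := q.2.2.symm
  have key : ∀ p, (∃ p', c.relabel p' = p ∧ p' ≠ c.r ∧ p' ≠ c.x ∧ G.InBox q.1 p') ↔
      c.contract.InBox q p := by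
    intro p
    constructor
    · rintro ⟨p', rfl, hr, hx, ⟨k, hk, hs⟩ | hp⟩
      · have hk' : k ≠ c.tens ∧ k ≠ c.par := by
          constructor
          · rintro rfl
            exact hr (c.eSource_tens.1 hs)
          · rintro rfl
            exact hx (c.eSource_par.1 hs)
        exact .inl ⟨⟨k, hk'⟩, hk, c.eSource_contract.2 ⟨_, hs, rfl⟩⟩
      · right
        rw [link_contract, Link.parVar_map]
        exact ⟨_, hp, rfl⟩
    · rintro (⟨k, hk, hs⟩ | hp)
      · obtain ⟨p', hp', rfl⟩ := c.eSource_contract.1 hs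
        obtain ⟨h₁, h₂⟩ := c.source_ne h k.2 hp'
        exact ⟨p', rfl, h₁, h₂, .inl ⟨k.1, hk, hp'⟩⟩
      · rw [link_contract, Link.parVar_map] at hp
        obtain ⟨p', hp', rfl⟩ := hp
        obtain ⟨h₁, h₂⟩ := c.source_ne h q.2 hp'.eSource
        exact ⟨p', rfl, h₁, h₂, .inr hp'⟩
  rw [← key]
  by_cases hx : n = c.x
  · subst hx
    rw [c.relabel_x, c.inBox_x h, or_iff_left hq, ← c.tens_mem_iff h, ← c.inBox_arg h]
    constructor
    · rintro ⟨p', e, _, hx', hp'⟩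
      rwa [← (c.relabel_eq_arg h e).resolve_right hx']
    · exact fun hp => ⟨c.arg, c.relabel_of_ne (c.arg_ne_x h) (c.arg_ne_body h),
        (c.r_ne_arg h).symm, c.arg_ne_x h, hp⟩
  · rw [c.relabel_of_ne hx hb]
    by_cases hr : n = c.r
    · subst hr
      rw [c.inBox_r h, c.tens_mem_iff h, ← or_iff_left (a := c.par ∈ _) hq, ← c.inBox_body h]
      constructor
      · rintro ⟨p', e, hr, _, hp'⟩
        rwa [← (c.relabel_eq_r h e).resolve_left hr]
      · exact fun hp => ⟨c.body, c.relabel_body h, (c.r_ne_body h).symm,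
          (c.x_ne_body h).symm, hp⟩
    · constructor
      · rintro ⟨p', e, hr', hx', hp'⟩
        by_cases hb' : p' = c.body
        · rw [c.relabel_of_eq_body hx' hb'] at e
          exact (hr e.symm).elim
        · rwa [← e, c.relabel_of_ne hx' hb']
      · exact fun hp => ⟨n, c.relabel_of_ne hx hb, hr, hx, hp⟩

/-- The nodes other than the root of the opened box are still targets after the `m`-step. -/
theorem exists_target (h : G.WF X) {n : ℕ ⊕ G.E} (hn : ∃ l, (G.link l).ETarget n)
    (hx : n ≠ c.x) (hb : n ≠ c.body) :
    ∃ l, (c.contract.link l).ETarget n := by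
  by_cases ha : n = c.arg
  · subst ha
    -- The argument takes over the links on the variable.
    obtain ⟨x, hx'⟩ := c.x_inr h
    have : ∃ l, (G.link l).ETarget c.x := by
      rw [hx', h.target_inner, ← hx']
      refine ⟨?_, _, c.eSource_par.2 rfl⟩
      rintro rfl
      exact h.root_not_inBox (hx' ▸ (c.inBox_x h _).2 (.inr rfl))
    obtain ⟨l, hl⟩ := this
    refine ⟨⟨l, ?_, ?_⟩, c.eTarget_contract.2 ⟨_, hl, c.relabel_x.symm⟩⟩
    · rintro rfl
      exact c.arg_ne_x h (c.eTarget_tens.1 hl).symm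
    · rintro rfl
      exact c.x_ne_body h (c.eTarget_par.1 hl)
  · obtain ⟨l, hl⟩ := hn
    refine ⟨⟨l, ?_, ?_⟩, c.eTarget_contract.2 ⟨_, hl, (c.relabel_of_ne hx hb).symm⟩⟩
    · rintro rfl
      exact ha (c.eTarget_tens.1 hl)
    · rintro rfl
      exact hb (c.eTarget_par.1 hl)

theorem exists_source (h : G.WF X) {n : ℕ ⊕ G.E} (hn : ∃ l, (G.link l).ESource n)
    (hx : n ≠ c.x) (hb : n ≠ c.body) : ∃ l, (c.contract.link l).ESource n := by
  by_cases hr : n = c.r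
  · subst hr
    obtain ⟨b, hb'⟩ := c.body_inr h
    obtain ⟨_, l, hl⟩ := h.target_inner.1 ⟨c.par, c.eTarget_par.2 hb'.symm⟩
    rw [← hb'] at hl
    refine ⟨⟨l, ?_, ?_⟩, c.eSource_contract.2 ⟨_, hl, (c.relabel_body h).symm⟩⟩
    · rintro rfl
      exact c.r_ne_body h (c.eSource_tens.1 hl).symm
    · rintro rfl
      exact c.x_ne_body h (c.eSource_par.1 hl).symm
  · obtain ⟨l, hl⟩ := hn
    refine ⟨⟨l, ?_, ?_⟩, c.eSource_contract.2 ⟨_, hl, (c.relabel_of_ne hx hb).symm⟩⟩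
    · rintro rfl
      exact hr (c.eSource_tens.1 hl)
    · rintro rfl
      exact hx (c.eSource_par.1 hl)

/-- The weakenings after the `m`-step are those that the other links force: the links on the
variable move to the argument, which loses the `tens`, and those out of the root of the box to the
source of the `tens`. -/
theorem sat_contract (h : G.WF X) : c.contract.Sat X where
  weak_unique {l l' n} hw ht ht' := by
    rw [link_contract, Link.isWeak_map] at hw
    obtain ⟨p, hp, rfl⟩ := c.eTarget_contract.1 ht
    obtain ⟨p', hp', e⟩ := c.eTarget_contract.1 ht'
    obtain ⟨h₁, h₂⟩ := c.target_ne h l.2 hp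
    obtain ⟨h₃, h₄⟩ := c.target_ne h l'.2 hp'
    have : p' = p := by
      by_cases hx : p = c.x
      · rw [c.relabel_of_eq_x hx] at e
        rw [hx]
        exact (c.relabel_eq_arg h e.symm).resolve_left h₃
      · rw [c.relabel_of_ne hx h₂] at e
        by_cases hx' : p' = c.x
        · rw [c.relabel_of_eq_x hx'] at e
          exact (h₁ e).elim
        · rw [c.relabel_of_ne hx' h₄] at e
          exact e.symm
    subst this
    exact Subtype.ext (h.target_unique hp hw.not_isDer hp')
  target_free {x} := by
    obtain ⟨x', hx'⟩ := c.x_inr h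
    obtain ⟨b', hb'⟩ := c.body_inr h
    obtain ⟨a', ha'⟩ := c.arg_inr h
    obtain ⟨r', hr'⟩ := c.r_inr h
    rw [← h.target_free]
    constructor
    · rintro ⟨l, hl⟩
      obtain ⟨p, hp, e⟩ := c.eTarget_contract.1 hl
      obtain ⟨rfl, _⟩ := c.relabel_eq e.symm (by simp [hr']) (by simp [ha'])
      exact ⟨l.1, hp⟩
    · exact fun hx => c.exists_target h hx (by simp [hx']) (by simp [hb'])
  target_inner {p} := by
    obtain ⟨x', hx'⟩ := c.x_inr h
    obtain ⟨b', hb'⟩ := c.body_inr h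
    constructor
    · rintro ⟨l, hl⟩
      obtain ⟨n, hn, e⟩ := c.eTarget_contract.1 hl
      obtain ⟨h₁, h₂⟩ := c.target_ne h l.2 hn
      have key : ∀ {p}, Sum.inr p ≠ c.x → Sum.inr p ≠ c.body →
          (∃ l, (G.link l).ETarget (.inr p)) → p ≠ c.contract.root ∧
            ∃ l, (c.contract.link l).ESource (.inr p) := by
        intro p hx hb hp
        obtain ⟨h₁, h₂⟩ := h.target_inner.1 hp
        exact ⟨h₁, c.exists_source h h₂ hx hb⟩
      by_cases hx : n = c.x
      · rw [c.relabel_of_eq_x hx] at e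
        exact key (e ▸ c.arg_ne_x h) (e ▸ c.arg_ne_body h)
          ⟨c.tens, c.eTarget_tens.2 e⟩
      · rw [c.relabel_of_ne hx h₂] at e
        exact key (e ▸ hx) (e ▸ h₂) ⟨l.1, e ▸ hn⟩
    · rintro ⟨hp, l, hl⟩
      obtain ⟨n, hn, e⟩ := c.eSource_contract.1 hl
      obtain ⟨h₁, h₂⟩ := c.source_ne h l.2 hn
      by_cases hb : n = c.body
      · rw [c.relabel_of_eq_body h₂ hb] at e
        rw [e]
        refine c.exists_target h ?_ (c.r_ne_x h) (c.r_ne_body h)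
        rw [← e]
        exact h.target_inner.2 ⟨hp, c.tens, c.eSource_tens.2 e⟩
      · rw [c.relabel_of_ne h₂ hb] at e
        rw [e]
        refine c.exists_target h ?_ h₂ hb
        rw [← e]
        exact h.target_inner.2 ⟨hp, l.1, e ▸ hn⟩
  weak_box {l n} hw ht q := by
    rw [link_contract, Link.isWeak_map] at hw
    obtain ⟨p, hp, rfl⟩ := c.eTarget_contract.1 ht
    rw [c.inBox_contract h ⟨_, hp⟩ (c.target_ne h l.2 hp).2]
    exact h.weak_box hw hp q.1
  box_weak {l} hw k hk := by
    rw [link_contract, Link.isWeak_map] at hw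
    exact (h.isPar_of_mem hk).not_isWeak hw
  root_src := by
    refine c.exists_source h h.root_src ?_ ?_
    · intro e
      exact h.root_not_inBox (e ▸ (c.inBox_x h _).2 (.inr rfl))
    · intro e
      exact h.root_not_inBox (e ▸ (c.inBox_body h _).2 (.inr rfl))

end MCut
end Net

/-! ### The nets of terms are well formed -/

namespace Link

variable {E' M' N M : Type} {x : E'} {f : N → E'} {g : M → M'} {l : Link (ℕ ⊕ N) M}

open Net (bind)

theorem eTarget_bind {n : ℕ ⊕ E'} :
    (l.map (bind x f) g).ETarget n ↔ (l.ETarget (.inl 0) ∧ n = .inr x) ∨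
      (∃ k, l.ETarget (.inl (k + 1)) ∧ n = .inl k) ∨ ∃ p, l.ETarget (.inr p) ∧ n = .inr (f p) := by
  rw [eTarget_map]
  constructor
  · rintro ⟨(_ | k) | p, h, rfl⟩
    · exact .inl ⟨h, rfl⟩
    · exact .inr (.inl ⟨k, h, rfl⟩)
    · exact .inr (.inr ⟨p, h, rfl⟩)
  · rintro (⟨h, rfl⟩ | ⟨k, h, rfl⟩ | ⟨p, h, rfl⟩)
    exacts [⟨_, h, rfl⟩, ⟨_, h, rfl⟩, ⟨_, h, rfl⟩]

theorem eSource_bind {n : ℕ ⊕ E'}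
    (hl : ∀ k, ¬ l.ESource (.inl k)) :
    (l.map (bind x f) g).ESource n ↔ ∃ p, l.ESource (.inr p) ∧ n = .inr (f p) := by
  rw [eSource_map]
  constructor
  · rintro ⟨k | p, h, rfl⟩
    · exact (hl _ h).elim
    · exact ⟨p, h, rfl⟩
  · rintro ⟨p, h, rfl⟩
    exact ⟨_, h, rfl⟩

theorem parVar_bind {n : ℕ ⊕ E'}
    (hl : ∀ k, ¬ l.ESource (.inl k)) :
    (l.map (bind x f) g).ParVar n ↔ ∃ p, l.ParVar (.inr p) ∧ n = .inr (f p) := by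
  rw [parVar_map]
  constructor
  · rintro ⟨k | p, h, rfl⟩
    · exact (hl _ h.eSource).elim
    · exact ⟨p, h, rfl⟩
  · rintro ⟨p, h, rfl⟩
    exact ⟨_, h, rfl⟩

theorem eTarget_sumMap {n : ℕ ⊕ E'} :
    (l.map (Sum.map id f) g).ETarget n ↔ (∃ k, l.ETarget (.inl k) ∧ n = .inl k) ∨
      ∃ p, l.ETarget (.inr p) ∧ n = .inr (f p) := by
  rw [eTarget_map]
  constructor
  · rintro ⟨k | p, h, rfl⟩
    · exact .inl ⟨k, h, rfl⟩
    · exact .inr ⟨p, h, rfl⟩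
  · rintro (⟨k, h, rfl⟩ | ⟨p, h, rfl⟩)
    exacts [⟨_, h, rfl⟩, ⟨_, h, rfl⟩]

theorem eSource_sumMap {n : ℕ ⊕ E'} (hl : ∀ k, ¬ l.ESource (.inl k)) :
    (l.map (Sum.map id f) g).ESource n ↔ ∃ p, l.ESource (.inr p) ∧ n = .inr (f p) := by
  rw [eSource_map]
  constructor
  · rintro ⟨k | p, h, rfl⟩
    · exact (hl _ h).elim
    · exact ⟨p, h, rfl⟩
  · rintro ⟨p, h, rfl⟩
    exact ⟨_, h, rfl⟩

theorem parVar_sumMap {n : ℕ ⊕ E'} (hl : ∀ k, ¬ l.ESource (.inl k)) :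
    (l.map (Sum.map id f) g).ParVar n ↔ ∃ p, l.ParVar (.inr p) ∧ n = .inr (f p) := by
  rw [parVar_map]
  constructor
  · rintro ⟨k | p, h, rfl⟩
    · exact (hl _ h.eSource).elim
    · exact ⟨p, h, rfl⟩
  · rintro ⟨p, h, rfl⟩
    exact ⟨_, h, rfl⟩

end Link

namespace Net

namespace WF

variable {G S : Net} {X Y : Finset ℕ}

theorem not_target_root (h : G.WF X) {l} : ¬ (G.link l).ETarget (.inr G.root) :=
  fun hl => (h.target_inner.1 ⟨l, hl⟩).1 rfl

theorem target_inner_source (h : G.WF X) {l p} (hl : (G.link l).ETarget (.inr p)) :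
    ∃ k, (G.link k).ESource (.inr p) := (h.target_inner.1 ⟨l, hl⟩).2

theorem exists_source_of_inBox {q : G.L} {n} (hq : G.InBox q n) :
    ∃ l, (G.link l).ESource n := by
  rcases hq with ⟨k, _, hk⟩ | hp
  · exact ⟨k, hk⟩
  · exact ⟨q, hp.eSource⟩

theorem inBox_of_mem_box (h : G.WF X) {l n q} (hl : (G.link l).ETarget n) (hq : l ∈ G.box q)
    (hd : ¬ (G.link l).IsDer) : G.InBox q n := h.inBox_of_mem hl hd (.inl hq)

theorem inBox_of_isPar (h : G.WF X) {l n} (hl : (G.link l).ETarget n) (hp : (G.link l).IsPar) :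
    G.InBox l n :=
  h.inBox_of_mem hl (by revert hp; cases G.link l <;> simp) (.inr ⟨rfl, hp⟩)

/-- The boxes of a part of a net that is included along `j` and `e`. -/
theorem inBox_image (G N : Net) (j : G.L → N.L) (e : G.E → N.E)
    (hbox : N.box ∘ j = fun q => j '' G.box q)
    (hs : ∀ l n, (N.link (j l)).ESource n ↔ ∃ p, (G.link l).ESource (.inr p) ∧ n = .inr (e p))
    (hp : ∀ l n, (N.link (j l)).ParVar n ↔ ∃ p, (G.link l).ParVar (.inr p) ∧ n = .inr (e p))
    (q n) : N.InBox (j q) n ↔ ∃ p, G.InBox q (.inr p) ∧ n = .inr (e p) := by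
  have hbox : N.box (j q) = j '' G.box q := congrFun hbox q
  simp only [InBox, hp, hbox]
  constructor
  · rintro (⟨_, ⟨k, hk, rfl⟩, hs'⟩ | ⟨p, hp, rfl⟩)
    · obtain ⟨p, hp, rfl⟩ := (hs _ _).1 hs'
      exact ⟨p, .inl ⟨k, hk, hp⟩, rfl⟩
    · exact ⟨p, .inr hp, rfl⟩
  · rintro ⟨p, ⟨k, hk, hs'⟩ | hp, rfl⟩
    · exact .inl ⟨_, ⟨k, hk, rfl⟩, (hs _ _).2 ⟨p, hs', rfl⟩⟩
    · exact .inr ⟨p, hp, rfl⟩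

protected theorem varNet (x : ℕ) : (varNet x).WF {x} := by
  constructor <;> simp [Net.InBox]

/-- Free weakenings on new variables preserve well-formedness. -/
theorem weaken (h : G.WF X) (W : Finset ℕ) (hW : ∀ x ∈ W, x ∉ X) : (G.weaken W).WF (X ∪ W) := by
  have hib : ∀ q n, (G.weaken W).InBox (.inl q) n ↔ G.InBox q n := by
    simp [InBox]
  have hib' : ∀ q n, ¬ (G.weaken W).InBox (.inr q) n := by
    simp [InBox]
  have hf : ∀ l k, ¬ (G.link l).ESource (.inl k) := fun l k => h.no_free
  have hf' : ∀ q k, ¬ G.InBox q (.inl k) := fun q k hk =>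
    (exists_source_of_inBox hk).elim fun l hl => hf l k hl
  refine ⟨?_, ?_, ?_, ?_, ?_, ?_, ?_, ?_, ?_, ?_, ?_, ?_, ?_, ?_, ?_, ?_, ?_⟩
  · simp [← h.target_free]
  · simp [h.target_inner]
  · simp [h.root_src]
  · intro l n q hl hq
    rcases l with l | l <;> rcases q with q | q <;> simp [hib, hib'] at hl hq ⊢ <;>
      grind [h.mem_of_inBox]
  · intro l n q hl hd hq
    rcases l with l | l <;> rcases q with q | q <;> simp [hib] at hl hd hq ⊢ <;>
      grind [h.inBox_of_mem]
  · intro a l l' hl hl' q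
    rcases l with l | l <;> rcases l' with l' | l' <;> rcases q with q | q <;> simp at hl hl' ⊢ <;>
      grind [h.mBox]
  · rintro (l | l) <;> simp [h.irrefl]
  · intro k l hk
    rcases k with k | k <;> rcases l with l | l <;> simp at hk ⊢ <;> grind [h.isPar_of_mem]
  · intro n l l' hl hl'
    rcases l with l | l <;> rcases l' with l' | l' <;> simp at hl hl' ⊢ <;>
      grind [h.eSource_unique]
  · intro n l l' hl hl'
    rcases l with l | l <;> rcases l' with l' | l' <;> simp at hl hl' ⊢ <;>
      grind [h.mSource_unique]
  · intro n l l' hl hl'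
    rcases l with l | l <;> rcases l' with l' | l' <;> simp at hl hl' ⊢ <;>
      grind [h.mTarget_unique]
  · rintro x (l | l) <;> simp [hf]
  · intro n l l' hl hd hl'
    rcases l with l | ⟨l, hlW⟩ <;> rcases l' with l' | ⟨l', hlW'⟩ <;> simp at hl hd hl' ⊢
    · exact h.target_unique hl hd hl'
    · subst hl'
      exact hW _ hlW' (h.target_free.1 ⟨_, hl⟩)
    · subst hl
      exact hW _ hlW (h.target_free.1 ⟨_, hl'⟩)
    · subst hl
      exact (Sum.inl.inj hl').symm
  · intro x l hl
    rcases l with l | l <;> simp at hl ⊢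
    exact h.free_principal hl
  · rintro (q | q)
    · exact fun hq => h.root_not_inBox ((hib _ _).1 hq)
    · exact hib' _ _
  · intro l n hl hl'
    rcases l with l | l <;> simp at hl hl' ⊢
    exact h.no_loop hl hl'
  · intro l k j m n hl hm hk hj hd ht
    rcases l with l | l <;> rcases k with k | k <;> rcases j with j | j <;>
      simp at hl hm hk hj hd ht ⊢
    exact h.acyclic hl hm hk hj hd ht

/-- The net of an abstraction is well formed.  The links of `G` on the free variables that remain
free have to be derelictions, since no other link may leave the new box. -/
theorem lamNet (h : G.WF X) (hX : 0 ∈ X)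
    (hG : ∀ {l k}, (G.link l).ETarget (.inl (k + 1)) → (G.link l).IsDer) :
    (lamNet G).WF ((X.erase 0).image Nat.pred) := by
  -- The incidences and boxes of the new net in terms of those of `G`; the properties then follow by
  -- cases on the links.
  have hs : ∀ l n, ((Net.lamNet G).link (.inr l)).ESource n ↔
      ∃ p, (G.link l).ESource (.inr p) ∧ n = .inr (.inr p) :=
    fun l n => Link.eSource_bind fun k => h.no_free
  have hp : ∀ l n, ((Net.lamNet G).link (.inr l)).ParVar n ↔
      ∃ p, (G.link l).ParVar (.inr p) ∧ n = .inr (.inr p) :=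
    fun l n => Link.parVar_bind fun k => h.no_free
  have ht : ∀ l n, ((Net.lamNet G).link (.inr l)).ETarget n ↔
      ((G.link l).ETarget (.inl 0) ∧ n = .inr (.inl false)) ∨
      (∃ k, (G.link l).ETarget (.inl (k + 1)) ∧ n = .inl k) ∨
        ∃ p, (G.link l).ETarget (.inr p) ∧ n = .inr (.inr p) :=
    fun l n => Link.eTarget_bind
  have hms : ∀ l n, ((Net.lamNet G).link (.inr l)).MSource n ↔
      ∃ p, (G.link l).MSource p ∧ n = .inr p := fun l n => Link.mSource_map
  have hmt : ∀ l n, ((Net.lamNet G).link (.inr l)).MTarget n ↔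
      ∃ p, (G.link l).MTarget p ∧ n = .inr p := fun l n => Link.mTarget_map
  have hpar : ∀ l, ((Net.lamNet G).link (.inr l)).IsPar ↔ (G.link l).IsPar :=
    fun l => Link.isPar_map
  have hder : ∀ l, ((Net.lamNet G).link (.inr l)).IsDer ↔ (G.link l).IsDer :=
    fun l => Link.isDer_map
  have hpr : ∀ l, ((Net.lamNet G).link (.inr l)).ETargetPrincipal ↔ (G.link l).ETargetPrincipal :=
    fun l => Link.eTargetPrincipal_map
  have hroot := h.root_src
  have htr : ∀ l, ¬ (G.link l).ETarget (.inr G.root) := fun l => h.not_target_root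
  have hf : ∀ l k, ¬ (G.link l).ESource (.inl k) := fun l k => h.no_free
  have hbf : ∀ q k, ¬ G.InBox q (.inl k) := fun q k hk =>
    (exists_source_of_inBox hk).elim fun l hl => hf l k hl
  have hbr : ∀ q, ¬ G.InBox q (.inr G.root) := fun q => h.root_not_inBox
  have hbs : ∀ q p, G.InBox q (.inr p) → ∃ l, (G.link l).ESource (.inr p) :=
    fun q p => exists_source_of_inBox
  have hib : ∀ q n, (Net.lamNet G).InBox (.inr q) n ↔
      ∃ p, G.InBox q (.inr p) ∧ n = .inr (.inr p) := fun q n =>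
    inBox_image G (Net.lamNet G) (fun l => .inr l) (fun p => .inr p) rfl hs hp q n
  have hib₁ : ∀ n, ¬ (Net.lamNet G).InBox (.inl true) n := by
    simp [InBox]
  have hib₂ : ∀ n, (Net.lamNet G).InBox (.inl false) n ↔
      n = .inr (.inl false) ∨ ∃ p, (∃ k, (G.link k).ESource (.inr p)) ∧ n = .inr (.inr p) := by
    intro n
    simp [InBox, hs]
    grind
  refine ⟨?_, ?_, ?_, ?_, ?_, ?_, ?_, ?_, ?_, ?_, ?_, ?_, ?_, ?_, ?_, ?_, ?_⟩
  · intro x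
    simp [ht, ← h.target_free]
    grind
  · intro p
    rcases p with (_ | _) | p <;> simp [ht, hs, h.target_inner, h.target_free, hX]
    grind
  · simp
  · intro l n q hl hq
    rcases l with (_ | _) | l <;> rcases q with (_ | _) | q <;>
      simp [ht, hib, hib₁, hib₂] at hl hq ⊢ <;>
      grind [h.mem_of_inBox]
  · intro l n q hl hd hq
    rcases l with (_ | _) | l <;> rcases q with (_ | _) | q <;>
      simp [ht, hib, hder, hpar, hib₂] at hl hd hq ⊢ <;>
      grind [→ h.inBox_of_mem_box, → h.inBox_of_isPar, h.target_inner_source]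
  · intro a l l' hl hl' q
    rcases l with (_ | _) | l <;> rcases l' with (_ | _) | l' <;> rcases q with (_ | _) | q <;>
      simp [hms, hmt] at hl hl' ⊢ <;>
      grind [h.mBox]
  · rintro l
    rcases l with (_ | _) | l <;> simp [h.irrefl]
  · intro k l hk
    rcases k with (_ | _) | k <;> rcases l with (_ | _) | l <;>
      simp [hpar] at hk ⊢ <;>
      grind [h.isPar_of_mem]
  · intro n l l' hl hl'
    rcases l with (_ | _) | l <;> rcases l' with (_ | _) | l' <;>
      simp [hs] at hl hl' ⊢ <;>
      grind [h.eSource_unique]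
  · intro n l l' hl hl'
    rcases l with (_ | _) | l <;> rcases l' with (_ | _) | l' <;>
      simp [hms] at hl hl' ⊢ <;>
      grind [h.mSource_unique]
  · intro n l l' hl hl'
    rcases l with (_ | _) | l <;> rcases l' with (_ | _) | l' <;>
      simp [hmt] at hl hl' ⊢ <;>
      grind [h.mTarget_unique]
  · intro x l
    rcases l with (_ | _) | l <;> simp [hs]
  · intro n l l' hl hd hl'
    rcases l with (_ | _) | l <;> rcases l' with (_ | _) | l' <;>
      simp [ht, hder] at hl hd hl' ⊢ <;>
      grind [h.target_unique]
  · intro x l hl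
    rcases l with (_ | _) | l <;> simp [ht, hpr] at hl ⊢ <;>
      grind [h.free_principal]
  · intro q
    rcases q with (_ | _) | q <;> simp [hib, hib₁, hib₂]
  · intro l n hl hl'
    rcases l with (_ | _) | l <;> simp [ht, hs] at hl hl' ⊢ <;> grind [h.no_loop]
  · intro l k j m n hl hm hk hj hd hjt
    rcases l with (_ | _) | l <;> rcases k with (_ | _) | k <;> rcases j with (_ | _) | j <;>
      simp [hs, ht, hms, hmt, hder] at hl hm hk hj hd hjt ⊢ <;>
      grind [h.acyclic]

/-- The net of an application of a variable is well formed; the new dereliction may share its target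
only with derelictions. -/
theorem appVarNet (x : ℕ) (h : S.WF Y)
    (hS : ∀ {l k}, (S.link l).ETarget (.inl k) → (S.link l).IsDer) :
    (appVarNet x S).WF (insert x Y) := by
  -- The incidences and boxes of the new net in terms of those of `S`.
  have hs : ∀ l n, ((Net.appVarNet x S).link (.inr l)).ESource n ↔
      ∃ p, (S.link l).ESource (.inr p) ∧ n = .inr (.inr p) :=
    fun l n => Link.eSource_sumMap fun k => h.no_free
  have hp : ∀ l n, ((Net.appVarNet x S).link (.inr l)).ParVar n ↔
      ∃ p, (S.link l).ParVar (.inr p) ∧ n = .inr (.inr p) :=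
    fun l n => Link.parVar_sumMap fun k => h.no_free
  have ht : ∀ l n, ((Net.appVarNet x S).link (.inr l)).ETarget n ↔
      (∃ k, (S.link l).ETarget (.inl k) ∧ n = .inl k) ∨
        ∃ p, (S.link l).ETarget (.inr p) ∧ n = .inr (.inr p) :=
    fun l n => Link.eTarget_sumMap
  have hms : ∀ l n, ((Net.appVarNet x S).link (.inr l)).MSource n ↔
      ∃ p, (S.link l).MSource p ∧ n = .inr p := fun l n => Link.mSource_map
  have hmt : ∀ l n, ((Net.appVarNet x S).link (.inr l)).MTarget n ↔
      ∃ p, (S.link l).MTarget p ∧ n = .inr p := fun l n => Link.mTarget_map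
  have hpar : ∀ l, ((Net.appVarNet x S).link (.inr l)).IsPar ↔ (S.link l).IsPar :=
    fun l => Link.isPar_map
  have hder : ∀ l, ((Net.appVarNet x S).link (.inr l)).IsDer ↔ (S.link l).IsDer :=
    fun l => Link.isDer_map
  have hpr : ∀ l, ((Net.appVarNet x S).link (.inr l)).ETargetPrincipal ↔
      (S.link l).ETargetPrincipal :=
    fun l => Link.eTargetPrincipal_map
  have hroot := h.root_src
  have htr : ∀ l, ¬ (S.link l).ETarget (.inr S.root) := fun l => h.not_target_root
  have hf : ∀ l k, ¬ (S.link l).ESource (.inl k) := fun l k => h.no_free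
  have hbf : ∀ q k, ¬ S.InBox q (.inl k) := fun q k hk =>
    (exists_source_of_inBox hk).elim fun l hl => hf l k hl
  have hbr : ∀ q, ¬ S.InBox q (.inr S.root) := fun q => h.root_not_inBox
  have hbs : ∀ q p, S.InBox q (.inr p) → ∃ l, (S.link l).ESource (.inr p) :=
    fun q p => exists_source_of_inBox
  have hib : ∀ q n, (Net.appVarNet x S).InBox (.inr q) n ↔
      ∃ p, S.InBox q (.inr p) ∧ n = .inr (.inr p) := fun q n =>
    inBox_image S (Net.appVarNet x S) (fun l => .inr l) (fun p => .inr p) rfl hs hp q n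
  have hib' : ∀ b n, ¬ (Net.appVarNet x S).InBox (.inl b) n := by
    rintro (_ | _) <;> simp [InBox]
  refine ⟨?_, ?_, ?_, ?_, ?_, ?_, ?_, ?_, ?_, ?_, ?_, ?_, ?_, ?_, ?_, ?_, ?_⟩
  · intro x
    simp [ht, ← h.target_free]
  · intro p
    rcases p with _ | p <;> simp [ht, hs, h.target_inner] <;> grind
  · simp
  · intro l n q hl hq
    rcases l with (_ | _) | l <;> rcases q with (_ | _) | q <;>
      simp [ht, hib, hib'] at hl hq ⊢ <;>
      grind [h.mem_of_inBox]
  · intro l n q hl hd hq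
    rcases l with (_ | _) | l <;> rcases q with (_ | _) | q <;>
      simp [ht, hib, hder, hpar] at hl hd hq ⊢ <;>
      grind [→ h.inBox_of_mem_box, → h.inBox_of_isPar, h.target_inner_source]
  · intro a l l' hl hl' q
    rcases l with (_ | _) | l <;> rcases l' with (_ | _) | l' <;> rcases q with (_ | _) | q <;>
      simp [hms, hmt] at hl hl' ⊢ <;>
      grind [h.mBox]
  · rintro l
    rcases l with (_ | _) | l <;> simp [h.irrefl]
  · intro k l hk
    rcases k with (_ | _) | k <;> rcases l with (_ | _) | l <;>
      simp [hpar] at hk ⊢ <;>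
      grind [h.isPar_of_mem]
  · intro n l l' hl hl'
    rcases l with (_ | _) | l <;> rcases l' with (_ | _) | l' <;>
      simp [hs] at hl hl' ⊢ <;>
      grind [h.eSource_unique]
  · intro n l l' hl hl'
    rcases l with (_ | _) | l <;> rcases l' with (_ | _) | l' <;>
      simp [hms] at hl hl' ⊢ <;>
      grind [h.mSource_unique]
  · intro n l l' hl hl'
    rcases l with (_ | _) | l <;> rcases l' with (_ | _) | l' <;>
      simp [hmt] at hl hl' ⊢ <;>
      grind [h.mTarget_unique]
  · intro x l
    rcases l with (_ | _) | l <;> simp [hs]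
  · intro n l l' hl hd hl'
    rcases l with (_ | _) | l <;> rcases l' with (_ | _) | l' <;>
      simp [ht, hder] at hl hd hl' ⊢ <;>
      grind [h.target_unique]
  · intro x l hl
    rcases l with (_ | _) | l <;> simp [ht, hpr] at hl ⊢ <;>
      grind [h.free_principal]
  · intro q
    rcases q with (_ | _) | q <;> simp [hib, hib']
  · intro l n hl hl'
    rcases l with (_ | _) | l <;> simp [ht, hs] at hl hl' ⊢ <;> grind [h.no_loop]
  · intro l k j m n hl hm hk hj hd hjt
    rcases l with (_ | _) | l <;> rcases k with (_ | _) | k <;> rcases j with (_ | _) | j <;>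
      simp [hs, ht, hms, hmt, hder] at hl hm hk hj hd hjt ⊢ <;>
      grind [h.acyclic]

set_option maxHeartbeats 1000000 in
/-- The net of an application of an abstraction is well formed.  The free variables of `G` and `S`
may be shared, and therefore are targets of derelictions only. -/
theorem appLamNet (h : G.WF X) (hX : 0 ∈ X) (h' : S.WF Y)
    (hG : ∀ {l k}, (G.link l).ETarget (.inl (k + 1)) → (G.link l).IsDer)
    (hS : ∀ {l k}, (S.link l).ETarget (.inl k) → (S.link l).IsDer) :
    (appLamNet G S).WF ((X.erase 0).image Nat.pred ∪ Y) := by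
  -- The incidences and boxes of the new net in terms of those of `G` and `S`.
  have hs : ∀ l n, ((Net.appLamNet G S).link (.inr (.inl l))).ESource n ↔
      ∃ p, (G.link l).ESource (.inr p) ∧ n = .inr (.inr (.inl p)) :=
    fun l n => Link.eSource_bind fun k => h.no_free
  have hp : ∀ l n, ((Net.appLamNet G S).link (.inr (.inl l))).ParVar n ↔
      ∃ p, (G.link l).ParVar (.inr p) ∧ n = .inr (.inr (.inl p)) :=
    fun l n => Link.parVar_bind fun k => h.no_free
  have ht : ∀ l n, ((Net.appLamNet G S).link (.inr (.inl l))).ETarget n ↔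
      ((G.link l).ETarget (.inl 0) ∧ n = .inr (.inl false)) ∨
      (∃ k, (G.link l).ETarget (.inl (k + 1)) ∧ n = .inl k) ∨
        ∃ p, (G.link l).ETarget (.inr p) ∧ n = .inr (.inr (.inl p)) :=
    fun l n => Link.eTarget_bind
  have hms : ∀ l n, ((Net.appLamNet G S).link (.inr (.inl l))).MSource n ↔
      ∃ p, (G.link l).MSource p ∧ n = .inr (.inl p) := fun l n => Link.mSource_map
  have hmt : ∀ l n, ((Net.appLamNet G S).link (.inr (.inl l))).MTarget n ↔
      ∃ p, (G.link l).MTarget p ∧ n = .inr (.inl p) := fun l n => Link.mTarget_map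
  have hpar : ∀ l, ((Net.appLamNet G S).link (.inr (.inl l))).IsPar ↔ (G.link l).IsPar :=
    fun l => Link.isPar_map
  have hder : ∀ l, ((Net.appLamNet G S).link (.inr (.inl l))).IsDer ↔ (G.link l).IsDer :=
    fun l => Link.isDer_map
  have hpr : ∀ l, ((Net.appLamNet G S).link (.inr (.inl l))).ETargetPrincipal ↔
      (G.link l).ETargetPrincipal :=
    fun l => Link.eTargetPrincipal_map
  have hroot := h.root_src
  have htr : ∀ l, ¬ (G.link l).ETarget (.inr G.root) := fun l => h.not_target_root
  have hf : ∀ l k, ¬ (G.link l).ESource (.inl k) := fun l k => h.no_free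
  have hbf : ∀ q k, ¬ G.InBox q (.inl k) := fun q k hk =>
    (exists_source_of_inBox hk).elim fun l hl => hf l k hl
  have hbr : ∀ q, ¬ G.InBox q (.inr G.root) := fun q => h.root_not_inBox
  have hbs : ∀ q p, G.InBox q (.inr p) → ∃ l, (G.link l).ESource (.inr p) :=
    fun q p => exists_source_of_inBox
  have hs' : ∀ l n, ((Net.appLamNet G S).link (.inr (.inr l))).ESource n ↔
      ∃ p, (S.link l).ESource (.inr p) ∧ n = .inr (.inr (.inr p)) :=
    fun l n => Link.eSource_sumMap fun k => h'.no_free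
  have hp' : ∀ l n, ((Net.appLamNet G S).link (.inr (.inr l))).ParVar n ↔
      ∃ p, (S.link l).ParVar (.inr p) ∧ n = .inr (.inr (.inr p)) :=
    fun l n => Link.parVar_sumMap fun k => h'.no_free
  have ht' : ∀ l n, ((Net.appLamNet G S).link (.inr (.inr l))).ETarget n ↔
      (∃ k, (S.link l).ETarget (.inl k) ∧ n = .inl k) ∨
        ∃ p, (S.link l).ETarget (.inr p) ∧ n = .inr (.inr (.inr p)) :=
    fun l n => Link.eTarget_sumMap
  have hms' : ∀ l n, ((Net.appLamNet G S).link (.inr (.inr l))).MSource n ↔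
      ∃ p, (S.link l).MSource p ∧ n = .inr (.inr p) := fun l n => Link.mSource_map
  have hmt' : ∀ l n, ((Net.appLamNet G S).link (.inr (.inr l))).MTarget n ↔
      ∃ p, (S.link l).MTarget p ∧ n = .inr (.inr p) := fun l n => Link.mTarget_map
  have hpar' : ∀ l, ((Net.appLamNet G S).link (.inr (.inr l))).IsPar ↔ (S.link l).IsPar :=
    fun l => Link.isPar_map
  have hder' : ∀ l, ((Net.appLamNet G S).link (.inr (.inr l))).IsDer ↔ (S.link l).IsDer :=
    fun l => Link.isDer_map
  have hpr' : ∀ l, ((Net.appLamNet G S).link (.inr (.inr l))).ETargetPrincipal ↔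
      (S.link l).ETargetPrincipal :=
    fun l => Link.eTargetPrincipal_map
  have hroot' := h'.root_src
  have htr' : ∀ l, ¬ (S.link l).ETarget (.inr S.root) := fun l => h'.not_target_root
  have hf' : ∀ l k, ¬ (S.link l).ESource (.inl k) := fun l k => h'.no_free
  have hbf' : ∀ q k, ¬ S.InBox q (.inl k) := fun q k hk =>
    (exists_source_of_inBox hk).elim fun l hl => hf' l k hl
  have hbr' : ∀ q, ¬ S.InBox q (.inr S.root) := fun q => h'.root_not_inBox
  have hbs' : ∀ q p, S.InBox q (.inr p) → ∃ l, (S.link l).ESource (.inr p) :=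
    fun q p => exists_source_of_inBox
  have hib : ∀ q n, (Net.appLamNet G S).InBox (.inr (.inl q)) n ↔
      ∃ p, G.InBox q (.inr p) ∧ n = .inr (.inr (.inl p)) := fun q n =>
    inBox_image G (Net.appLamNet G S) (fun l => .inr (.inl l))
      (fun p => .inr (.inl p)) rfl hs hp q n
  have hib' : ∀ q n, (Net.appLamNet G S).InBox (.inr (.inr q)) n ↔
      ∃ p, S.InBox q (.inr p) ∧ n = .inr (.inr (.inr p)) := fun q n =>
    inBox_image S (Net.appLamNet G S) (fun l => .inr (.inr l))
      (fun p => .inr (.inr p)) rfl hs' hp' q n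
  have hib₁ : ∀ n, ¬ (Net.appLamNet G S).InBox (.inl true) n := by
    simp [InBox]
  have hib₂ : ∀ n, (Net.appLamNet G S).InBox (.inl false) n ↔
      n = .inr (.inl false) ∨
        ∃ p, (∃ k, (G.link k).ESource (.inr p)) ∧ n = .inr (.inr (.inl p)) := by
    intro n
    simp [InBox, hs]
    grind
  refine ⟨?_, ?_, ?_, ?_, ?_, ?_, ?_, ?_, ?_, ?_, ?_, ?_, ?_, ?_, ?_, ?_, ?_⟩
  · intro x
    simp [ht, ht', ← h.target_free, ← h'.target_free]
    grind
  · intro p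
    rcases p with (_ | _) | p | p <;>
      simp [ht, ht', hs, hs', h.target_inner, h'.target_inner, h.target_free, hX] <;> grind
  · simp
  · intro l n q hl hq
    rcases l with (_ | _) | l | l <;> rcases q with (_ | _) | q | q <;>
      simp [ht, ht', hib, hib', hib₁, hib₂] at hl hq ⊢ <;>
      grind [h.mem_of_inBox, h'.mem_of_inBox]
  · intro l n q hl hd hq
    rcases l with (_ | _) | l | l <;> rcases q with (_ | _) | q | q <;>
      simp [ht, ht', hib, hib', hder, hder', hpar, hpar', hib₂] at hl hd hq ⊢ <;>
      first
        | grind [→ h.inBox_of_mem_box, → h.inBox_of_isPar, → h'.inBox_of_mem_box,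
            → h'.inBox_of_isPar]
        | rcases hl with ⟨hl, rfl⟩ | ⟨k, hl, rfl⟩ | ⟨p, hl, rfl⟩
          exacts [.inl rfl, (hd (hG hl)).elim, .inr ⟨p, h.target_inner_source hl, rfl⟩]
  · intro a l l' hl hl' q
    rcases l with (_ | _) | l | l <;> rcases l' with (_ | _) | l' | l' <;>
      rcases q with (_ | _) | q | q <;>
      simp [hms, hms', hmt, hmt'] at hl hl' ⊢ <;>
      grind [h.mBox, h'.mBox]
  · rintro l
    rcases l with (_ | _) | l | l <;> simp [h.irrefl, h'.irrefl]
  · intro k l hk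
    rcases k with (_ | _) | k | k <;> rcases l with (_ | _) | l | l <;>
      simp [hpar, hpar'] at hk ⊢ <;>
      grind [h.isPar_of_mem, h'.isPar_of_mem]
  · intro n l l' hl hl'
    rcases l with (_ | _) | l | l <;> rcases l' with (_ | _) | l' | l' <;>
      simp [hs, hs'] at hl hl' ⊢ <;>
      grind [h.eSource_unique, h'.eSource_unique]
  · intro n l l' hl hl'
    rcases l with (_ | _) | l | l <;> rcases l' with (_ | _) | l' | l' <;>
      simp [hms, hms'] at hl hl' ⊢ <;>
      grind [h.mSource_unique, h'.mSource_unique]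
  · intro n l l' hl hl'
    rcases l with (_ | _) | l | l <;> rcases l' with (_ | _) | l' | l' <;>
      simp [hmt, hmt'] at hl hl' ⊢ <;>
      grind [h.mTarget_unique, h'.mTarget_unique]
  · intro x l
    rcases l with (_ | _) | l | l <;> simp [hs, hs']
  · intro n l l' hl hd hl'
    rcases l with (_ | _) | l | l <;> rcases l' with (_ | _) | l' | l' <;>
      simp [ht, ht', hder, hder'] at hl hd hl' ⊢ <;>
      grind [h.target_unique, h'.target_unique]
  · intro x l hl
    rcases l with (_ | _) | l | l <;> simp [ht, ht', hpr, hpr'] at hl ⊢ <;>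
      grind [h.free_principal, h'.free_principal]
  · intro q
    rcases q with (_ | _) | q | q <;> simp [hib, hib', hib₁, hib₂]
  · intro l n hl hl'
    rcases l with (_ | _) | l | l <;> simp [ht, ht', hs, hs'] at hl hl' ⊢ <;>
      grind [h.no_loop, h'.no_loop]
  · intro l k j m n hl hm hk hj hd hjt
    rcases l with (_ | _) | l | l <;> rcases k with (_ | _) | k | k <;>
      rcases j with (_ | _) | j | j <;>
      simp [hs, hs', ht, ht', hms, hms', hmt, hmt', hder, hder'] at hl hm hk hj hd hjt ⊢ <;>
      grind [h.acyclic, h'.acyclic]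

set_option maxHeartbeats 1000000 in
/-- The net of an explicit substitution is well formed.  The free variables of `G` and `S` may be
shared, and therefore are targets of derelictions only. -/
theorem subNet (h : G.WF X) (hX : 0 ∈ X) (h' : S.WF Y)
    (hG : ∀ {l k}, (G.link l).ETarget (.inl (k + 1)) → (G.link l).IsDer)
    (hS : ∀ {l k}, (S.link l).ETarget (.inl k) → (S.link l).IsDer) :
    (subNet G S).WF ((X.erase 0).image Nat.pred ∪ Y) := by
  -- The incidences and boxes of the new net in terms of those of `G` and `S`.
  have hs : ∀ l n, ((Net.subNet G S).link (.inl l)).ESource n ↔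
      ∃ p, (G.link l).ESource (.inr p) ∧ n = .inr (.inl p) :=
    fun l n => Link.eSource_bind fun k => h.no_free
  have hp : ∀ l n, ((Net.subNet G S).link (.inl l)).ParVar n ↔
      ∃ p, (G.link l).ParVar (.inr p) ∧ n = .inr (.inl p) :=
    fun l n => Link.parVar_bind fun k => h.no_free
  have ht : ∀ l n, ((Net.subNet G S).link (.inl l)).ETarget n ↔
      ((G.link l).ETarget (.inl 0) ∧ n = .inr (.inr S.root)) ∨
      (∃ k, (G.link l).ETarget (.inl (k + 1)) ∧ n = .inl k) ∨
        ∃ p, (G.link l).ETarget (.inr p) ∧ n = .inr (.inl p) :=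
    fun l n => Link.eTarget_bind
  have hms : ∀ l n, ((Net.subNet G S).link (.inl l)).MSource n ↔
      ∃ p, (G.link l).MSource p ∧ n = .inl p := fun l n => Link.mSource_map
  have hmt : ∀ l n, ((Net.subNet G S).link (.inl l)).MTarget n ↔
      ∃ p, (G.link l).MTarget p ∧ n = .inl p := fun l n => Link.mTarget_map
  have hpar : ∀ l, ((Net.subNet G S).link (.inl l)).IsPar ↔ (G.link l).IsPar :=
    fun l => Link.isPar_map
  have hder : ∀ l, ((Net.subNet G S).link (.inl l)).IsDer ↔ (G.link l).IsDer :=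
    fun l => Link.isDer_map
  have hpr : ∀ l, ((Net.subNet G S).link (.inl l)).ETargetPrincipal ↔ (G.link l).ETargetPrincipal :=
    fun l => Link.eTargetPrincipal_map
  have hroot := h.root_src
  have htr : ∀ l, ¬ (G.link l).ETarget (.inr G.root) := fun l => h.not_target_root
  have hf : ∀ l k, ¬ (G.link l).ESource (.inl k) := fun l k => h.no_free
  have hbf : ∀ q k, ¬ G.InBox q (.inl k) := fun q k hk =>
    (exists_source_of_inBox hk).elim fun l hl => hf l k hl
  have hbr : ∀ q, ¬ G.InBox q (.inr G.root) := fun q => h.root_not_inBox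
  have hbs : ∀ q p, G.InBox q (.inr p) → ∃ l, (G.link l).ESource (.inr p) :=
    fun q p => exists_source_of_inBox
  have hs' : ∀ l n, ((Net.subNet G S).link (.inr l)).ESource n ↔
      ∃ p, (S.link l).ESource (.inr p) ∧ n = .inr (.inr p) :=
    fun l n => Link.eSource_sumMap fun k => h'.no_free
  have hp' : ∀ l n, ((Net.subNet G S).link (.inr l)).ParVar n ↔
      ∃ p, (S.link l).ParVar (.inr p) ∧ n = .inr (.inr p) :=
    fun l n => Link.parVar_sumMap fun k => h'.no_free
  have ht' : ∀ l n, ((Net.subNet G S).link (.inr l)).ETarget n ↔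
      (∃ k, (S.link l).ETarget (.inl k) ∧ n = .inl k) ∨
        ∃ p, (S.link l).ETarget (.inr p) ∧ n = .inr (.inr p) :=
    fun l n => Link.eTarget_sumMap
  have hms' : ∀ l n, ((Net.subNet G S).link (.inr l)).MSource n ↔
      ∃ p, (S.link l).MSource p ∧ n = .inr p := fun l n => Link.mSource_map
  have hmt' : ∀ l n, ((Net.subNet G S).link (.inr l)).MTarget n ↔
      ∃ p, (S.link l).MTarget p ∧ n = .inr p := fun l n => Link.mTarget_map
  have hpar' : ∀ l, ((Net.subNet G S).link (.inr l)).IsPar ↔ (S.link l).IsPar :=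
    fun l => Link.isPar_map
  have hder' : ∀ l, ((Net.subNet G S).link (.inr l)).IsDer ↔ (S.link l).IsDer :=
    fun l => Link.isDer_map
  have hpr' : ∀ l, ((Net.subNet G S).link (.inr l)).ETargetPrincipal ↔
      (S.link l).ETargetPrincipal :=
    fun l => Link.eTargetPrincipal_map
  have hroot' := h'.root_src
  have htr' : ∀ l, ¬ (S.link l).ETarget (.inr S.root) := fun l => h'.not_target_root
  have hf' : ∀ l k, ¬ (S.link l).ESource (.inl k) := fun l k => h'.no_free
  have hbf' : ∀ q k, ¬ S.InBox q (.inl k) := fun q k hk =>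
    (exists_source_of_inBox hk).elim fun l hl => hf' l k hl
  have hbr' : ∀ q, ¬ S.InBox q (.inr S.root) := fun q => h'.root_not_inBox
  have hbs' : ∀ q p, S.InBox q (.inr p) → ∃ l, (S.link l).ESource (.inr p) :=
    fun q p => exists_source_of_inBox
  have hib : ∀ q n, (Net.subNet G S).InBox (.inl q) n ↔
      ∃ p, G.InBox q (.inr p) ∧ n = .inr (.inl p) := fun q n =>
    inBox_image G (Net.subNet G S) (fun l => .inl l) (fun p => .inl p) rfl hs hp q n
  have hib' : ∀ q n, (Net.subNet G S).InBox (.inr q) n ↔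
      ∃ p, S.InBox q (.inr p) ∧ n = .inr (.inr p) := fun q n =>
    inBox_image S (Net.subNet G S) (fun l => .inr l) (fun p => .inr p) rfl hs' hp' q n
  -- The root of `S` is a target in the new net, since `0` is one in `G`.
  obtain ⟨l₀, hl₀⟩ := h.target_free.2 hX
  refine ⟨?_, ?_, ?_, ?_, ?_, ?_, ?_, ?_, ?_, ?_, ?_, ?_, ?_, ?_, ?_, ?_, ?_⟩
  · intro x
    simp [ht, ht', ← h.target_free, ← h'.target_free]
    grind
  · intro p
    rcases p with p | p <;>
      simp [ht, ht', hs, hs', h.target_inner, h'.target_inner, h.target_free, hX] <;> grind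
  · simp [hs]; grind
  · intro l n q hl hq
    rcases l with l | l <;> rcases q with q | q <;>
      simp [ht, ht', hib, hib'] at hl hq ⊢ <;>
      grind [h.mem_of_inBox, h'.mem_of_inBox]
  · intro l n q hl hd hq
    rcases l with l | l <;> rcases q with q | q <;>
      simp [ht, ht', hib, hib', hder, hder', hpar, hpar'] at hl hd hq ⊢ <;>
      grind [→ h.inBox_of_mem_box, → h.inBox_of_isPar, → h'.inBox_of_mem_box, → h'.inBox_of_isPar,
        h.target_inner_source, h'.target_inner_source]
  · intro a l l' hl hl' q
    rcases l with l | l <;> rcases l' with l' | l' <;> rcases q with q | q <;>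
      simp [hms, hms', hmt, hmt'] at hl hl' ⊢ <;>
      grind [h.mBox, h'.mBox]
  · rintro l
    rcases l with l | l <;> simp [h.irrefl, h'.irrefl]
  · intro k l hk
    rcases k with k | k <;> rcases l with l | l <;>
      simp [hpar, hpar'] at hk ⊢ <;>
      grind [h.isPar_of_mem, h'.isPar_of_mem]
  · intro n l l' hl hl'
    rcases l with l | l <;> rcases l' with l' | l' <;>
      simp [hs, hs'] at hl hl' ⊢ <;>
      grind [h.eSource_unique, h'.eSource_unique]
  · intro n l l' hl hl'
    rcases l with l | l <;> rcases l' with l' | l' <;>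
      simp [hms, hms'] at hl hl' ⊢ <;>
      grind [h.mSource_unique, h'.mSource_unique]
  · intro n l l' hl hl'
    rcases l with l | l <;> rcases l' with l' | l' <;>
      simp [hmt, hmt'] at hl hl' ⊢ <;>
      grind [h.mTarget_unique, h'.mTarget_unique]
  · intro x l
    rcases l with l | l <;> simp [hs, hs']
  · intro n l l' hl hd hl'
    rcases l with l | l <;> rcases l' with l' | l' <;>
      simp [ht, ht', hder, hder'] at hl hd hl' ⊢ <;>
      grind [h.target_unique, h'.target_unique]
  · intro x l hl
    rcases l with l | l <;> simp [ht, ht', hpr, hpr'] at hl ⊢ <;>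
      grind [h.free_principal, h'.free_principal]
  · intro q
    rcases q with q | q <;> simp [hib, hib'] <;> grind
  · intro l n hl hl'
    rcases l with l | l <;> simp [ht, ht', hs, hs'] at hl hl' ⊢ <;> grind [h.no_loop, h'.no_loop]
  · intro l k j m n hl hm hk hj hd hjt
    rcases l with l | l <;> rcases k with k | k <;> rcases j with j | j <;>
      simp [hs, hs', ht, ht', hms, hms', hmt, hmt', hder, hder'] at hl hm hk hj hd hjt ⊢ <;>
      grind [h.acyclic, h'.acyclic]

end WF

theorem isDer_of_map_target_free {N N' M M' : Type} {f : N → ℕ ⊕ N'} {g : M → M'} {l : Link N M} {x}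
    (h : ∀ n, l.ETarget n → f n = .inl x → l.IsDer)
    (hl : (l.map f g).ETarget (.inl x)) : (l.map f g).IsDer := by
  obtain ⟨n, hn, e⟩ := Link.eTarget_map.1 hl
  exact Link.isDer_map.2 (h n hn e.symm)

end Net

namespace Term

theorem isDer_of_target_weaken {G : Net}
    (h : ∀ {l x}, (G.link l).ETarget (.inl x) → (G.link l).IsDer)
    (W : Finset ℕ) {l k} (hl : ((G.weaken ({0} \ W)).link l).ETarget (.inl (k + 1))) :
    ((G.weaken ({0} \ W)).link l).IsDer := by
  rcases l with l | ⟨y, hy⟩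
  · exact h hl
  · have : y = 0 := by simp at hy; exact hy.1
    cases Sum.inl.inj hl.symm
    omega

open Net in
theorem isDer_of_map_bind {G : Net}
    (h : ∀ {l k}, (G.link l).ETarget (.inl (k + 1)) → (G.link l).IsDer)
    {E' M' : Type} {y : E'} {f : G.E → E'} {g : G.M → M'} {l x}
    (hl : ((G.link l).map (bind y f) g).ETarget (.inl x)) :
    ((G.link l).map (bind y f) g).IsDer := by
  refine isDer_of_map_target_free (fun n hn e => ?_) hl
  rcases n with (_ | k) | n
  · cases e
  · exact h hn
  · cases e

open Net in
theorem isDer_of_map_sumMap {G : Net} (h : ∀ {l k}, (G.link l).ETarget (.inl k) → (G.link l).IsDer)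
    {E' M' : Type} {f : G.E → E'} {g : G.M → M'} {l x}
    (hl : ((G.link l).map (Sum.map id f) g).ETarget (.inl x)) :
    ((G.link l).map (Sum.map id f) g).IsDer := by
  refine isDer_of_map_target_free (fun n hn e => ?_) hl
  rcases n with k | n
  · exact h hn
  · cases e

/-- The links on the free variables of `⟦t⟧` are derelictions. -/
theorem isDer_of_target_free (t : Term) :
    ∀ {l x}, (t.net.link l).ETarget (.inl x) → (t.net.link l).IsDer := by
  induction t with
  | var y => rintro (_ | _) x hl <;> trivial
  | lam t ih =>
    rintro ((_ | _) | l) x hl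
    · cases hl
    · cases hl
    · exact isDer_of_map_bind (G := t.net.weaken ({0} \ t.fv)) (isDer_of_target_weaken ih _) hl
  | appVar y s ih =>
    rintro ((_ | _) | l) x hl
    · trivial
    · cases hl
    · exact isDer_of_map_sumMap ih hl
  | appLam t s iht ihs =>
    rintro ((_ | _) | l | l) x hl
    · cases hl
    · cases hl
    · exact isDer_of_map_bind (G := t.net.weaken ({0} \ t.fv)) (isDer_of_target_weaken iht _) hl
    · exact isDer_of_map_sumMap ihs hl
  | sub t u iht ihu =>
    rintro (l | l) x hl
    · exact isDer_of_map_bind (G := t.net.weaken ({0} \ t.fv)) (isDer_of_target_weaken iht _) hl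
    · exact isDer_of_map_sumMap ihu hl

theorem erase_union_sdiff (s : Finset ℕ) : (s ∪ {0} \ s).erase 0 = s.erase 0 := by
  ext; simp

theorem zero_mem_union_sdiff (s : Finset ℕ) : 0 ∈ s ∪ {0} \ s := by
  simp

/-- `⟦t⟧` is well formed, with free variables `fv t`. -/
theorem wf_net (t : Term) : t.net.WF t.fv := by
  have hw (t : Term) (h : t.net.WF t.fv) :
      (t.net.weaken ({0} \ t.fv)).WF (t.fv ∪ {0} \ t.fv) :=
    h.weaken _ fun x hx => (Finset.mem_sdiff.1 hx).2
  induction t with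
  | var y => exact .varNet y
  | lam t ih =>
    have := (hw t ih).lamNet (zero_mem_union_sdiff _)
      (isDer_of_target_weaken t.isDer_of_target_free _)
    rwa [erase_union_sdiff] at this
  | appVar y s ih => exact ih.appVarNet y s.isDer_of_target_free
  | appLam t s iht ihs =>
    have := (hw t iht).appLamNet (zero_mem_union_sdiff _) ihs
      (isDer_of_target_weaken t.isDer_of_target_free _) s.isDer_of_target_free
    rwa [erase_union_sdiff] at this
  | sub t u iht ihu =>
    have := (hw t iht).subNet (zero_mem_union_sdiff _) ihu
      (isDer_of_target_weaken t.isDer_of_target_free _) u.isDer_of_target_free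
    rwa [erase_union_sdiff] at this

/-- `⟦t⟧_X` is well formed. -/
theorem wf_netX (t : Term) {X : Finset ℕ} (hX : t.fv ⊆ X) : (t.netX X).WF X := by
  have := t.wf_net.weaken (X \ t.fv) fun x hx => (Finset.mem_sdiff.1 hx).2
  rwa [Finset.union_sdiff_of_subset hX] at this

end Term

/-! ### One-hole contexts -/

theorem Link.map_eq_self {N M : Type} {f : N → N} {g : M → M} (hf : ∀ n, f n = n)
    (hg : ∀ a, g a = a) {l : Link N M} : l.map f g = l := by
  cases l <;> simp [map, hf, hg]

namespace Net

/-- Isomorphisms of nets given by bijections on all elements of the types of nodes, including those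
that are not nodes. -/
structure StrictIso (G G' : Net) where
  onL : G.L ≃ G'.L
  onE : G.E ≃ G'.E
  onM : G.M ≃ G'.M
  link_eq : ∀ l, G'.link (onL l) = (G.link l).map (Sum.map id onE) onM
  box_iff : ∀ l k, onL k ∈ G'.box (onL l) ↔ k ∈ G.box l
  root_eq : onE G.root = G'.root

namespace StrictIso

variable {G G' : Net}

/-- A strict isomorphism is an embedding. -/
def emb (f : StrictIso G G') : Emb G G' where
  onL := f.onL
  onE := f.onE
  onM := f.onM
  injL := f.onL.injective
  injE := f.onE.injective.injOn
  injM := f.onM.injective.injOn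
  link_eq := f.link_eq
  box_iff := f.box_iff
  root_eq := f.root_eq
  cover l := .inl ⟨f.onL.symm l, by simp⟩

/-- The inverse of a strict isomorphism. -/
def symm (f : StrictIso G G') : StrictIso G' G where
  onL := f.onL.symm
  onE := f.onE.symm
  onM := f.onM.symm
  link_eq l := by
    obtain ⟨l, rfl⟩ := f.onL.surjective l
    rw [f.link_eq, Link.map_map, Equiv.symm_apply_apply]
    refine (Link.map_eq_self (fun n => ?_) fun a => ?_).symm
    · rcases n with x | n <;> simp
    · simp
  box_iff l k := by
    rw [← f.box_iff, Equiv.apply_symm_apply, Equiv.apply_symm_apply]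
  root_eq := by rw [← f.root_eq, Equiv.symm_apply_apply]

end StrictIso

/-- A net with a hole.  In `link` and `root`, the node `none` is the root of the net that fills the
hole; `var` says what the free variables of that net become; `holeIn` is the set of the links in
whose box the hole lies. -/
structure Ctx where
  E : Type
  M : Type
  L : Type
  link : L → Link (ℕ ⊕ Option E) M
  box : L → Set L
  holeIn : Set L
  var : ℕ → ℕ ⊕ E
  root : Option E

namespace Ctx

variable (C : Ctx) (G : Net)

/-- The nodes of the context in the filled context. -/
def outer {G : Net} : Option C.E → C.E ⊕ G.E
  | none => .inr G.root
  | some e => .inl e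

/-- The nodes of the net that fills the hole in the filled context. -/
def inner {E : Type} : ℕ ⊕ E → ℕ ⊕ (C.E ⊕ E)
  | .inl x => (C.var x).map id .inl
  | .inr n => .inr (.inr n)

/-- The context `C` with its hole filled by `G`. -/
@[reducible] def plug : Net where
  E := C.E ⊕ G.E
  M := C.M ⊕ G.M
  L := C.L ⊕ G.L
  link
    | .inl l => (C.link l).map (Sum.map id C.outer) .inl
    | .inr l => (G.link l).map C.inner .inr
  box
    | .inl q => {k | match k with
        | .inl l => l ∈ C.box q
        | .inr _ => q ∈ C.holeIn}
    | .inr q => .inr '' G.box q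
  root := C.outer C.root

variable {G} {G' : Net}

theorem eq_of_inner_eq {E : Type} {n : ℕ ⊕ E} {p} (h : C.inner n = .inr (.inr p)) : n = .inr p := by
  rcases n with x | n
  · cases hx : C.var x <;> simp [inner, hx] at h
  · simpa [inner] using h

/-- Filling a context is functorial.  The root has to be a node, since the context may identify it
with nodes of its own. -/
def plugEmb (f : Emb G G') (hr : G.root ∈ G.eNodes) : Emb (C.plug G) (C.plug G') where
  onL := Sum.map id f.onL
  onE := Sum.map id f.onE
  onM := Sum.map id f.onM
  injL := Function.injective_id.sumMap f.injL
  injE := by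
    have key : ∀ p, (.inr p : C.E ⊕ G.E) ∈ (C.plug G).eNodes → p ∈ G.eNodes := by
      rintro p ⟨l | l, hl⟩
      · have : p = G.root := by
          simp only [Link.eSource_map, Link.eTarget_map] at hl
          rcases hl with ⟨x | _ | e, _, h⟩ | ⟨x | _ | e, _, h⟩ <;> simp [outer] at h
          · exact h
          · exact h
        exact this ▸ hr
      · simp only [Link.eSource_map, Link.eTarget_map] at hl
        rcases hl with ⟨n, hn, h⟩ | ⟨n, hn, h⟩
        · exact ⟨l, .inl (C.eq_of_inner_eq h.symm ▸ hn)⟩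
        · exact ⟨l, .inr (C.eq_of_inner_eq h.symm ▸ hn)⟩
    rintro (p | p) hp (q | q) hq e
    · exact congrArg _ (Sum.inl.inj e : p = q)
    · cases e
    · cases e
    · rw [f.injE (key _ hp) (key _ hq) (Sum.inr.inj e)]
  injM := by
    have key : ∀ p, (.inr p : C.M ⊕ G.M) ∈ (C.plug G).mNodes → p ∈ G.mNodes := by
      rintro p ⟨l | l, hl⟩
      · simp [Link.mSource_map, Link.mTarget_map] at hl
      · simp only [Link.mSource_map, Link.mTarget_map] at hl
        rcases hl with ⟨n, hn, h⟩ | ⟨n, hn, h⟩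
        · exact ⟨l, .inl (Sum.inr.inj h ▸ hn)⟩
        · exact ⟨l, .inr (Sum.inr.inj h ▸ hn)⟩
    rintro (p | p) hp (q | q) hq e
    · exact congrArg _ (Sum.inl.inj e : p = q)
    · cases e
    · cases e
    · rw [f.injM (key _ hp) (key _ hq) (Sum.inr.inj e)]
  link_eq l := by
    rcases l with l | l
    · simp only [Sum.map_inl, Link.map_map, id]
      refine Link.map_congr ?_ fun _ _ => rfl
      rintro (x | _ | e) _
      · rfl
      · simp [outer, f.root_eq]
      · rfl
    · simp only [Sum.map_inr, f.link_eq, Link.map_map]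
      refine Link.map_congr ?_ fun _ _ => rfl
      rintro (x | p) _
      · cases hx : C.var x <;> simp [inner, hx]
      · rfl
  box_iff q l := by
    rcases q with q | q <;> rcases l with l | l <;> simp [f.box_iff]
  root_eq := by
    rcases h : C.root with _ | e
    · simp [h, outer, f.root_eq]
    · simp [h, outer]
  cover l := by
    rcases l with l | l
    · exact .inl ⟨.inl l, rfl⟩
    · rcases f.cover l with ⟨l, rfl⟩ | h
      · exact .inl ⟨.inr l, rfl⟩
      · exact .inr (by simpa using h)

end Ctx

/-! #### The contexts of the translation -/

/-- The context of the body of an abstraction. -/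
@[reducible] def lamCtx : Ctx where
  E := Bool
  M := Unit
  L := Bool
  link
    | true => .bang (.inr (some true)) ()
    | false => .par () (.inr (some false)) (.inr none)
  box _ := ∅
  holeIn := {false}
  var
    | 0 => .inr false
    | k + 1 => .inl k
  root := some true

/-- The context of the argument of a variable. -/
@[reducible] def appVarCtx (x : ℕ) : Ctx where
  E := Unit
  M := Unit
  L := Bool
  link
    | true => .tens (.inr (some ())) () (.inr none)
    | false => .der () (.inl x)
  box _ := ∅
  holeIn := ∅
  var := .inl
  root := some ()

/-- The context of the body of an abstraction applied to `S`. -/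
@[reducible] def appLamLeftCtx (S : Net) : Ctx where
  E := Bool ⊕ S.E
  M := Unit ⊕ S.M
  L := Bool ⊕ S.L
  link
    | .inl true => .tens (.inr (some (.inl true))) (.inl ()) (.inr (some (.inr S.root)))
    | .inl false => .par (.inl ()) (.inr (some (.inl false))) (.inr none)
    | .inr l => (S.link l).map (Sum.map id (some ∘ .inr)) .inr
  box
    | .inl _ => ∅
    | .inr l => .inr '' S.box l
  holeIn := {.inl false}
  var
    | 0 => .inr (.inl false)
    | k + 1 => .inl k
  root := some (.inl true)

/-- The context of the argument of an abstraction with body `G`. -/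
@[reducible] def appLamRightCtx (G : Net) : Ctx where
  E := Bool ⊕ G.E
  M := Unit ⊕ G.M
  L := Bool ⊕ G.L
  link
    | .inl true => .tens (.inr (some (.inl true))) (.inl ()) (.inr none)
    | .inl false => .par (.inl ()) (.inr (some (.inl false))) (.inr (some (.inr G.root)))
    | .inr l => (G.link l).map (bind (some (.inl false)) (some ∘ .inr)) .inr
  box
    | .inl true => ∅
    | .inl false => Set.range .inr
    | .inr l => .inr '' G.box l
  holeIn := ∅
  var := .inl
  root := some (.inl true)

/-- The context of the body of an explicit substitution of `S`. -/
@[reducible] def subLeftCtx (S : Net) : Ctx where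
  E := S.E
  M := S.M
  L := S.L
  link l := (S.link l).map (Sum.map id some) id
  box l := S.box l
  holeIn := ∅
  var
    | 0 => .inr S.root
    | k + 1 => .inl k
  root := none

/-- The context of the argument of an explicit substitution in `G`. -/
@[reducible] def subRightCtx (G : Net) : Ctx where
  E := G.E
  M := G.M
  L := G.L
  link l := (G.link l).map (bind none some) id
  box l := G.box l
  holeIn := ∅
  var := .inl
  root := some G.root

/-- `(a ⊕ c) ⊕ b ≃ a ⊕ (b ⊕ c)`. -/
@[simps] def sumRight (a b c : Type) : (a ⊕ c) ⊕ b ≃ a ⊕ (b ⊕ c) where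
  toFun
    | .inl (.inl x) => .inl x
    | .inl (.inr x) => .inr (.inr x)
    | .inr x => .inr (.inl x)
  invFun
    | .inl x => .inl (.inl x)
    | .inr (.inl x) => .inr x
    | .inr (.inr x) => .inl (.inr x)
  left_inv := by rintro ((_ | _) | _) <;> rfl
  right_inv := by rintro (_ | _ | _) <;> rfl

/-- Filling `lamCtx` is forming the net of an abstraction. -/
def lamIso (G : Net) : StrictIso (lamCtx.plug G) (lamNet G) where
  onL := .refl _
  onE := .refl _
  onM := .refl _
  link_eq := by
    rintro ((_ | _) | l)
    · rfl
    · rfl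
    · simp only [Link.map_map, Equiv.refl_apply]
      refine Link.map_congr ?_ fun _ _ => rfl
      rintro ((_ | _) | _) _ <;> rfl
  box_iff := by
    rintro ((_ | _) | q) ((_ | _) | l) <;> simp
  root_eq := rfl

/-- Filling `appVarCtx` is forming the net of an application of a variable. -/
def appVarIso (x : ℕ) (S : Net) : StrictIso ((appVarCtx x).plug S) (appVarNet x S) where
  onL := .refl _
  onE := .refl _
  onM := .refl _
  link_eq := by
    rintro ((_ | _) | l)
    · rfl
    · rfl
    · simp only [Link.map_map, Equiv.refl_apply]
      refine Link.map_congr ?_ fun _ _ => rfl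
      rintro (_ | _) _ <;> rfl
  box_iff := by
    rintro ((_ | _) | q) ((_ | _) | l) <;> simp
  root_eq := rfl

/-- Filling `appLamLeftCtx` is forming the net of an application of an abstraction. -/
def appLamLeftIso (G S : Net) : StrictIso ((appLamLeftCtx S).plug G) (appLamNet G S) where
  onL := sumRight _ _ _
  onE := sumRight _ _ _
  onM := sumRight _ _ _
  link_eq := by
    rintro (((_ | _) | l) | l)
    · rfl
    · rfl
    · simp only [Link.map_map, sumRight_apply]
      refine Link.map_congr ?_ fun _ _ => rfl
      rintro (_ | _) _ <;> rfl
    · simp only [Link.map_map, sumRight_apply]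
      refine Link.map_congr ?_ fun _ _ => rfl
      rintro ((_ | _) | _) _ <;> rfl
  box_iff := by
    rintro (((_ | _) | q) | q) (((_ | _) | l) | l) <;> simp
  root_eq := rfl

/-- Filling `appLamRightCtx` is forming the net of an application of an abstraction. -/
def appLamRightIso (G S : Net) : StrictIso ((appLamRightCtx G).plug S) (appLamNet G S) where
  onL := Equiv.sumAssoc _ _ _
  onE := Equiv.sumAssoc _ _ _
  onM := Equiv.sumAssoc _ _ _
  link_eq := by
    rintro (((_ | _) | l) | l)
    · rfl
    · rfl
    · simp only [Link.map_map]
      refine Link.map_congr ?_ fun _ _ => rfl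
      rintro ((_ | _) | _) _ <;> rfl
    · simp only [Link.map_map]
      refine Link.map_congr ?_ fun _ _ => rfl
      rintro (_ | _) _ <;> rfl
  box_iff := by
    rintro (((_ | _) | q) | q) (((_ | _) | l) | l) <;> simp
  root_eq := rfl

/-- Filling `subLeftCtx` is forming the net of an explicit substitution. -/
def subLeftIso (G S : Net) : StrictIso ((subLeftCtx S).plug G) (subNet G S) where
  onL := Equiv.sumComm _ _
  onE := Equiv.sumComm _ _
  onM := Equiv.sumComm _ _
  link_eq := by
    rintro (l | l)
    · simp only [Link.map_map]
      refine Link.map_congr ?_ fun _ _ => rfl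
      rintro (_ | _) _ <;> rfl
    · simp only [Link.map_map]
      refine Link.map_congr ?_ fun _ _ => rfl
      rintro ((_ | _) | _) _ <;> rfl
  box_iff := by
    rintro (q | q) (l | l) <;> simp
  root_eq := rfl

/-- Filling `subRightCtx` is forming the net of an explicit substitution. -/
def subRightIso (G S : Net) : StrictIso ((subRightCtx G).plug S) (subNet G S) where
  onL := .refl _
  onE := .refl _
  onM := .refl _
  link_eq := by
    rintro (l | l)
    · simp only [Link.map_map]
      refine Link.map_congr ?_ fun _ _ => rfl
      rintro ((_ | _) | _) _ <;> rfl
    · simp only [Link.map_map]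
      refine Link.map_congr ?_ fun _ _ => rfl
      rintro (_ | _) _ <;> rfl
  box_iff := by
    rintro (q | q) (l | l) <;> simp
  root_eq := rfl

end Net

/-! ### Skeletons: the nets of terms without weakenings -/

namespace Net

variable {G G' S S' : Net}

/-- `lamNet` is functorial. -/
def lamEmb (f : Emb G G') (hr : G.root ∈ G.eNodes) : Emb (lamNet G) (lamNet G') :=
  (lamIso G).symm.emb.trans ((lamCtx.plugEmb f hr).trans (lamIso G').emb)

/-- `appVarNet` is functorial. -/
def appVarEmb (x : ℕ) (f : Emb S S') (hr : S.root ∈ S.eNodes) :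
    Emb (appVarNet x S) (appVarNet x S') :=
  (appVarIso x S).symm.emb.trans (((appVarCtx x).plugEmb f hr).trans (appVarIso x S').emb)

/-- `appLamNet` is functorial. -/
def appLamEmb (f : Emb G G') (hr : G.root ∈ G.eNodes) (g : Emb S S') (hs : S.root ∈ S.eNodes) :
    Emb (appLamNet G S) (appLamNet G' S') :=
  ((appLamLeftIso G S).symm.emb.trans
    (((appLamLeftCtx S).plugEmb f hr).trans (appLamLeftIso G' S).emb)).trans
  ((appLamRightIso G' S).symm.emb.trans
    (((appLamRightCtx G').plugEmb g hs).trans (appLamRightIso G' S').emb))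

/-- `subNet` is functorial. -/
def subEmb (f : Emb G G') (hr : G.root ∈ G.eNodes) (g : Emb S S') (hs : S.root ∈ S.eNodes) :
    Emb (subNet G S) (subNet G' S') :=
  ((subLeftIso G S).symm.emb.trans
    (((subLeftCtx S).plugEmb f hr).trans (subLeftIso G' S).emb)).trans
  ((subRightIso G' S).symm.emb.trans
    (((subRightCtx G').plugEmb g hs).trans (subRightIso G' S').emb))

/-- A net embeds into the net with additional weakenings. -/
def weakenEmb (G : Net) (W : Finset ℕ) : Emb G (G.weaken W) where
  onL := .inl
  onE := id
  onM := id
  injL := Sum.inl_injective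
  injE := Set.injOn_id _
  injM := Set.injOn_id _
  link_eq l := (Link.map_eq_self (by rintro (_ | _) <;> rfl) fun _ => rfl).symm
  box_iff _ _ := by simp
  root_eq := rfl
  cover := by
    rintro (l | l)
    · exact .inl ⟨l, rfl⟩
    · exact .inr trivial

end Net

open Net

namespace Term

/-- The skeleton of a term: its net without the weakenings. -/
def skel : Term → Net
  | var x => varNet x
  | lam t => lamNet t.skel
  | appVar x s => appVarNet x s.skel
  | appLam t s => appLamNet t.skel s.skel
  | sub t u => subNet t.skel u.skel

theorem skel_root_src (t : Term) : ∃ l, (t.skel.link l).ESource (.inr t.skel.root) := by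
  induction t with
  | var x => exact ⟨true, rfl⟩
  | lam t _ => exact ⟨.inl true, rfl⟩
  | appVar x s _ => exact ⟨.inl true, rfl⟩
  | appLam t s _ _ => exact ⟨.inl true, rfl⟩
  | sub t u ih _ =>
    obtain ⟨l, hl⟩ := ih
    exact ⟨.inl l, Link.eSource_map.2 ⟨_, hl, rfl⟩⟩

theorem skel_root_mem (t : Term) : t.skel.root ∈ t.skel.eNodes :=
  t.skel_root_src.imp fun _ => .inl

theorem skel_not_isWeak (t : Term) : ∀ l, ¬ (t.skel.link l).IsWeak := by
  induction t with
  | var x => rintro (_ | _) <;> exact id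
  | lam t ih =>
    rintro ((_ | _) | l)
    · exact id
    · exact id
    · exact mt Link.isWeak_map.1 (ih l)
  | appVar x s ih =>
    rintro ((_ | _) | l)
    · exact id
    · exact id
    · exact mt Link.isWeak_map.1 (ih l)
  | appLam t s iht ihs =>
    rintro ((_ | _) | l | l)
    · exact id
    · exact id
    · exact mt Link.isWeak_map.1 (iht l)
    · exact mt Link.isWeak_map.1 (ihs l)
  | sub t u iht ihu =>
    rintro (l | l)
    · exact mt Link.isWeak_map.1 (iht l)
    · exact mt Link.isWeak_map.1 (ihu l)

/-- The skeleton of a term embeds into its net. -/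
def skelEmb : (t : Term) → Emb t.skel t.net
  | var _ => .refl _
  | lam t => lamEmb (t.skelEmb.trans (weakenEmb _ _)) t.skel_root_mem
  | appVar x s => appVarEmb x s.skelEmb s.skel_root_mem
  | appLam t s => appLamEmb (t.skelEmb.trans (weakenEmb _ _)) t.skel_root_mem s.skelEmb
      s.skel_root_mem
  | sub t u => subEmb (t.skelEmb.trans (weakenEmb _ _)) t.skel_root_mem u.skelEmb u.skel_root_mem

theorem skel_no_free (t : Term) {l x} : ¬ (t.skel.link l).ESource (.inl x) := fun h =>
  t.wf_net.no_free (x := x) (l := t.skelEmb.onL l) <| by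
    rw [t.skelEmb.link_onL, Link.eSource_map]; exact ⟨_, h, rfl⟩

theorem skel_isDer_of_target_free (t : Term) {l x} (h : (t.skel.link l).ETarget (.inl x)) :
    (t.skel.link l).IsDer := by
  have := t.isDer_of_target_free (x := x) (l := t.skelEmb.onL l) <| by
    rw [t.skelEmb.link_onL, Link.eTarget_map]; exact ⟨_, h, rfl⟩
  rwa [t.skelEmb.link_onL, Link.isDer_map] at this

theorem skel_target_src (t : Term) {l p} (h : (t.skel.link l).ETarget (.inr p)) :
    ∃ k, (t.skel.link k).ESource (.inr p) := by
  obtain ⟨k, hk⟩ := t.wf_net.target_inner_source (p := t.skelEmb.onE p) (l := t.skelEmb.onL l) <| by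
    rw [t.skelEmb.link_onL, Link.eTarget_map]; exact ⟨_, h, rfl⟩
  obtain ⟨k, rfl⟩ := t.skelEmb.exists_of_not_isWeak hk.not_isWeak
  exact ⟨k, (t.skelEmb.eSource_iff ⟨l, .inr h⟩ k).1 hk⟩

theorem skelEmb_appLam (t s : Term) :
    (t.appLam s).skelEmb.onE = Sum.map id (Sum.map t.skelEmb.onE s.skelEmb.onE) ∧
      (t.appLam s).skelEmb.onM = Sum.map id (Sum.map t.skelEmb.onM s.skelEmb.onM) :=
  ⟨by funext x; rcases x with _ | _ | _ <;> rfl, by funext x; rcases x with _ | _ | _ <;> rfl⟩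

theorem skelEmb_sub (t s : Term) :
    (t.sub s).skelEmb.onE = Sum.map t.skelEmb.onE s.skelEmb.onE ∧
      (t.sub s).skelEmb.onM = Sum.map t.skelEmb.onM s.skelEmb.onM :=
  ⟨by funext x; rcases x with _ | _ <;> rfl, by funext x; rcases x with _ | _ <;> rfl⟩

end Term

/-! ### Contraction in contexts -/

namespace Net

/-- A cut of either kind, contracted without creating weakenings. -/
inductive Cut (G : Net) : Type
  | m (c : G.MCut)
  | e (c : G.BangCut)

namespace Cut

variable {G G' : Net}

/-- The node of a cut. -/
def node : G.Cut → G.M ⊕ G.E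
  | m c => .inl c.node
  | e c => .inr c.node

/-- The kind of a cut. -/
def kind : G.Cut → Kind
  | m _ => .m
  | e _ => .e

/-- The net obtained by eliminating the cut, up to weakenings. -/
noncomputable def contract : G.Cut → Net
  | m c => c.contract
  | e c => c.contract ∅

/-- The step identifies or removes neither the root nor a free variable, and all links on an
exponential cut node are derelictions or weakenings. -/
def Proper : G.Cut → Prop
  | m c => ∃ x b, c.x = .inr x ∧ c.body = .inr b ∧ x ≠ G.root ∧ b ≠ G.root
  | e c => c.node ≠ G.root ∧ ∀ l, (G.link l).ETarget (.inr c.node) → (G.link l).ETargetPrincipal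

/-- The image of a cut under an embedding. -/
def map (f : Emb G G') : G.Cut → G'.Cut
  | m c => m (f.mapMCut c)
  | e c => e (f.mapBang c)

theorem node_map (f : Emb G G') (c : G.Cut) : (c.map f).node = Sum.map f.onM f.onE c.node := by
  cases c <;> rfl

theorem kind_map (f : Emb G G') (c : G.Cut) : (c.map f).kind = c.kind := by
  cases c <;> rfl

theorem Proper.map {c : G.Cut} (h : c.Proper) (f : Emb G G') (hr : G.root ∈ G.eNodes) :
    (c.map f).Proper := by
  have key : ∀ {p}, p ∈ G.eNodes → p ≠ G.root → f.onE p ≠ G'.root := by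
    intro p hp hne e
    rw [← f.root_eq] at e
    exact hne (f.injE hp hr e)
  rcases c with c | c
  · obtain ⟨x, b, hx, hb, hx', hb'⟩ := h
    refine ⟨f.onE x, f.onE b, congrArg f.onN hx, congrArg f.onN hb, key ?_ hx', key ?_ hb'⟩
    · have := c.x_isNode
      rwa [hx] at this
    · have := c.body_isNode
      rwa [hb] at this
  · refine ⟨key c.node_isNode h.1, fun l hl => ?_⟩
    rcases f.cover l with ⟨l, rfl⟩ | hw
    · rw [f.link_onL, Link.eTargetPrincipal_map]
      exact h.2 l ((f.eTarget_iff c.node_isNode l).1 hl)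
    · exact hw.principal

/-- An embedding of nets induces an embedding of the contracted nets. -/
noncomputable def contractEmb (f : Emb G G') : (c : G.Cut) → Emb c.contract (c.map f).contract
  | m c => f.contractM c
  | e c => f.contractBang c (by simp)

end Cut

namespace Ctx

variable (C : Ctx) {G : Net}

/-- A cut of the net in the hole, as a cut of the filled context. -/
@[reducible] def plugBang (c : G.BangCut) : (C.plug G).BangCut where
  node := .inr c.node
  bang := .inr c.bang
  m := .inr c.m
  below := .inr c.below
  bang_eq := by simp only [c.bang_eq]; rfl
  below_src := Link.mSource_map.2 ⟨_, c.below_src, rfl⟩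

/-- A multiplicative redex of the net in the hole, as a redex of the filled context. -/
@[reducible] def plugMCut (c : G.MCut) : (C.plug G).MCut where
  node := .inr c.node
  tens := .inr c.tens
  par := .inr c.par
  r := C.inner c.r
  arg := C.inner c.arg
  x := C.inner c.x
  body := C.inner c.body
  tens_eq := by simp only [c.tens_eq]; rfl
  par_eq := by simp only [c.par_eq]; rfl

/-- A cut of the net in the hole, as a cut of the filled context. -/
def plugCut : G.Cut → (C.plug G).Cut
  | .m c => .m (C.plugMCut c)
  | .e c => .e (C.plugBang c)

theorem kind_plugCut (c : G.Cut) : (C.plugCut c).kind = c.kind := by cases c <;> rfl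

theorem node_plugCut (c : G.Cut) : (C.plugCut c).node = Sum.map .inr .inr c.node := by
  cases c <;> rfl

theorem target_inner {l : C.L} {p : G.E} (h : ((C.plug G).link (.inl l)).ETarget (.inr (.inr p))) :
    p = G.root := by
  rw [Link.eTarget_map] at h
  rcases h with ⟨x | _ | e, _, h⟩ <;> simp [outer] at h
  exact h

theorem proper_plugCut {c : G.Cut} (h : c.Proper) : (C.plugCut c).Proper := by
  have key : ∀ {p}, p ≠ G.root → (.inr p : C.E ⊕ G.E) ≠ (C.plug G).root := by
    intro p hp e
    cases hC : C.root <;> simp [hC, outer] at e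
    exact hp e
  rcases c with c | c
  · obtain ⟨x, b, hx, hb, hx', hb'⟩ := h
    exact ⟨.inr x, .inr b, by simp only [hx]; rfl, by simp only [hb]; rfl, key hx', key hb'⟩
  · refine ⟨key h.1, ?_⟩
    rintro (l | l) hl
    · exact absurd (C.target_inner hl) h.1
    · rw [Link.eTargetPrincipal_map]
      obtain ⟨n, hn, e⟩ := Link.eTarget_map.1 hl
      rw [C.eq_of_inner_eq e.symm] at hn
      exact h.2 l hn

/-- Contraction commutes with filling a context. -/
def plugContractM (c : G.MCut) (h : (Cut.m c).Proper) :
    Emb (C.plug c.contract) (C.plugMCut c).contract where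
  onL
    | .inl l => ⟨.inl l, by simp, by simp⟩
    | .inr l => ⟨.inr l.1, by simpa using l.2⟩
  onE := id
  onM := id
  injL := by
    rintro (l | l) (l' | l') e <;> simp [Subtype.ext_iff] at e
    · rw [e]
    · rw [Subtype.ext e]
  injE := Set.injOn_id _
  injM := Set.injOn_id _
  link_eq := by
    obtain ⟨x, b, hx, hb, hx', hb'⟩ := h
    rintro (l | l)
    · rw [MCut.link_contract]
      simp only [Link.map_map]
      refine Link.map_congr ?_ fun _ _ => rfl
      rintro n -
      simp only [Function.comp]
      rw [MCut.relabel_of_ne]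
      · rcases n with n | _ | n <;> rfl
      · rcases n with n | _ | n <;> simp [outer, hx, inner]
        exact hx'.symm
      · rcases n with n | _ | n <;> simp [outer, hb, inner]
        exact hb'.symm
    · rw [MCut.link_contract]
      change ((G.link l.1).map C.inner (Sum.inr : G.M → C.M ⊕ G.M)).map _ _ =
        (((G.link l.1).map c.relabel id).map C.inner (Sum.inr : G.M → C.M ⊕ G.M)).map _ _
      simp only [Link.map_map]
      refine Link.map_congr ?_ fun _ _ => rfl
      rintro n -
      simp only [Function.comp, Sum.map_id_id, id]
      by_cases hn : n = c.x
      · rw [c.relabel_of_eq_x hn, MCut.relabel_of_eq_x _ (by rw [hn])]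
      · have hn' : C.inner n ≠ C.inner c.x :=
          fun e => hn (by rw [hx] at e ⊢; exact C.eq_of_inner_eq e)
        by_cases hn₁ : n = c.body
        · rw [c.relabel_of_eq_body hn hn₁, MCut.relabel_of_eq_body _ hn' (by rw [hn₁])]
        · rw [c.relabel_of_ne hn hn₁, MCut.relabel_of_ne _ hn' fun e =>
            hn₁ (by
            change C.inner n = C.inner c.body at e
            rw [hb] at e ⊢; exact C.eq_of_inner_eq e)]
  box_iff := by
    rintro (q | q) (l | l) <;> simp [Subtype.ext_iff]
    exact fun _ => l.2
  root_eq := rfl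
  cover := by
    rintro ⟨l | l, h⟩
    · exact .inl ⟨.inl l, rfl⟩
    · exact .inl ⟨.inr ⟨l, by simpa using h⟩, rfl⟩

theorem mem_plugBang_H (c : G.BangCut) {l : (C.plug G).L} :
    l ∈ (C.plugBang c).H ↔ ∃ k ∈ c.H, l = .inr k := by
  rcases l with l | l <;> simp [BangCut.H]

theorem plugBang_kept_inl (c : G.BangCut) (h : c.node ≠ G.root) (l : C.L) :
    (C.plugBang c).Kept (.inl l) := by
  refine ⟨by simp, fun hl => h (C.target_inner hl), ?_⟩
  rw [mem_plugBang_H]; simp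

theorem eTarget_plug {l : G.L} {p : G.E} :
    ((C.plug G).link (.inr l)).ETarget (.inr (.inr p)) ↔ (G.link l).ETarget (.inr p) := by
  rw [Link.eTarget_map]
  exact ⟨fun ⟨n, hn, e⟩ => C.eq_of_inner_eq e.symm ▸ hn, fun h => ⟨_, h, rfl⟩⟩

theorem plugBang_kept_inr (c : G.BangCut) {l : G.L} :
    (C.plugBang c).Kept (.inr l) ↔ c.Kept l := by
  unfold BangCut.Kept
  rw [mem_plugBang_H, eTarget_plug]
  simp

theorem plugBang_inner (c : G.BangCut) {p : G.E} :
    (C.plugBang c).InnerE (.inr (.inr p)) ↔ c.InnerE (.inr p) := by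
  constructor
  · rintro ⟨l, hl, hs⟩
    obtain ⟨k, hk, rfl⟩ := (C.mem_plugBang_H c).1 hl
    obtain ⟨n, hn, e⟩ := Link.eSource_map.1 hs
    rw [C.eq_of_inner_eq e.symm] at hn
    exact ⟨k, hk, hn⟩
  · rintro ⟨k, hk, hs⟩
    exact ⟨.inr k, (C.mem_plugBang_H c).2 ⟨k, hk, rfl⟩, Link.eSource_map.2 ⟨_, hs, rfl⟩⟩

theorem plugBang_not_inner (c : G.BangCut) (hf : ∀ l x, ¬ (G.link l).ESource (.inl x)) {p : C.E} :
    ¬ (C.plugBang c).InnerE (.inr (.inl p)) := by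
  rintro ⟨l, hl, hs⟩
  obtain ⟨l, _, rfl⟩ := (C.mem_plugBang_H c).1 hl
  obtain ⟨n | n, hn, e⟩ := Link.eSource_map.1 hs
  · exact hf _ _ hn
  · cases e

/-- A dereliction on the cut node, in the filled context. -/
def plugD (c : G.BangCut) (d : c.D) : (C.plugBang c).D :=
  ⟨(.inr d.1.1, .inr d.1.2), by simp only [d.2]; rfl⟩

/-- Contraction commutes with filling a context. -/
noncomputable def plugContractE (c : G.BangCut) (h : (Cut.e c).Proper)
    (hf : ∀ l x, ¬ (G.link l).ESource (.inl x)) :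
    Emb (C.plug (c.contract ∅)) ((C.plugBang c).contract ∅) where
  onL
    | .inl l => .inl ⟨.inl l, C.plugBang_kept_inl c h.1 l⟩
    | .inr (.inl l) => .inl ⟨.inr l.1, (C.plugBang_kept_inr c).2 l.2⟩
    | .inr (.inr (.inl (d, l))) =>
        .inr (.inl (C.plugD c d, ⟨.inr l.1, (C.mem_plugBang_H c).2 ⟨_, l.2, rfl⟩⟩))
    | .inr (.inr (.inr n)) => n.2.elim
  onE
    | .inl e => (.inl e, none)
    | .inr (p, o) => (.inr p, o.map .inr)
  onM
    | .inl e => (.inl e, none)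
    | .inr (p, o) => (.inr p, o.map .inr)
  injL := by
    rintro (l | l | ⟨d, l⟩ | ⟨_, ⟨⟩⟩) (l' | l' | ⟨d', l'⟩ | ⟨_, ⟨⟩⟩) e
    · cases e; rfl
    · cases e
    · cases e
    · cases e
    · simp only [Sum.inr.injEq, Sum.inl.injEq, Subtype.mk.injEq] at e
      rw [Subtype.ext e]
    · cases e
    · cases e
    · cases e
    · simp only [Sum.inr.injEq, Sum.inl.injEq, Prod.mk.injEq, Subtype.mk.injEq] at e
      have : d = d' := BangCut.D.ext (Sum.inr.inj (congrArg (fun d => d.1.1) e.1))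
      rw [this, Subtype.ext e.2]
  injE := by
    rintro (p | ⟨p, o⟩) _ (q | ⟨q, o'⟩) _ e <;> simp at e
    · rw [e]
    · rw [e.1, Option.map_injective Sum.inr_injective e.2]
  injM := by
    rintro (p | ⟨p, o⟩) _ (q | ⟨q, o'⟩) _ e <;> simp at e
    · rw [e]
    · rw [e.1, Option.map_injective Sum.inr_injective e.2]
  link_eq := by
    rintro (l | l | ⟨d, l⟩ | ⟨_, ⟨⟩⟩)
    · simp only [Link.map_map]
      refine Link.map_congr ?_ fun _ _ => rfl
      rintro (n | _ | n) _ <;> rfl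
    · simp only [Link.map_map]
      refine Link.map_congr ?_ fun _ _ => rfl
      rintro (n | n) _
      · cases hn : C.var n <;> simp [inner, hn]
      · rfl
    · simp only [Link.map_map]
      refine Link.map_congr ?_ ?_
      · rintro (n | n) _
        · cases hn : C.var n with
          | inl x => simp [inner, hn, BangCut.copyE]
          | inr p =>
            simp [inner, hn, BangCut.copyE, C.plugBang_not_inner c hf]
        · by_cases hn : c.InnerE (.inr n)
          · simp only [Function.comp, inner, BangCut.copyE_of_inner hn,
              BangCut.copyE_of_inner ((C.plugBang_inner c).2 hn)]
            rfl
          · simp only [Function.comp, inner, BangCut.copyE_of_not_inner hn,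
              BangCut.copyE_of_not_inner (mt (C.plugBang_inner c).1 hn)]
            rfl
      · intro a _
        by_cases ha : a = c.m
        · simp [BangCut.copyM, ha, plugD]
        · simp [BangCut.copyM, ha, plugD]
  box_iff := by
    rintro (q | q | ⟨d, q⟩ | ⟨_, ⟨⟩⟩) (l | l | ⟨d', l⟩ | ⟨_, ⟨⟩⟩)
    all_goals simp [plugD]
    exact fun _ => ⟨fun h => BangCut.D.ext h.1.1,
      fun h => ⟨by simp [h], (C.mem_plugBang_H c).2 ⟨_, l.2, rfl⟩⟩⟩
  root_eq := by
    cases hC : C.root <;> simp [outer, hC]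
  cover := by
    rintro (⟨l | l, hl⟩ | ⟨⟨⟨l, m⟩, hd⟩, ⟨k, hk⟩⟩ | ⟨_, ⟨⟩⟩)
    · exact .inl ⟨.inl l, rfl⟩
    · exact .inl ⟨.inr (.inl ⟨l, (C.plugBang_kept_inr c).1 hl⟩), rfl⟩
    · obtain ⟨k, hk', rfl⟩ := (C.mem_plugBang_H c).1 hk
      rcases l with l | l
      · exact absurd (C.target_inner (by rw [hd]; rfl)) h.1
      · obtain ⟨s, t, hst, rfl, e⟩ := Link.map_eq_der.1 hd
        rw [C.eq_of_inner_eq e] at hst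
        exact .inl ⟨.inr (.inr (.inl (⟨(l, s), hst⟩, ⟨k, hk'⟩))), rfl⟩

/-- Contraction commutes with filling a context. -/
noncomputable def plugContract (hf : ∀ l x, ¬ (G.link l).ESource (.inl x)) :
    (c : G.Cut) → c.Proper → Emb (C.plug c.contract) (C.plugCut c).contract
  | .m c, h => C.plugContractM c h
  | .e c, h => C.plugContractE c h hf

end Ctx

end Net

/-! ### Simulation of multiplicative steps, and congruence -/

namespace Net

/-- The multiplicative redex at the root of `appLamNet G S`. -/
@[reducible] def rootMCut (G S : Net) : (appLamNet G S).MCut where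
  node := .inl ()
  tens := .inl true
  par := .inl false
  r := .inr (.inl true)
  arg := .inr (.inr (.inr S.root))
  x := .inr (.inl false)
  body := .inr (.inr (.inl G.root))
  tens_eq := rfl
  par_eq := rfl

open Classical in
/-- The `m`-step at the root yields the net of the explicit substitution. -/
noncomputable def rootMEmb (G S : Net) : Emb (subNet G S) (rootMCut G S).contract where
  onL
    | .inl l => ⟨.inr (.inl l), by simp⟩
    | .inr l => ⟨.inr (.inr l), by simp⟩
  -- The root of the opened box is identified with the source of the `tens`, which is the node that
  -- is kept.
  onE
    | .inl p => if p = G.root then .inl true else .inr (.inl p)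
    | .inr p => .inr (.inr p)
  onM := .inr
  injL := by
    rintro (l | l) (l' | l') e <;> simp at e <;> rw [e]
  injE := by
    rintro (p | p) _ (q | q) _ e
    · dsimp only at e
      split_ifs at e with hp hq
      · rw [hp, hq]
      · rw [Sum.inl.inj (Sum.inr.inj e)]
    · dsimp only at e
      split_ifs at e
      cases e
    · dsimp only at e
      split_ifs at e
      cases e
    · rw [Sum.inr.inj (Sum.inr.inj e)]
  injM := Sum.inr_injective.injOn
  link_eq := by
    rintro (l | l)
    · rw [MCut.link_contract]
      simp only [Link.map_map]
      refine Link.map_congr ?_ fun _ _ => rfl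
      rintro ((_ | k) | p) _
      · exact MCut.relabel_of_eq_x _ rfl
      · exact MCut.relabel_of_ne _ (by simp [bind]) (by simp [bind])
      · simp only [Function.comp, bind, Sum.map_inr]
        by_cases hp : p = G.root
        · subst hp
          rw [MCut.relabel_of_eq_body _ (by simp) rfl, if_pos rfl]
        · rw [MCut.relabel_of_ne _ (by simp) (by simpa using hp), if_neg hp]
    · rw [MCut.link_contract]
      simp only [Link.map_map]
      refine Link.map_congr ?_ fun _ _ => rfl
      rintro (k | p) _
      · exact MCut.relabel_of_ne _ (by simp) (by simp)
      · exact MCut.relabel_of_ne _ (by simp) (by simp)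
  box_iff := by
    rintro (q | q) (l | l) <;> simp
  root_eq := if_pos rfl
  cover := by
    rintro ⟨(_ | _) | l | l, h⟩
    · simp at h
    · simp at h
    · exact .inl ⟨.inl l, rfl⟩
    · exact .inl ⟨.inr l, rfl⟩

end Net

open Net

namespace Term

/-- Some cut of the skeleton of `t`, with the same node as the redex `R`, simulates `R`. -/
def Redex.Simulated {t : Term} (R : t.Redex) : Prop :=
  ∃ c : t.skel.Cut, c.Proper ∧ c.kind = R.kind ∧
    Sum.map t.skelEmb.onM t.skelEmb.onE c.node = R.node ∧ Nonempty (Emb R.contract.skel c.contract)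

/-- A simulation may be put into a context, as contraction commutes with filling the context. -/
theorem exists_cut_of_ctx {t t' T T' : Term} (C : Ctx) (f : StrictIso (C.plug t.skel) T.skel)
    (f' : StrictIso (C.plug t'.skel) T'.skel) {c : t.skel.Cut} (hc : c.Proper)
    (h : Nonempty (Emb t'.skel c.contract)) :
    ∃ c' : T.skel.Cut, c'.Proper ∧ c'.kind = c.kind ∧
      c'.node = Sum.map (f.onM ∘ .inr) (f.onE ∘ .inr) c.node ∧
      Nonempty (Emb T'.skel c'.contract) := by
  obtain ⟨e⟩ := h
  have hr : (C.plug t.skel).root ∈ (C.plug t.skel).eNodes := by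
    obtain ⟨l, hl⟩ := T.skel_root_src
    rw [← f.root_eq] at hl
    obtain ⟨l, rfl⟩ := f.onL.surjective l
    rw [f.link_eq, Link.eSource_map] at hl
    obtain ⟨n | n, hn, e⟩ := hl
    · cases e
    · rw [← f.onE.injective (Sum.inr.inj e)] at hn
      exact ⟨l, .inl hn⟩
  refine ⟨(C.plugCut c).map f.emb, (C.proper_plugCut hc).map _ hr, ?_, ?_, ⟨?_⟩⟩
  · rw [Cut.kind_map, C.kind_plugCut]
  · rw [Cut.node_map, C.node_plugCut]
    rcases c with c | c <;> rfl
  · exact f'.symm.emb.trans ((C.plugEmb e t'.skel_root_mem).trans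
      ((C.plugContract (fun _ _ => t.skel_no_free) c hc).trans (Cut.contractEmb f.emb _)))

namespace Redex

theorem simulated_mRoot (t u : Term) : (mRoot t u).Simulated :=
  ⟨.m (rootMCut t.skel u.skel), ⟨_, _, rfl, rfl, by simp [skel], by simp [skel]⟩, rfl, rfl,
    ⟨rootMEmb t.skel u.skel⟩⟩

theorem Simulated.lam {t : Term} {R : t.Redex} (h : R.Simulated) : (Redex.lam R).Simulated := by
  obtain ⟨c, hc, hk, hn, he⟩ := h
  obtain ⟨c', hc', hk', hn', he'⟩ := exists_cut_of_ctx (T := t.lam) (T' := R.contract.lam) lamCtx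
    (lamIso _) (lamIso _) hc he
  refine ⟨c', hc', hk'.trans hk, ?_, he'⟩
  rw [hn', node, ← hn]
  rcases c with c | c <;> rfl

theorem Simulated.appVar {t : Term} {R : t.Redex} (h : R.Simulated) (x : ℕ) :
    (Redex.appVar x R).Simulated := by
  obtain ⟨c, hc, hk, hn, he⟩ := h
  obtain ⟨c', hc', hk', hn', he'⟩ := exists_cut_of_ctx (T := t.appVar x)
    (T' := R.contract.appVar x) (appVarCtx x) (appVarIso _ _) (appVarIso _ _) hc he
  refine ⟨c', hc', hk'.trans hk, ?_, he'⟩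
  rw [hn', node, ← hn]
  rcases c with c | c <;> rfl

theorem Simulated.appLamLeft {t : Term} {R : t.Redex} (h : R.Simulated) (s : Term) :
    (Redex.appLamLeft s R).Simulated := by
  obtain ⟨c, hc, hk, hn, he⟩ := h
  obtain ⟨c', hc', hk', hn', he'⟩ := exists_cut_of_ctx (T := t.appLam s)
    (T' := R.contract.appLam s) (appLamLeftCtx s.skel) (appLamLeftIso _ _) (appLamLeftIso _ _) hc he
  refine ⟨c', hc', hk'.trans hk, ?_, he'⟩
  rw [hn', node, ← hn]
  rcases c with c | c <;> rfl

theorem Simulated.appLamRight {s : Term} {R : s.Redex} (h : R.Simulated) (t : Term) :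
    (Redex.appLamRight t R).Simulated := by
  obtain ⟨c, hc, hk, hn, he⟩ := h
  obtain ⟨c', hc', hk', hn', he'⟩ := exists_cut_of_ctx (T := t.appLam s)
    (T' := t.appLam R.contract) (appLamRightCtx t.skel) (appLamRightIso _ _) (appLamRightIso _ _)
    hc he
  refine ⟨c', hc', hk'.trans hk, ?_, he'⟩
  rw [hn', node, ← hn]
  rcases c with c | c <;> rfl

theorem Simulated.subLeft {t : Term} {R : t.Redex} (h : R.Simulated) (s : Term) :
    (Redex.subLeft s R).Simulated := by
  obtain ⟨c, hc, hk, hn, he⟩ := h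
  obtain ⟨c', hc', hk', hn', he'⟩ := exists_cut_of_ctx (T := t.sub s)
    (T' := R.contract.sub s) (subLeftCtx s.skel) (subLeftIso _ _) (subLeftIso _ _) hc he
  refine ⟨c', hc', hk'.trans hk, ?_, he'⟩
  rw [hn', node, ← hn]
  rcases c with c | c <;> rfl

theorem Simulated.subRight {s : Term} {R : s.Redex} (h : R.Simulated) (t : Term) :
    (Redex.subRight t R).Simulated := by
  obtain ⟨c, hc, hk, hn, he⟩ := h
  obtain ⟨c', hc', hk', hn', he'⟩ := exists_cut_of_ctx (T := t.sub s)
    (T' := t.sub R.contract) (subRightCtx t.skel) (subRightIso _ _) (subRightIso _ _) hc he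
  refine ⟨c', hc', hk'.trans hk, ?_, he'⟩
  rw [hn', node, ← hn]
  rcases c with c | c <;> rfl

end Redex

end Term

/-! ### Substitution in nets -/

/-- The contents of `bang`-links.  The `m`-node `none` is the source of the content, and `top` is
the link with that source. -/
structure Content where
  E : Type
  M : Type
  L : Type
  link : L → Link (ℕ ⊕ E) (Option M)
  box : L → Set L
  top : L

namespace Content

/-- A dereliction on the free variable `y`. -/
@[reducible] def var (y : ℕ) : Content where
  E := Empty
  M := Empty
  L := Unit
  link _ := .der none (.inl y)
  box _ := ∅
  top := ()

/-- A `par` with box `G`, whose variable is the free variable `0` of `G`. -/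
@[reducible] def lam (G : Net) : Content where
  E := Option G.E
  M := G.M
  L := Option G.L
  link
    | none => .par none (.inr none) (.inr (some G.root))
    | some l => (G.link l).map (Net.bind none some) some
  box
    | none => Set.range some
    | some l => some '' G.box l
  top := none

/-- Renaming of the free variables. -/
@[reducible] def ren (f : ℕ → ℕ) (c : Content) : Content where
  E := c.E
  M := c.M
  L := c.L
  link l := (c.link l).map (Sum.map f id) id
  box := c.box
  top := c.top

/-- A substitution of contents for free variables, under a binder. -/
@[reducible] def up (τ : ℕ → Content) : ℕ → Content
  | 0 => var 0
  | k + 1 => (τ k).ren Nat.succ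

/-- The substitution of `c` for the free variable `0`, whose binder disappears. -/
@[reducible] def inst (c : Content) : ℕ → Content
  | 0 => c
  | k + 1 => var k

/-- A `bang` on a content. -/
@[reducible] def bang (c : Content) : Net where
  E := Option c.E
  M := Option c.M
  L := Option c.L
  link
    | none => .bang (.inr none) none
    | some l => (c.link l).map (Sum.map id some) id
  box
    | none => ∅
    | some l => some '' c.box l
  root := none

/-- A `tens` on a content and on the root of `S`. -/
@[reducible] def tens (c : Content) (S : Net) : Net where
  E := Option c.E ⊕ S.E
  M := Option c.M ⊕ S.M
  L := Option c.L ⊕ S.L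
  link
    | .inl none => .tens (.inr (.inl none)) (.inl none) (.inr (.inr S.root))
    | .inl (some l) => (c.link l).map (Sum.map id (.inl ∘ some)) .inl
    | .inr l => (S.link l).map (Sum.map id .inr) .inr
  box
    | .inl none => ∅
    | .inl (some l) => (.inl ∘ some) '' c.box l
    | .inr l => .inr '' S.box l
  root := .inl none

end Content

namespace Net

/-- The unique element of `Unit` as that of `Option Empty`. -/
@[simps] def unitEquiv : Unit ≃ Option Empty where
  toFun _ := none
  invFun _ := ()
  left_inv _ := rfl
  right_inv := by rintro (_ | ⟨⟨⟩⟩); rfl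

/-- `true` corresponds to `none`. -/
@[simps] def boolEquiv : Bool ≃ Option Unit where
  toFun b := if b then none else some ()
  invFun o := o.isNone
  left_inv := by rintro (_ | _) <;> rfl
  right_inv := by rintro (_ | _) <;> rfl

/-- The elements of `Unit ⊕ α` as those of `Option α`. -/
@[simps] def unitSumEquiv (α : Type) : Unit ⊕ α ≃ Option α where
  toFun
    | .inl _ => none
    | .inr a => some a
  invFun
    | none => .inl ()
    | some a => .inr a
  left_inv := by rintro (_ | _) <;> rfl
  right_inv := by rintro (_ | _) <;> rfl

/-- The elements of `Bool ⊕ α` as those of `Option (Option α)`; `true` corresponds to `none`. -/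
@[simps] def boolSumEquiv (α : Type) : Bool ⊕ α ≃ Option (Option α) where
  toFun
    | .inl true => none
    | .inl false => some none
    | .inr a => some (some a)
  invFun
    | none => .inl true
    | some none => .inl false
    | some (some a) => .inr a
  left_inv := by rintro ((_ | _) | _) <;> rfl
  right_inv := by rintro (_ | _ | _) <;> rfl

/-- The net of a variable is a `bang` on a content. -/
def varBangIso (y : ℕ) : StrictIso (varNet y) (Content.var y).bang where
  onL := boolEquiv
  onE := unitEquiv
  onM := unitEquiv
  link_eq := by rintro (_ | _) <;> rfl
  box_iff := by rintro (_ | _) (_ | _) <;> simp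
  root_eq := rfl

/-- The net of an abstraction is a `bang` on a content. -/
def lamBangIso (G : Net) : StrictIso (lamNet G) (Content.lam G).bang where
  onL := boolSumEquiv _
  onE := boolSumEquiv _
  onM := unitSumEquiv _
  link_eq := by
    rintro ((_ | _) | l)
    · rfl
    · rfl
    · simp only [boolSumEquiv_apply, Link.map_map]
      refine Link.map_congr ?_ fun _ _ => rfl
      rintro ((_ | _) | _) _ <;> rfl
  box_iff := by rintro ((_ | _) | _) ((_ | _) | _) <;> simp
  root_eq := rfl

/-- The net of an application of a variable is a `tens` on a content. -/
def varTensIso (y : ℕ) (S : Net) : StrictIso (appVarNet y S) ((Content.var y).tens S) where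
  onL := boolEquiv.sumCongr (.refl _)
  onE := unitEquiv.sumCongr (.refl _)
  onM := unitEquiv.sumCongr (.refl _)
  link_eq := by
    rintro ((_ | _) | l)
    · rfl
    · rfl
    · simp only [Equiv.sumCongr_apply, Link.map_map, Sum.map_inr, Equiv.refl_apply]
      refine Link.map_congr ?_ fun _ _ => rfl
      rintro (_ | _) _ <;> rfl
  box_iff := by rintro ((_ | _) | _) ((_ | _) | _) <;> simp
  root_eq := rfl

/-- The net of an application of an abstraction is a `tens` on a content. -/
def lamTensIso (G S : Net) : StrictIso (appLamNet G S) ((Content.lam G).tens S) where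
  onL := (Equiv.sumAssoc _ _ _).symm.trans ((boolSumEquiv _).sumCongr (.refl _))
  onE := (Equiv.sumAssoc _ _ _).symm.trans ((boolSumEquiv _).sumCongr (.refl _))
  onM := (Equiv.sumAssoc _ _ _).symm.trans ((unitSumEquiv _).sumCongr (.refl _))
  link_eq := by
    rintro ((_ | _) | l | l)
    · rfl
    · rfl
    · simp [Link.map_map]
      refine Link.map_congr ?_ fun _ _ => rfl
      rintro ((_ | _) | _) _ <;> rfl
    · simp [Link.map_map]
      refine Link.map_congr ?_ fun _ _ => rfl
      rintro (_ | _) _ <;> rfl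
  box_iff := by rintro ((_ | _) | _ | _) ((_ | _) | _ | _) <;> simp
  root_eq := rfl

/-- The derelictions on free variables. -/
structure FreeDer (G : Net) where
  l : G.L
  m : G.M
  k : ℕ
  eq : G.link l = .der m (.inl k)

/-- The link is a dereliction on a free variable. -/
def IsFreeDer (G : Net) (l : G.L) : Prop := ∃ m k, G.link l = .der m (.inl k)

/-- The simultaneous substitution of contents for the free variables: each dereliction on a free
variable is replaced by a copy of the content for that variable, which lies in the same boxes. -/
@[reducible] def subst (G : Net) (τ : ℕ → Content) : Net where
  E := G.E ⊕ Σ d : G.FreeDer, (τ d.k).E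
  M := G.M ⊕ Σ d : G.FreeDer, (τ d.k).M
  L := {l : G.L // ¬ G.IsFreeDer l} ⊕ Σ d : G.FreeDer, (τ d.k).L
  link
    | .inl l => (G.link l.1).map (Sum.map id .inl) .inl
    | .inr ⟨d, l⟩ => ((τ d.k).link l).map (Sum.map id fun e => .inr ⟨d, e⟩) fun
        | none => .inl d.m
        | some a => .inr ⟨d, a⟩
  box
    | .inl q => {k | match k with
        | .inl l => l.1 ∈ G.box q.1
        | .inr ⟨d, _⟩ => d.l ∈ G.box q.1}
    | .inr ⟨d, q⟩ => (fun l => .inr ⟨d, l⟩) '' (τ d.k).box q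
  root := .inl G.root

variable (G S : Net) (τ : ℕ → Content)

theorem map_sumMap_eq_der {G : Net} {E' M' : Type} {f : G.E → E'} {g : G.M → M'} {l : G.L} {m k} :
    (G.link l).map (Sum.map id f) g = .der m (.inl k) ↔
      ∃ a, G.link l = .der a (.inl k) ∧ g a = m := by
  rw [Link.map_eq_der]
  constructor
  · rintro ⟨a, x | p, h, rfl, e⟩ <;> cases e
    exact ⟨a, h, rfl⟩
  · rintro ⟨a, h, rfl⟩
    exact ⟨a, _, h, rfl, rfl⟩

theorem map_bind_eq_der {G : Net} {E' M' : Type} {x : E'} {f : G.E → E'} {g : G.M → M'} {l : G.L}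
    {m k} : (G.link l).map (bind x f) g = .der m (.inl k) ↔
      ∃ a, G.link l = .der a (.inl (k + 1)) ∧ g a = m := by
  rw [Link.map_eq_der]
  constructor
  · rintro ⟨a, (_ | x) | p, h, rfl, e⟩ <;> cases e
    exact ⟨a, h, rfl⟩
  · rintro ⟨a, h, rfl⟩
    exact ⟨a, _, h, rfl, rfl⟩

theorem not_isFreeDer_sumMap {G N : Net} {f : G.E → N.E} {g : G.M → N.M} {l : G.L} {j : N.L}
    (h : N.link j = (G.link l).map (Sum.map id f) g) (hl : ¬ G.IsFreeDer l) : ¬ N.IsFreeDer j := by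
  rintro ⟨m, k, hd⟩
  rw [h, map_sumMap_eq_der] at hd
  obtain ⟨a, ha, _⟩ := hd
  exact hl ⟨a, k, ha⟩

theorem not_isFreeDer_bind {G N : Net} {x : N.E} {f : G.E → N.E} {g : G.M → N.M} {l : G.L}
    {j : N.L} (h : N.link j = (G.link l).map (bind x f) g)
    (hl : ∀ m k, G.link l ≠ .der m (.inl (k + 1))) : ¬ N.IsFreeDer j := by
  rintro ⟨m, k, hd⟩
  rw [h, map_bind_eq_der] at hd
  obtain ⟨a, ha, _⟩ := hd
  exact hl _ _ ha

theorem isFreeDer_of_map {G N : Net} {f : ℕ ⊕ G.E → ℕ ⊕ N.E} {g : G.M → N.M} {l : G.L}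
    {j : N.L} (h : N.link j = (G.link l).map f g) {m k} (hl : G.link l = .der m k) {k'}
    (hk : f k = .inl k') : N.IsFreeDer j := by
  rw [hl] at h
  exact ⟨_, _, h.trans (by rw [Link.map, hk])⟩

/-- Substitution in the net of a variable. -/
def substVarEmb (x : ℕ) : Emb (τ x).bang ((varNet x).subst τ) where
  onL
    | none => .inl ⟨true, by rintro ⟨m, k, h⟩; cases h⟩
    | some l => .inr ⟨⟨false, (), x, rfl⟩, l⟩
  onE
    | none => .inl ()
    | some e => .inr ⟨⟨false, (), x, rfl⟩, e⟩
  onM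
    | none => .inl ()
    | some e => .inr ⟨⟨false, (), x, rfl⟩, e⟩
  injL := by rintro (_ | _) (_ | _) e <;> cases e <;> rfl
  injE := by rintro (_ | _) _ (_ | _) _ e <;> cases e <;> rfl
  injM := by rintro (_ | _) _ (_ | _) _ e <;> cases e <;> rfl
  link_eq := by
    rintro (_ | l)
    · rfl
    · simp only [Link.map_map]
      refine Link.map_congr ?_ ?_
      · rintro (_ | _) _ <;> rfl
      · rintro (_ | _) _ <;> rfl
  box_iff := by
    rintro (_ | q) (_ | l) <;> simp
  root_eq := rfl
  cover := by
    rintro (⟨_ | _, h⟩ | ⟨⟨_ | _, m, k, h⟩, j⟩)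
    · exact absurd ⟨(), x, rfl⟩ h
    · exact .inl ⟨none, rfl⟩
    · cases h
      exact .inl ⟨some j, rfl⟩
    · cases h

/-- Substitution in the net of an application of a variable. -/
def substAppVarEmb (x : ℕ) :
    Emb ((τ x).tens (S.subst τ)) ((appVarNet x S).subst τ) where
  onL
    | .inl none => .inl ⟨.inl true, by rintro ⟨m, k, h⟩; cases h⟩
    | .inl (some l) => .inr ⟨⟨.inl false, .inl (), x, rfl⟩, l⟩
    | .inr (.inl l) => .inl ⟨.inr l.1, not_isFreeDer_sumMap rfl l.2⟩
    | .inr (.inr ⟨d, l⟩) => .inr ⟨⟨.inr d.l, .inr d.m, d.k, by simp only [d.eq]; rfl⟩, l⟩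
  onE
    | .inl none => .inl (.inl ())
    | .inl (some e) => .inr ⟨⟨.inl false, .inl (), x, rfl⟩, e⟩
    | .inr (.inl e) => .inl (.inr e)
    | .inr (.inr ⟨d, e⟩) => .inr ⟨⟨.inr d.l, .inr d.m, d.k, by simp only [d.eq]; rfl⟩, e⟩
  onM
    | .inl none => .inl (.inl ())
    | .inl (some e) => .inr ⟨⟨.inl false, .inl (), x, rfl⟩, e⟩
    | .inr (.inl e) => .inl (.inr e)
    | .inr (.inr ⟨d, e⟩) => .inr ⟨⟨.inr d.l, .inr d.m, d.k, by simp only [d.eq]; rfl⟩, e⟩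
  injL := by
    rintro ((_ | _) | ⟨_, _⟩ | ⟨⟨_, _, _, _⟩, _⟩) ((_ | _) | ⟨_, _⟩ | ⟨⟨_, _, _, _⟩, _⟩) e <;>
      cases e <;> rfl
  injE := by
    rintro ((_ | _) | _ | ⟨⟨_, _, _, _⟩, _⟩) _ ((_ | _) | _ | ⟨⟨_, _, _, _⟩, _⟩) _ e <;>
      cases e <;> rfl
  injM := by
    rintro ((_ | _) | _ | ⟨⟨_, _, _, _⟩, _⟩) _ ((_ | _) | _ | ⟨⟨_, _, _, _⟩, _⟩) _ e <;>
      cases e <;> rfl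
  link_eq := by
    rintro ((_ | l) | l | ⟨d, l⟩)
    · rfl
    · simp only [Link.map_map]
      refine Link.map_congr ?_ ?_
      · rintro (_ | _) _ <;> rfl
      · rintro (_ | _) _ <;> rfl
    · simp only [Link.map_map]
      refine Link.map_congr ?_ ?_
      · rintro (_ | _) _ <;> rfl
      · rintro _ _; rfl
    · simp only [Link.map_map]
      refine Link.map_congr ?_ ?_
      · rintro (_ | _) _ <;> rfl
      · rintro (_ | _) _ <;> rfl
  box_iff := by
    rintro ((_ | q) | q | ⟨⟨_, _, _, _⟩, q⟩) ((_ | l) | l | ⟨⟨_, _, _, _⟩, l⟩) <;> simp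
  root_eq := rfl
  cover := by
    rintro (⟨(_ | _) | l, h⟩ | ⟨⟨(_ | _) | l, m, k, h⟩, j⟩)
    · exact absurd ⟨_, x, rfl⟩ h
    · exact .inl ⟨.inl none, rfl⟩
    · exact .inl ⟨.inr (.inl ⟨l, fun ⟨m, k, hl⟩ => h (isFreeDer_of_map rfl hl rfl)⟩), rfl⟩
    · cases h
      exact .inl ⟨.inl (some j), rfl⟩
    · cases h
    · obtain ⟨a, ha, rfl⟩ := map_sumMap_eq_der.1 h
      exact .inl ⟨.inr (.inr ⟨⟨l, a, k, ha⟩, j⟩), rfl⟩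

end Net

namespace Net

variable (G S : Net) (τ : ℕ → Content)

/-- Only `par`-links have a box. -/
def BoxPar : Prop := ∀ q k, k ∈ G.box q → (G.link q).IsPar

variable {G} in
theorem BoxPar.notMem (h : G.BoxPar) {q m n} (hq : G.link q = .der m n) (k) : k ∉ G.box q := by
  intro hk
  have := h _ _ hk
  rw [hq] at this
  exact this

/-- Substitution in the net of an abstraction.  The derelictions on the bound variable are among the
links of `G` on free variables, where `Content.up` replaces them by themselves, but not among those
of the net of the abstraction, where they are kept. -/
def substLamEmb (hG : G.BoxPar) : Emb (lamNet (G.subst (.up τ))) ((lamNet G).subst τ) where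
  onL
    | .inl true => .inl ⟨.inl true, by rintro ⟨m, k, h⟩; cases h⟩
    | .inl false => .inl ⟨.inl false, by rintro ⟨m, k, h⟩; cases h⟩
    | .inr (.inl l) => .inl ⟨.inr l.1, not_isFreeDer_bind rfl fun _ _ h => l.2 ⟨_, _, h⟩⟩
    | .inr (.inr ⟨⟨l, m, 0, h⟩, _⟩) =>
        .inl ⟨.inr l, not_isFreeDer_bind rfl fun _ _ h' => by rw [h] at h'; cases h'⟩
    | .inr (.inr ⟨⟨l, m, k + 1, h⟩, j⟩) => .inr ⟨⟨.inr l, .inr m, k, by simp only [h]; rfl⟩, j⟩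
  onE
    | .inl b => .inl (.inl b)
    | .inr (.inl e) => .inl (.inr e)
    | .inr (.inr ⟨⟨_, _, 0, _⟩, e⟩) => e.elim
    | .inr (.inr ⟨⟨l, m, k + 1, h⟩, e⟩) => .inr ⟨⟨.inr l, .inr m, k, by simp only [h]; rfl⟩, e⟩
  onM
    | .inl b => .inl (.inl b)
    | .inr (.inl e) => .inl (.inr e)
    | .inr (.inr ⟨⟨_, _, 0, _⟩, e⟩) => e.elim
    | .inr (.inr ⟨⟨l, m, k + 1, h⟩, e⟩) => .inr ⟨⟨.inr l, .inr m, k, by simp only [h]; rfl⟩, e⟩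
  injL := by
    rintro ((_ | _) | ⟨_, h⟩ | ⟨⟨_, _, _ | _, h⟩, _⟩) ((_ | _) | ⟨_, h'⟩ | ⟨⟨_, _, _ | _, h'⟩,
      _⟩) e <;>
      cases e
    · rfl
    · rfl
    · rfl
    · exact absurd ⟨_, _, h'⟩ h
    · exact absurd ⟨_, _, h⟩ h'
    · rw [h] at h'
      cases h'
      rfl
    · rfl
  injE := by
    rintro (_ | _ | ⟨⟨_, _, _ | _, _⟩, _⟩) _ (_ | _ | ⟨⟨_, _, _ | _, _⟩, _⟩) _ e <;>
      first
      | exact Empty.elim ‹_›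
      | (cases e <;> rfl)
  injM := by
    rintro (_ | _ | ⟨⟨_, _, _ | _, _⟩, _⟩) _ (_ | _ | ⟨⟨_, _, _ | _, _⟩, _⟩) _ e <;>
      first
      | exact Empty.elim ‹_›
      | (cases e <;> rfl)
  link_eq := by
    rintro ((_ | _) | l | ⟨⟨l, m, _ | k, h⟩, j⟩)
    · rfl
    · rfl
    · simp only [Link.map_map]
      refine Link.map_congr ?_ ?_
      · rintro ((_ | _) | _) _ <;> rfl
      · rintro _ _; rfl
    · simp only [h]
      rfl
    · simp only [Link.map_map]
      refine Link.map_congr ?_ ?_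
      · rintro (_ | _) _ <;> rfl
      · rintro (_ | _) _ <;> rfl
  box_iff := by
    rintro ((_ | _) | ⟨q, hq⟩ | ⟨⟨q, _, _ | _, hq⟩, _⟩) ((_ | _) | ⟨l, hl⟩ | ⟨⟨l, _, _ | _, hl⟩,
      _⟩) <;> simp
    all_goals exact hG.notMem hq _
  root_eq := rfl
  cover := by
    rintro (⟨(_ | _) | l, h⟩ | ⟨⟨(_ | _) | l, m, k, h⟩, j⟩)
    · exact .inl ⟨.inl false, rfl⟩
    · exact .inl ⟨.inl true, rfl⟩
    · by_cases hl : G.IsFreeDer l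
      · obtain ⟨m, _ | k, hl⟩ := hl
        · exact .inl ⟨.inr (.inr ⟨⟨l, m, 0, hl⟩, ()⟩), rfl⟩
        · exact absurd (isFreeDer_of_map rfl hl rfl) h
      · exact .inl ⟨.inr (.inl ⟨l, hl⟩), rfl⟩
    · cases h
    · cases h
    · obtain ⟨a, ha, rfl⟩ := map_bind_eq_der.1 h
      exact .inl ⟨.inr (.inr ⟨⟨l, a, k + 1, ha⟩, j⟩), rfl⟩

/-- Substitution in the net of an application of an abstraction. -/
def substAppLamEmb (hG : G.BoxPar) :
    Emb (appLamNet (G.subst (.up τ)) (S.subst τ)) ((appLamNet G S).subst τ) where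
  onL
    | .inl true => .inl ⟨.inl true, by rintro ⟨m, k, h⟩; cases h⟩
    | .inl false => .inl ⟨.inl false, by rintro ⟨m, k, h⟩; cases h⟩
    | .inr (.inl (.inl l)) =>
        .inl ⟨.inr (.inl l.1), not_isFreeDer_bind rfl fun _ _ h => l.2 ⟨_, _, h⟩⟩
    | .inr (.inl (.inr ⟨⟨l, m, 0, h⟩, _⟩)) =>
        .inl ⟨.inr (.inl l), not_isFreeDer_bind rfl fun _ _ h' => by rw [h] at h'; cases h'⟩
    | .inr (.inl (.inr ⟨⟨l, m, k + 1, h⟩, j⟩)) =>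
        .inr ⟨⟨.inr (.inl l), .inr (.inl m), k, by simp only [h]; rfl⟩, j⟩
    | .inr (.inr (.inl l)) => .inl ⟨.inr (.inr l.1), not_isFreeDer_sumMap rfl l.2⟩
    | .inr (.inr (.inr ⟨d, l⟩)) =>
        .inr ⟨⟨.inr (.inr d.l), .inr (.inr d.m), d.k, by simp only [d.eq]; rfl⟩, l⟩
  onE
    | .inl b => .inl (.inl b)
    | .inr (.inl (.inl e)) => .inl (.inr (.inl e))
    | .inr (.inl (.inr ⟨⟨_, _, 0, _⟩, e⟩)) => e.elim
    | .inr (.inl (.inr ⟨⟨l, m, k + 1, h⟩, e⟩)) =>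
        .inr ⟨⟨.inr (.inl l), .inr (.inl m), k, by simp only [h]; rfl⟩, e⟩
    | .inr (.inr (.inl e)) => .inl (.inr (.inr e))
    | .inr (.inr (.inr ⟨d, e⟩)) =>
        .inr ⟨⟨.inr (.inr d.l), .inr (.inr d.m), d.k, by simp only [d.eq]; rfl⟩, e⟩
  onM
    | .inl b => .inl (.inl b)
    | .inr (.inl (.inl e)) => .inl (.inr (.inl e))
    | .inr (.inl (.inr ⟨⟨_, _, 0, _⟩, e⟩)) => e.elim
    | .inr (.inl (.inr ⟨⟨l, m, k + 1, h⟩, e⟩)) =>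
        .inr ⟨⟨.inr (.inl l), .inr (.inl m), k, by simp only [h]; rfl⟩, e⟩
    | .inr (.inr (.inl e)) => .inl (.inr (.inr e))
    | .inr (.inr (.inr ⟨d, e⟩)) =>
        .inr ⟨⟨.inr (.inr d.l), .inr (.inr d.m), d.k, by simp only [d.eq]; rfl⟩, e⟩
  injL := by
    rintro ((_ | _) | (⟨_, h⟩ | ⟨⟨_, _, _ | _, h⟩, _⟩) | ⟨_, _⟩ | ⟨⟨_, _, _, _⟩, _⟩)
      ((_ | _) | (⟨_, h'⟩ | ⟨⟨_, _, _ | _, h'⟩, _⟩) | ⟨_, _⟩ | ⟨⟨_, _, _, _⟩, _⟩) e <;>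
      cases e
    · rfl
    · rfl
    · rfl
    · exact absurd ⟨_, _, h'⟩ h
    · exact absurd ⟨_, _, h⟩ h'
    · rw [h] at h'
      cases h'
      rfl
    · rfl
    · rfl
    · rfl
  injE := by
    rintro (_ | (_ | ⟨⟨_, _, _ | _, _⟩, _⟩) | _ | ⟨⟨_, _, _, _⟩, _⟩) _
      (_ | (_ | ⟨⟨_, _, _ | _, _⟩, _⟩) | _ | ⟨⟨_, _, _, _⟩, _⟩) _ e <;>
      first
      | exact Empty.elim ‹_›
      | (cases e <;> rfl)
  injM := by
    rintro (_ | (_ | ⟨⟨_, _, _ | _, _⟩, _⟩) | _ | ⟨⟨_, _, _, _⟩, _⟩) _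
      (_ | (_ | ⟨⟨_, _, _ | _, _⟩, _⟩) | _ | ⟨⟨_, _, _, _⟩, _⟩) _ e <;>
      first
      | exact Empty.elim ‹_›
      | (cases e <;> rfl)
  link_eq := by
    rintro ((_ | _) | (l | ⟨⟨l, m, _ | k, h⟩, j⟩) | l | ⟨d, l⟩)
    · rfl
    · rfl
    · simp only [Link.map_map]
      refine Link.map_congr ?_ ?_
      · rintro ((_ | _) | _) _ <;> rfl
      · rintro _ _; rfl
    · simp only [h]
      rfl
    · simp only [Link.map_map]
      refine Link.map_congr ?_ ?_
      · rintro (_ | _) _ <;> rfl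
      · rintro (_ | _) _ <;> rfl
    · simp only [Link.map_map]
      refine Link.map_congr ?_ ?_
      · rintro (_ | _) _ <;> rfl
      · rintro _ _; rfl
    · simp only [Link.map_map]
      refine Link.map_congr ?_ ?_
      · rintro (_ | _) _ <;> rfl
      · rintro (_ | _) _ <;> rfl
  box_iff := by
    rintro ((_ | _) | (⟨q, hq⟩ | ⟨⟨q, _, _ | _, hq⟩, _⟩) | ⟨q, hq⟩ | ⟨⟨_, _, _, _⟩, q⟩)
      ((_ | _) | (⟨l, hl⟩ | ⟨⟨l, _, _ | _, hl⟩, _⟩) | ⟨l, hl⟩ | ⟨⟨_, _, _, _⟩, l⟩) <;> simp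
    all_goals exact hG.notMem hq _
  root_eq := rfl
  cover := by
    rintro (⟨(_ | _) | l | l, h⟩ | ⟨⟨(_ | _) | l | l, m, k, h⟩, j⟩)
    · exact .inl ⟨.inl false, rfl⟩
    · exact .inl ⟨.inl true, rfl⟩
    · by_cases hl : G.IsFreeDer l
      · obtain ⟨m, _ | k, hl⟩ := hl
        · exact .inl ⟨.inr (.inl (.inr ⟨⟨l, m, 0, hl⟩, ()⟩)), rfl⟩
        · exact absurd (isFreeDer_of_map rfl hl rfl) h
      · exact .inl ⟨.inr (.inl (.inl ⟨l, hl⟩)), rfl⟩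
    · exact .inl ⟨.inr (.inr (.inl ⟨l, fun ⟨m, k, hl⟩ => h (isFreeDer_of_map rfl hl rfl)⟩)), rfl⟩
    · cases h
    · cases h
    · obtain ⟨a, ha, rfl⟩ := map_bind_eq_der.1 h
      exact .inl ⟨.inr (.inl (.inr ⟨⟨l, a, k + 1, ha⟩, j⟩)), rfl⟩
    · obtain ⟨a, ha, rfl⟩ := map_sumMap_eq_der.1 h
      exact .inl ⟨.inr (.inr (.inr ⟨⟨l, a, k, ha⟩, j⟩)), rfl⟩

/-- Substitution in the net of an explicit substitution. -/
def substSubEmb (hG : G.BoxPar) :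
    Emb (subNet (G.subst (.up τ)) (S.subst τ)) ((subNet G S).subst τ) where
  onL
    | .inl (.inl l) =>
        .inl ⟨.inl l.1, not_isFreeDer_bind rfl fun _ _ h => l.2 ⟨_, _, h⟩⟩
    | .inl (.inr ⟨⟨l, m, 0, h⟩, _⟩) =>
        .inl ⟨.inl l, not_isFreeDer_bind rfl fun _ _ h' => by rw [h] at h'; cases h'⟩
    | .inl (.inr ⟨⟨l, m, k + 1, h⟩, j⟩) =>
        .inr ⟨⟨.inl l, .inl m, k, by simp only [h]; rfl⟩, j⟩
    | .inr (.inl l) => .inl ⟨.inr l.1, not_isFreeDer_sumMap rfl l.2⟩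
    | .inr (.inr ⟨d, l⟩) =>
        .inr ⟨⟨.inr d.l, .inr d.m, d.k, by simp only [d.eq]; rfl⟩, l⟩
  onE
    | .inl (.inl e) => .inl (.inl e)
    | .inl (.inr ⟨⟨_, _, 0, _⟩, e⟩) => e.elim
    | .inl (.inr ⟨⟨l, m, k + 1, h⟩, e⟩) =>
        .inr ⟨⟨.inl l, .inl m, k, by simp only [h]; rfl⟩, e⟩
    | .inr (.inl e) => .inl (.inr e)
    | .inr (.inr ⟨d, e⟩) =>
        .inr ⟨⟨.inr d.l, .inr d.m, d.k, by simp only [d.eq]; rfl⟩, e⟩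
  onM
    | .inl (.inl e) => .inl (.inl e)
    | .inl (.inr ⟨⟨_, _, 0, _⟩, e⟩) => e.elim
    | .inl (.inr ⟨⟨l, m, k + 1, h⟩, e⟩) =>
        .inr ⟨⟨.inl l, .inl m, k, by simp only [h]; rfl⟩, e⟩
    | .inr (.inl e) => .inl (.inr e)
    | .inr (.inr ⟨d, e⟩) =>
        .inr ⟨⟨.inr d.l, .inr d.m, d.k, by simp only [d.eq]; rfl⟩, e⟩
  injL := by
    rintro ((⟨_, h⟩ | ⟨⟨_, _, _ | _, h⟩, _⟩) | ⟨_, _⟩ | ⟨⟨_, _, _, _⟩, _⟩)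
      ((⟨_, h'⟩ | ⟨⟨_, _, _ | _, h'⟩, _⟩) | ⟨_, _⟩ | ⟨⟨_, _, _, _⟩, _⟩) e <;>
      cases e
    · rfl
    · exact absurd ⟨_, _, h'⟩ h
    · exact absurd ⟨_, _, h⟩ h'
    · rw [h] at h'
      cases h'
      rfl
    · rfl
    · rfl
    · rfl
  injE := by
    rintro ((_ | ⟨⟨_, _, _ | _, _⟩, _⟩) | _ | ⟨⟨_, _, _, _⟩, _⟩) _
      ((_ | ⟨⟨_, _, _ | _, _⟩, _⟩) | _ | ⟨⟨_, _, _, _⟩, _⟩) _ e <;>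
      first
      | exact Empty.elim ‹_›
      | (cases e <;> rfl)
  injM := by
    rintro ((_ | ⟨⟨_, _, _ | _, _⟩, _⟩) | _ | ⟨⟨_, _, _, _⟩, _⟩) _
      ((_ | ⟨⟨_, _, _ | _, _⟩, _⟩) | _ | ⟨⟨_, _, _, _⟩, _⟩) _ e <;>
      first
      | exact Empty.elim ‹_›
      | (cases e <;> rfl)
  link_eq := by
    rintro ((l | ⟨⟨l, m, _ | k, h⟩, j⟩) | l | ⟨d, l⟩)
    · simp only [Link.map_map]
      refine Link.map_congr ?_ ?_
      · rintro ((_ | _) | _) _ <;> rfl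
      · rintro _ _; rfl
    · simp only [h]
      rfl
    · simp only [Link.map_map]
      refine Link.map_congr ?_ ?_
      · rintro (_ | _) _ <;> rfl
      · rintro (_ | _) _ <;> rfl
    · simp only [Link.map_map]
      refine Link.map_congr ?_ ?_
      · rintro (_ | _) _ <;> rfl
      · rintro _ _; rfl
    · simp only [Link.map_map]
      refine Link.map_congr ?_ ?_
      · rintro (_ | _) _ <;> rfl
      · rintro (_ | _) _ <;> rfl
  box_iff := by
    rintro ((⟨q, hq⟩ | ⟨⟨q, _, _ | _, hq⟩, _⟩) | ⟨q, hq⟩ | ⟨⟨_, _, _, _⟩, q⟩)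
      ((⟨l, hl⟩ | ⟨⟨l, _, _ | _, hl⟩, _⟩) | ⟨l, hl⟩ | ⟨⟨_, _, _, _⟩, l⟩) <;> simp
    all_goals exact hG.notMem hq _
  root_eq := rfl
  cover := by
    rintro (⟨l | l, h⟩ | ⟨⟨l | l, m, k, h⟩, j⟩)
    · by_cases hl : G.IsFreeDer l
      · obtain ⟨m, _ | k, hl⟩ := hl
        · exact .inl ⟨.inl (.inr ⟨⟨l, m, 0, hl⟩, ()⟩), rfl⟩
        · exact absurd (isFreeDer_of_map rfl hl rfl) h
      · exact .inl ⟨.inl (.inl ⟨l, hl⟩), rfl⟩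
    · exact .inl ⟨.inr (.inl ⟨l, fun ⟨m, k, hl⟩ => h (isFreeDer_of_map rfl hl rfl)⟩), rfl⟩
    · obtain ⟨a, ha, rfl⟩ := map_bind_eq_der.1 h
      exact .inl ⟨.inl (.inr ⟨⟨l, a, k + 1, ha⟩, j⟩), rfl⟩
    · obtain ⟨a, ha, rfl⟩ := map_sumMap_eq_der.1 h
      exact .inl ⟨.inr (.inr ⟨⟨l, a, k, ha⟩, j⟩), rfl⟩

end Net

/-! ### Renaming and substitution of terms -/

theorem upRen_comp (f g : ℕ → ℕ) : upRen g ∘ upRen f = upRen (g ∘ f) := by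
  funext k; cases k <;> rfl

theorem upRen_id : upRen id = id := by
  funext k; cases k <;> rfl

namespace Term

theorem rename_rename (t : Term) (f g : ℕ → ℕ) : (t.rename f).rename g = t.rename (g ∘ f) := by
  induction t generalizing f g <;> simp_all [rename, upRen_comp]

theorem rename_id (t : Term) : t.rename id = t := by
  induction t <;> simp_all [rename, upRen_id]

end Term

namespace Net

/-- Renaming of the free variables. -/
@[reducible] def ren (f : ℕ → ℕ) (G : Net) : Net where
  E := G.E
  M := G.M
  L := G.L
  link l := (G.link l).map (Sum.map f id) id
  box := G.box
  root := G.root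

theorem lamNet_ren (f : ℕ → ℕ) (G : Net) : lamNet (G.ren (upRen f)) = (lamNet G).ren f := by
  unfold lamNet ren
  congr 1
  · funext l
    rcases l with (_ | _) | l
    · rfl
    · rfl
    · simp only [Link.map_map]
      refine Link.map_congr ?_ fun _ _ => rfl
      rintro ((_ | _) | _) _ <;> rfl
  · funext l; rcases l with (_ | _) | l <;> rfl

theorem appVarNet_ren (f : ℕ → ℕ) (x : ℕ) (S : Net) :
    appVarNet (f x) (S.ren f) = (appVarNet x S).ren f := by
  unfold appVarNet ren
  congr 1
  · funext l
    rcases l with (_ | _) | l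
    · rfl
    · rfl
    · simp only [Link.map_map]
      refine Link.map_congr ?_ fun _ _ => rfl
      rintro (_ | _) _ <;> rfl
  · funext l; rcases l with _ | l <;> rfl

theorem appLamNet_ren (f : ℕ → ℕ) (G S : Net) :
    appLamNet (G.ren (upRen f)) (S.ren f) = (appLamNet G S).ren f := by
  unfold appLamNet ren
  congr 1
  · funext l
    rcases l with (_ | _) | l | l
    · rfl
    · rfl
    · simp only [Link.map_map]
      refine Link.map_congr ?_ fun _ _ => rfl
      rintro ((_ | _) | _) _ <;> rfl
    · simp only [Link.map_map]
      refine Link.map_congr ?_ fun _ _ => rfl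
      rintro (_ | _) _ <;> rfl
  · funext l; rcases l with (_ | _) | l | l <;> rfl

theorem subNet_ren (f : ℕ → ℕ) (G S : Net) :
    subNet (G.ren (upRen f)) (S.ren f) = (subNet G S).ren f := by
  unfold subNet ren
  congr 1
  · funext l
    rcases l with l | l
    · simp only [Link.map_map]
      refine Link.map_congr ?_ fun _ _ => rfl
      rintro ((_ | _) | _) _ <;> rfl
    · simp only [Link.map_map]
      refine Link.map_congr ?_ fun _ _ => rfl
      rintro (_ | _) _ <;> rfl
  · funext l; rcases l with l | l <;> rfl

end Net

open Net

theorem Term.skel_rename (t : Term) (f : ℕ → ℕ) : (t.rename f).skel = t.skel.ren f := by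
  induction t generalizing f with
  | var x =>
    simp only [rename, skel]
    unfold varNet ren
    congr 1
    funext l
    cases l <;> rfl
  | lam t ih => simp only [rename, skel, ih, lamNet_ren]
  | appVar x s ih => simp only [rename, skel, ih, appVarNet_ren]
  | appLam t s iht ihs => simp only [rename, skel, iht, ihs, appLamNet_ren]
  | sub t u iht ihu => simp only [rename, skel, iht, ihu, subNet_ren]

/-- The content of the `bang` of the net of a value. -/
def Value.content : Value → Content
  | .var x => .var x
  | .lam t => .lam t.skel

namespace Value

theorem content_rename (v : Value) (f : ℕ → ℕ) : (v.rename f).content = v.content.ren f := by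
  cases v with
  | var x => rfl
  | lam t =>
    simp only [rename, content, Term.skel_rename]
    unfold Content.lam Content.ren
    congr 1
    · funext l
      rcases l with _ | l
      · rfl
      · simp only [Link.map_map]
        refine Link.map_congr ?_ fun _ _ => rfl
        rintro ((_ | _) | _) _ <;> rfl
    · funext l; rcases l with _ | l <;> rfl

theorem content_upSubst (σ : ℕ → Value) :
    (fun k => (upSubst σ k).content) = Content.up fun k => (σ k).content := by
  funext k
  cases k with
  | zero => rfl
  | succ k => exact content_rename _ _

theorem content_instSubst (v : Value) :
    (fun k => (instSubst v k).content) = Content.inst v.content := by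
  funext k
  cases k <;> rfl

/-- The net of a value is a `bang` on its content. -/
def bangIso : (v : Value) → StrictIso v.toTerm.skel v.content.bang
  | .var x => varBangIso x
  | .lam t => lamBangIso t.skel

/-- The net of an application is a `tens` on the content of the function. -/
def appEmb {s : Term} {S : Net} (f : Emb s.skel S) :
    (v : Value) → Emb (v.app s).skel (v.content.tens S)
  | .var x => (appVarEmb x f s.skel_root_mem).trans (varTensIso x S).emb
  | .lam t => (appLamEmb (.refl _) t.skel_root_mem f s.skel_root_mem).trans
    (lamTensIso t.skel S).emb

end Value

namespace Term

theorem skel_boxPar (t : Term) : t.skel.BoxPar := by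
  intro q k hk
  have := t.wf_net.isPar_of_mem ((t.skelEmb.box_iff q k).2 hk)
  rwa [t.skelEmb.link_onL, Link.isPar_map] at this

/-- The net of a substituted term is obtained by substituting contents in its net. -/
theorem skel_subst (t : Term) (σ : ℕ → Value) :
    Nonempty (Emb (t.subst σ).skel (t.skel.subst fun k => (σ k).content)) := by
  induction t generalizing σ with
  | var x => exact ⟨(σ x).bangIso.emb.trans (substVarEmb (fun k => (σ k).content) x)⟩
  | lam t ih =>
    obtain ⟨f⟩ := ih (upSubst σ)
    rw [Value.content_upSubst] at f
    exact ⟨(lamEmb f (skel_root_mem _)).trans (substLamEmb _ _ t.skel_boxPar)⟩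
  | appVar x s ih =>
    obtain ⟨f⟩ := ih σ
    exact ⟨(Value.appEmb f (σ x)).trans (substAppVarEmb s.skel (fun k => (σ k).content) x)⟩
  | appLam t s iht ihs =>
    obtain ⟨f⟩ := iht (upSubst σ)
    obtain ⟨g⟩ := ihs σ
    rw [Value.content_upSubst] at f
    exact ⟨(appLamEmb f (skel_root_mem _) g (skel_root_mem _)).trans
      (substAppLamEmb _ _ _ t.skel_boxPar)⟩
  | sub t u iht ihu =>
    obtain ⟨f⟩ := iht (upSubst σ)
    obtain ⟨g⟩ := ihu σ
    rw [Value.content_upSubst] at f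
    exact ⟨(subEmb f (skel_root_mem _) g (skel_root_mem _)).trans
      (substSubEmb _ _ _ t.skel_boxPar)⟩

end Term

/-! ### Simulation of exponential steps -/

/-- The conditions that distinguish contents among hypergraphs with a missing source. -/
structure Content.IsContent (c : Content) : Prop where
  top_src : (c.link c.top).MSource none
  eq_or_mem : ∀ l, l = c.top ∨ l ∈ c.box c.top
  target_src : ∀ l p, (c.link l).ETarget (.inr p) → ∃ k, (c.link k).ESource (.inr p)

theorem Value.isContent (v : Value) : v.content.IsContent := by
  cases v with
  | var y => constructor <;> simp [content]
  | lam t =>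
    refine ⟨rfl, ?_, ?_⟩
    · rintro (_ | l)
      · exact .inl rfl
      · exact .inr ⟨l, rfl⟩
    · have key : ∀ p, (∃ k, (t.skel.link k).ESource (.inr p)) →
          ∃ k, ((Content.lam t.skel).link k).ESource (.inr (some p)) := by
        rintro p ⟨k, hk⟩
        exact ⟨some k, Link.eSource_map.2 ⟨_, hk, rfl⟩⟩
      rintro (_ | l) p h
      · cases h
        exact key _ t.skel_root_src
      · obtain ⟨(_ | n) | p', hn, e⟩ := Link.eTarget_map.1 h
        · cases e
          exact ⟨none, rfl⟩
        · cases e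
        · cases e
          exact key _ (t.skel_target_src hn)

namespace Net

/-- The cut at the root of the `bang` on `c`, in the net of an explicit substitution. -/
@[reducible] def rootBang (G : Net) {c : Content} (hc : c.IsContent) :
    (subNet G c.bang).BangCut where
  node := .inr none
  bang := .inr none
  m := .inr none
  below := .inr (some c.top)
  bang_eq := rfl
  below_src := by
    obtain h := hc.top_src
    simp only [Link.mSource_map]
    exact ⟨_, ⟨_, h, rfl⟩, rfl⟩

section

variable (G : Net) {c : Content} (hc : c.IsContent)

theorem mem_rootBang_H {l} : l ∈ (rootBang G hc).H ↔ ∃ j, l = .inr (some j) := by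
  constructor
  · rintro (rfl | ⟨_, ⟨j, _, rfl⟩, rfl⟩)
    · exact ⟨_, rfl⟩
    · exact ⟨_, rfl⟩
  · rintro ⟨j, rfl⟩
    rcases hc.eq_or_mem j with rfl | hj
    · exact .inl rfl
    · exact .inr ⟨_, ⟨j, hj, rfl⟩, rfl⟩

theorem target_rootBang {l : G.L} :
    ((subNet G c.bang).link (.inl l)).ETarget (.inr (.inr none)) ↔
      (G.link l).ETarget (.inl 0) := by
  rw [Link.eTarget_map]
  constructor
  · rintro ⟨(_ | k) | p, h, e⟩
    · exact h
    · cases e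
    · cases e
  · exact fun h => ⟨_, h, rfl⟩

theorem kept_rootBang {l : G.L} :
    (rootBang G hc).Kept (.inl l) ↔ ¬ (G.link l).ETarget (.inl 0) := by
  unfold BangCut.Kept
  rw [target_rootBang, mem_rootBang_H]
  simp

theorem inner_rootBang {l : c.L} {p : c.E}
    (h : (c.link l).ESource (.inr p) ∨ (c.link l).ETarget (.inr p)) :
    (rootBang G hc).InnerE (.inr (.inr (some p))) := by
  obtain ⟨k, hk⟩ : ∃ k, (c.link k).ESource (.inr p) := h.elim (fun h => ⟨_, h⟩) (hc.target_src _ _)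
  refine ⟨.inr (some k), (mem_rootBang_H G hc).2 ⟨k, rfl⟩, ?_⟩
  simp only [Link.eSource_map]
  exact ⟨_, ⟨_, hk, rfl⟩, rfl⟩

variable {G}

theorem not_target_of_not_isFreeDer (hd : ∀ l x, (G.link l).ETarget (.inl x) → (G.link l).IsDer)
    {l} (hl : ¬ G.IsFreeDer l) (x) : ¬ (G.link l).ETarget (.inl x) := by
  intro h
  have := hd l x h
  cases e : G.link l <;> rw [e] at this h
  case der m n => cases h; exact hl ⟨m, x, e⟩
  all_goals exact this

/-- The `e`-step at the root substitutes the content for the free variable `0`. -/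
noncomputable def rootBangEmb (hG : G.BoxPar) (hf : ∀ l x, ¬ (G.link l).ESource (.inl x))
    (hd : ∀ l x, (G.link l).ETarget (.inl x) → (G.link l).IsDer) :
    Emb (G.subst (.inst c)) ((rootBang G hc).contract ∅) where
  onL
    | .inl l => .inl ⟨.inl l.1, (kept_rootBang G hc).2 (not_target_of_not_isFreeDer hd l.2 0)⟩
    | .inr ⟨⟨l, m, 0, h⟩, j⟩ =>
        .inr (.inl (⟨(.inl l, .inl m), by simp only [h]; rfl⟩,
          ⟨.inr (some j), (mem_rootBang_H G hc).2 ⟨j, rfl⟩⟩))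
    | .inr ⟨⟨l, m, k + 1, h⟩, _⟩ => .inl ⟨.inl l, (kept_rootBang G hc).2 (by rw [h]; simp)⟩
  onE
    | .inl p => (.inl p, none)
    | .inr ⟨⟨l, _, 0, _⟩, e⟩ => (.inr (some e), some (.inl l))
    | .inr ⟨⟨_, _, _ + 1, _⟩, e⟩ => e.elim
  onM
    | .inl p => (.inl p, none)
    | .inr ⟨⟨l, _, 0, _⟩, e⟩ => (.inr (some e), some (.inl l))
    | .inr ⟨⟨_, _, _ + 1, _⟩, e⟩ => e.elim
  injL := by
    rintro (⟨_, h⟩ | ⟨⟨_, _, _ | _, h⟩, _⟩) (⟨_, h'⟩ | ⟨⟨_, _, _ | _, h'⟩, _⟩) e <;> cases e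
    · rfl
    · exact absurd ⟨_, _, h'⟩ h
    · rfl
    · exact absurd ⟨_, _, h⟩ h'
    · rw [h] at h'
      cases h'
      rfl
  injE := by
    rintro (_ | ⟨⟨_, _, _ | _, h⟩, _⟩) _ (_ | ⟨⟨_, _, _ | _, h'⟩, _⟩) _ e <;>
      first
      | exact Empty.elim ‹_›
      | cases e
    · rfl
    · rw [h] at h'
      cases h'
      rfl
  injM := by
    rintro (_ | ⟨⟨_, _, _ | _, h⟩, _⟩) _ (_ | ⟨⟨_, _, _ | _, h'⟩, _⟩) _ e <;>
      first
      | exact Empty.elim ‹_›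
      | cases e
    · rfl
    · rw [h] at h'
      cases h'
      rfl
  link_eq := by
    rintro (⟨l, hl⟩ | ⟨⟨l, m, _ | k, h⟩, j⟩)
    · simp only [Link.map_map]
      refine Link.map_congr ?_ fun _ _ => rfl
      rintro (x | p) hn
      · exact absurd hn (not_or.2 ⟨hf l x, not_target_of_not_isFreeDer hd hl x⟩)
      · rfl
    · simp only [Link.map_map]
      refine Link.map_congr ?_ ?_
      · rintro (x | p) hn
        · rfl
        · simp only [Function.comp, Sum.map_inr]
          rw [BangCut.copyE_of_inner (inner_rootBang G hc hn)]
      · rintro (_ | a) _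
        · simp [BangCut.copyM]
        · simp [BangCut.copyM]
    · simp only [h]
      rfl
  box_iff := by
    rintro (⟨q, hq⟩ | ⟨⟨q, _, _ | _, hq⟩, _⟩) (⟨l, hl⟩ | ⟨⟨l, _, _ | _, hl⟩, _⟩) <;> simp
    all_goals try exact hG.notMem hq _
    constructor
    · rintro ⟨⟨⟨rfl, rfl⟩, _⟩, h⟩
      exact ⟨h, rfl, rfl⟩
    · rintro ⟨h, rfl, rfl⟩
      exact ⟨⟨⟨rfl, rfl⟩, (mem_rootBang_H G hc).2 ⟨_, rfl⟩⟩, h⟩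
  root_eq := rfl
  cover := by
    rintro (⟨l | _ | l, h⟩ | ⟨⟨⟨l | _ | l, m⟩, hd'⟩, ⟨j, hj⟩⟩ | ⟨_, ⟨⟩⟩)
    · rw [kept_rootBang] at h
      by_cases hl : G.IsFreeDer l
      · obtain ⟨m, _ | k, hl⟩ := hl
        · rw [hl] at h
          exact absurd rfl h
        · exact .inl ⟨.inr ⟨⟨l, m, k + 1, hl⟩, ()⟩, rfl⟩
      · exact .inl ⟨.inl ⟨l, hl⟩, rfl⟩
    · exact absurd rfl h.1
    · exact absurd ((mem_rootBang_H G hc).2 ⟨l, rfl⟩) h.2.2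
    · obtain ⟨j, rfl⟩ := (mem_rootBang_H G hc).1 hj
      obtain ⟨a, (_ | k) | p, ha, rfl, e⟩ := Link.map_eq_der.1 hd'
      · exact .inl ⟨.inr ⟨⟨l, a, 0, ha⟩, j⟩, rfl⟩
      · cases e
      · cases e
    · cases hd'
    · simp only [Link.map_map] at hd'
      obtain ⟨a, k | p, ha, rfl, e⟩ := Link.map_eq_der.1 hd'
      · cases e
      · cases e

end

/-- Explicit substitutions may be nested in either way, the variables being renamed accordingly. -/
def subAssocIso (G U S : Net) :
    StrictIso (subNet (subNet (G.ren (upRen Nat.succ)) U) S) (subNet G (subNet U S)) where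
  onL := Equiv.sumAssoc _ _ _
  onE := Equiv.sumAssoc _ _ _
  onM := Equiv.sumAssoc _ _ _
  link_eq := by
    rintro ((l | l) | l)
    · simp only [Link.map_map]
      refine Link.map_congr ?_ fun _ _ => rfl
      rintro ((_ | _) | _) _ <;> rfl
    · simp only [Equiv.sumAssoc_apply_inl_inr, Link.map_map]
      refine Link.map_congr ?_ fun _ _ => rfl
      rintro ((_ | _) | _) _ <;> rfl
    · simp only [Equiv.sumAssoc_apply_inr, Link.map_map]
      refine Link.map_congr ?_ fun _ _ => rfl
      rintro (_ | _) _ <;> rfl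
  box_iff := by
    rintro ((q | q) | q) ((l | l) | l) <;> simp
  root_eq := rfl

end Net

open Net

namespace Term

/-- The redex `t[x/v]` is simulated. -/
theorem exists_cut_sub_value (t : Term) (v : Value) :
    ∃ c : (t.sub v.toTerm).skel.Cut, c.Proper ∧ c.kind = .e ∧
      c.node = .inr (.inr v.toTerm.skel.root) ∧
      Nonempty (Emb (t.subst (instSubst v)).skel c.contract) := by
  have hr : v.content.bang.root ∈ v.content.bang.eNodes := ⟨none, .inl rfl⟩
  let f : Emb (subNet t.skel v.content.bang) (t.sub v.toTerm).skel :=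
    subEmb (.refl _) t.skel_root_mem v.bangIso.symm.emb hr
  have hr' : (subNet t.skel v.content.bang).root ∈ (subNet t.skel v.content.bang).eNodes := by
    obtain ⟨l, hl⟩ := t.skel_root_src
    exact ⟨.inl l, .inl (Link.eSource_map.2 ⟨_, hl, rfl⟩)⟩
  let c : (subNet t.skel v.content.bang).Cut := .e (rootBang t.skel v.isContent)
  have hc : c.Proper := by
    refine ⟨by simp, ?_⟩
    rintro (l | _ | l) hl
    · rw [target_rootBang] at hl
      have := t.skel_isDer_of_target_free hl
      rw [Link.eTargetPrincipal_map]
      revert this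
      cases t.skel.link l <;> simp
    · cases hl
    · simp only [Link.map_map] at hl
      obtain ⟨_ | _, _, e⟩ := Link.eTarget_map.1 hl <;> cases e
  refine ⟨c.map f, hc.map f hr', rfl, ?_, ?_⟩
  · rw [Cut.node_map]
    exact congrArg (fun x => Sum.inr (Sum.inr x)) v.bangIso.symm.root_eq
  · obtain ⟨g⟩ := t.skel_subst (instSubst v)
    rw [Value.content_instSubst] at g
    exact ⟨g.trans ((rootBangEmb v.isContent t.skel_boxPar (fun _ _ => t.skel_no_free)
      fun _ _ => t.skel_isDer_of_target_free).trans (c.contractEmb f))⟩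

/-- `t[x/U[y/S]]` and `t[x/U][y/S]` have the same net; this is why `e`-steps act at a distance. -/
theorem exists_assocEmb (t U S : Term) :
    ∃ f : Emb (((t.rename (upRen Nat.succ)).sub U).sub S).skel (t.sub (U.sub S)).skel,
      ∀ x, f.onE (.inl (.inr x)) = .inr (.inl x) := by
  simp only [skel]
  rw [skel_rename]
  exact ⟨(subAssocIso t.skel U.skel S.skel).emb, fun _ => rfl⟩

theorem subs_concat (t : Term) (L : List Term) (w : Term) :
    t.subs (L ++ [w]) = (t.subs L).sub w := by
  simp [subs]

/-- The redex `t[x/vL]` is simulated: by associativity, the substitutions in `L` may be taken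
out. -/
theorem exists_cut_sub_subs (t : Term) (v : Value) (L : List Term) :
    ∃ c : (t.sub (v.toTerm.subs L)).skel.Cut, c.Proper ∧ c.kind = .e ∧
      c.node = .inr (.inr (v.toTerm.subs L).skel.root) ∧
      Nonempty (Emb (((t.rename (upRen (· + L.length))).subst (instSubst v)).subs L).skel
        c.contract) := by
  induction L using List.reverseRecOn generalizing t with
  | nil =>
    have : t.rename (upRen (· + 0)) = t := by
      have : (fun x : ℕ => x + 0) = id := rfl
      rw [this, upRen_id, rename_id]
    simp only [List.length_nil, this]
    exact exists_cut_sub_value t v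
  | append_singleton L w ih =>
    obtain ⟨c, hc, hk, hn, he⟩ := ih (t.rename (upRen Nat.succ))
    have hren : (t.rename (upRen Nat.succ)).rename (upRen (· + L.length)) =
        t.rename (upRen (· + (L ++ [w]).length)) := by
      rw [rename_rename, upRen_comp]
      congr 2
      funext k
      simp [Nat.succ_eq_add_one]
      omega
    rw [hren] at he
    rw [subs_concat, subs_concat]
    set U := v.toTerm.subs L
    set T := ((t.rename (upRen (· + (L ++ [w]).length))).subst (instSubst v)).subs L
    obtain ⟨c', hc', hk', hn', ⟨e⟩⟩ := exists_cut_of_ctx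
      (T := ((t.rename (upRen Nat.succ)).sub U).sub w) (T' := T.sub w)
      (subLeftCtx w.skel) (subLeftIso _ _) (subLeftIso _ _) hc he
    obtain ⟨f, hf⟩ := exists_assocEmb t U w
    refine ⟨c'.map f, hc'.map f (skel_root_mem _), by rw [Cut.kind_map, hk', hk], ?_,
      ⟨e.trans (c'.contractEmb f)⟩⟩
    rw [Cut.node_map, hn', hn]
    exact congrArg Sum.inr (hf _)

/-- Every redex is simulated. -/
theorem Redex.simulated {t : Term} (R : t.Redex) : R.Simulated := by
  induction R with
  | mRoot t u => exact simulated_mRoot t u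
  | eRoot t u v L h =>
    subst h
    obtain ⟨c, hc, hk, hn, he⟩ := exists_cut_sub_subs t v L
    refine ⟨c, hc, hk, ?_, he⟩
    rw [hn]
    exact congrArg Sum.inr ((congrFun (skelEmb_sub _ _).1 _).trans
      (congrArg Sum.inr (skelEmb _).root_eq))
  | lam R ih => exact ih.lam
  | appVar x R ih => exact ih.appVar x
  | appLamLeft s R ih => exact ih.appLamLeft s
  | appLamRight t R ih => exact ih.appLamRight t
  | subLeft u R ih => exact ih.subLeft u
  | subRight t R ih => exact ih.subRight t

end Term

/-! ### Redexes of nets are determined by their nodes -/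

namespace Net

variable {G : Net} {X : Finset ℕ}

theorem MCut.ext_of_links {c c' : G.MCut} (ht : c.tens = c'.tens) (hp : c.par = c'.par) :
    c = c' := by
  obtain ⟨n, t, p, r, a, x, b, h₁, h₂⟩ := c
  obtain ⟨n', t', p', r', a', x', b', h₁', h₂'⟩ := c'
  simp only at ht hp
  subst ht hp
  rw [h₁] at h₁'
  rw [h₂] at h₂'
  cases h₁'
  cases h₂'
  rfl

theorem ECut.ext_of_links {c c' : G.ECut} (hb : c.bang = c'.bang) (hl : c.below = c'.below) :
    c = c' := by
  obtain ⟨n, b, m, l, h₁, _, _, _⟩ := c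
  obtain ⟨n', b', m', l', h₁', _, _, _⟩ := c'
  simp only at hb hl
  subst hb hl
  rw [h₁] at h₁'
  cases h₁'
  rfl

/-- In a well-formed net, a redex is determined by its node. -/
theorem WF.redex_ext (h : G.WF X) {S S' : G.Redex} (e : S.node = S'.node) : S = S' := by
  rcases S with c | c <;> rcases S' with c' | c' <;> simp only [Redex.node] at e
  · have e := Sum.inl.inj e
    refine congrArg _ (MCut.ext_of_links (h.mTarget_unique (a := c.node) ?_ ?_)
      (h.mSource_unique (a := c.node) ?_ ?_))
    · rw [c.tens_eq]; rfl
    · rw [c'.tens_eq]; exact e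
    · rw [c.par_eq]; rfl
    · rw [c'.par_eq]; exact e
  · cases e
  · cases e
  · have e := Sum.inr.inj e
    have hb : c.bang = c'.bang := h.eSource_unique (n := .inr c.node)
      (by rw [c.bang_eq]; rfl) (by rw [c'.bang_eq]; exact congrArg _ e)
    have hm : c.m = c'.m := by
      have := c.bang_eq
      rw [hb, c'.bang_eq] at this
      exact (Link.bang.inj this).2.symm
    exact congrArg _ (ECut.ext_of_links hb
      (h.mSource_unique c.below_src (hm ▸ c'.below_src)))

theorem WF.eCut_node_ne_root (h : G.WF X) (c : G.ECut) : c.node ≠ G.root :=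
  (h.target_inner.1 c.incoming).1

theorem WF.sat_contract (h : G.WF X) (S : G.Redex) : S.contract.Sat X := by
  rcases S with c | c
  · exact c.sat_contract h
  · change c.contract.Sat X
    rw [BangCut.contract_toBangCut]
    exact h.sat_contract_bang c.toBangCut c.principal (h.eCut_node_ne_root c)

/-- The image of a proper cut in a well-formed net is a redex of that net: an exponential cut node
has an incoming link, if only a weakening, as it is a source other than the root. -/
theorem WF.exists_redex (h : G.WF X) {G₀ : Net} (f : Emb G₀ G) (hr : G₀.root ∈ G₀.eNodes)
    {c : G₀.Cut} (hc : c.Proper) :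
    ∃ S : G.Redex, S.node = Sum.map f.onM f.onE c.node ∧ S.kind = c.kind ∧
      Nonempty (Emb c.contract S.contract) := by
  rcases c with c | c
  · exact ⟨.m (f.mapMCut c), rfl, rfl, ⟨f.contractM c⟩⟩
  · obtain ⟨hn, hp⟩ := hc.map f hr
    let c' : G.ECut :=
      { node := f.onE c.node
        bang := f.onL c.bang
        m := f.onM c.m
        below := f.onL c.below
        bang_eq := (f.mapBang c).bang_eq
        below_src := (f.mapBang c).below_src
        incoming := h.target_inner.2 ⟨hn, f.onL c.bang, by
          rw [f.link_onL, c.bang_eq]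
          rfl⟩
        principal := hp }
    refine ⟨.e c', rfl, rfl, ⟨?_⟩⟩
    change Emb _ c'.contract
    rw [BangCut.contract_toBangCut]
    exact f.contractBang c (by simp)

/-! ### Redexes along isomorphisms -/

namespace Emb

variable {G' : Net} (f : Emb G G') (hf : Function.Surjective f.onL)

/-- An isomorphism preserves the set of nodes that receive a weakening. -/
theorem mem_mapBang_W (hf : Function.Surjective f.onL) (c : G.BangCut) {n : ℕ ⊕ G.E}
    (hn : G.IsNode n) :
    f.onN n ∈ (f.mapBang c).W ↔ n ∈ c.W := by
  unfold BangCut.W BangCut.OuterE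
  simp only [Set.mem_ofPred_eq, hf.forall, hf.exists, f.mem_mapBang_H, f.kept_mapBang,
    f.innerE_mapBang c hn, f.eTarget_iff hn]
  refine and_congr_left fun _ => ⟨fun h => ⟨fun d => h.false (f.mapD c d)⟩, fun h => ⟨fun d => ?_⟩⟩
  obtain ⟨d, rfl⟩ := f.mapD_surjective c d
  exact h.false d

/-- The image of an exponential redex under an isomorphism. -/
def mapECut (c : G.ECut) : G'.ECut where
  node := f.onE c.node
  bang := f.onL c.bang
  m := f.onM c.m
  below := f.onL c.below
  bang_eq := (f.mapBang c.toBangCut).bang_eq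
  below_src := (f.mapBang c.toBangCut).below_src
  incoming := by
    obtain ⟨l, hl⟩ := c.incoming
    exact ⟨f.onL l, (f.eTarget_iff c.toBangCut.node_isNode l).2 hl⟩
  principal := by
    intro l hl
    obtain ⟨l, rfl⟩ := hf l
    rw [f.link_onL, Link.eTargetPrincipal_map]
    exact c.principal l ((f.eTarget_iff c.toBangCut.node_isNode l).1 hl)

/-- The image of a redex under an isomorphism. -/
def mapRedex : G.Redex → G'.Redex
  | .m c => .m (f.mapMCut c)
  | .e c => .e (f.mapECut hf c)

theorem kind_mapRedex (S : G.Redex) : (f.mapRedex hf S).kind = S.kind := by cases S <;> rfl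

theorem equal_mapRedex (S : G.Redex) : S.contract.Equal (f.mapRedex hf S).contract := by
  rcases S with c | c
  · exact ⟨(f.contractM c).toIso (f.contractM_surjective c hf)⟩
  · change c.contract.Equal (f.mapECut hf c).contract
    rw [BangCut.contract_toBangCut, BangCut.contract_toBangCut]
    have hW : ∀ n ∈ c.toBangCut.W, G.IsNode n := fun n hn => by
      obtain ⟨-, ⟨⟨l, -, hl⟩, -⟩, -⟩ := hn
      exact ⟨l, .inr hl⟩
    refine ⟨(f.contractBang c.toBangCut
      (fun n hn => ⟨(f.mem_mapBang_W hf _ (hW n hn)).2 hn, hW n hn⟩)).toIso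
      (f.contractBang_surjective _ _ hf fun n' hn' => ?_)⟩
    obtain ⟨-, ⟨⟨l, -, hl⟩, -⟩, -⟩ := id hn'
    obtain ⟨l, rfl⟩ := hf l
    rw [f.link_onL] at hl
    obtain ⟨n, hn, rfl⟩ := Link.eTarget_map.1 hl
    exact ⟨n, (f.mem_mapBang_W hf _ ⟨l, .inr hn⟩).1 hn', rfl⟩

theorem mapRedex_injective (h : G.WF X) : Function.Injective (f.mapRedex hf) := by
  intro S S' e
  apply h.redex_ext
  have e := congrArg Redex.node e
  rcases S with c | c <;> rcases S' with c' | c'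
  · exact congrArg Sum.inl (f.injM ⟨c.tens, .inr (by rw [c.tens_eq]; rfl)⟩
      ⟨c'.tens, .inr (by rw [c'.tens_eq]; rfl)⟩ (Sum.inl.inj e))
  · cases e
  · cases e
  · exact congrArg Sum.inr (f.injE c.toBangCut.node_isNode c'.toBangCut.node_isNode (Sum.inr.inj e))

theorem mapRedex_surjective : Function.Surjective (f.mapRedex hf) := by
  rintro (⟨n, t, p, r, a, x, b, ht, hp⟩ | ⟨n, b, m, l, hb, hl, hi, hp⟩)
  · obtain ⟨t, rfl⟩ := hf t
    obtain ⟨p, rfl⟩ := hf p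
    obtain ⟨r, n, a, ht', rfl, rfl, rfl⟩ := Link.map_eq_tens.1 ((f.link_onL t).symm.trans ht)
    obtain ⟨n', x, b, hp', e, rfl, rfl⟩ := Link.map_eq_par.1 ((f.link_onL p).symm.trans hp)
    have := f.onM_inj ⟨p, .inl (by rw [hp']; rfl)⟩ ⟨t, .inr (by rw [ht']; rfl)⟩ e
    subst this
    exact ⟨.m ⟨n', t, p, r, a, x, b, ht', hp'⟩, rfl⟩
  · obtain ⟨b, rfl⟩ := hf b
    obtain ⟨l, rfl⟩ := hf l
    obtain ⟨_ | n, m, hb', e, rfl⟩ := Link.map_eq_bang.1 ((f.link_onL b).symm.trans hb)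
    · cases e
    cases e
    obtain ⟨m', hl', e⟩ := Link.mSource_map.1 (f.link_onL l ▸ hl)
    have := f.onM_inj ⟨b, .inr (by rw [hb']; rfl)⟩ ⟨l, .inl hl'⟩ e
    subst this
    have hn : G.IsNode (.inr n) := ⟨b, .inl (by rw [hb']; rfl)⟩
    refine ⟨.e ⟨n, b, m, l, hb', hl', ?_, ?_⟩, congrArg _ (ECut.ext_of_links rfl rfl)⟩
    · obtain ⟨k, hk⟩ := hi
      obtain ⟨k, rfl⟩ := hf k
      exact ⟨k, (f.eTarget_iff hn k).1 hk⟩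
    · intro k hk
      have := hp _ ((f.eTarget_iff hn k).2 hk)
      rwa [f.link_onL, Link.eTargetPrincipal_map] at this

end Emb

end Net

/-! ### The redexes of a term and those of its net -/

open Net

namespace Net

/-- The node of a redex: an `m`-node between a `tens` and a `par`, or an `e`-node other than the
root that is the source of a `bang` and only the target of derelictions and weakenings. -/
def IsCutNode (G : Net) : G.M ⊕ G.E → Prop
  | .inl a => (∃ l r b, G.link l = .tens r a b) ∧ ∃ l x b, G.link l = .par a x b
  | .inr p => (∃ l m, G.link l = .bang (.inr p) m) ∧ p ≠ G.root ∧
      ∀ l, (G.link l).ETarget (.inr p) → (G.link l).ETargetPrincipal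

/-- The node of a redex is in the image of an embedding, since the links that form the redex are not
weakenings. -/
theorem WF.exists_isCutNode {G₀ G : Net} {X : Finset ℕ} (h : G.WF X) (f : Emb G₀ G) (S : G.Redex) :
    ∃ n, G₀.IsCutNode n ∧ Sum.map f.onM f.onE n = S.node := by
  rcases S with c | c
  · obtain ⟨l, hl⟩ := f.exists_of_not_isWeak (l := c.tens) (by rw [c.tens_eq]; exact id)
    obtain ⟨k, hk⟩ := f.exists_of_not_isWeak (l := c.par) (by rw [c.par_eq]; exact id)
    obtain ⟨r, n, a, ht, -, e, -⟩ := Link.map_eq_tens.1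
      ((f.link_onL l).symm.trans (hl ▸ c.tens_eq))
    obtain ⟨n', x, b, hp, e', -, -⟩ := Link.map_eq_par.1
      ((f.link_onL k).symm.trans (hk ▸ c.par_eq))
    have := f.onM_inj ⟨l, .inr (by rw [ht]; rfl)⟩ ⟨k, .inl (by rw [hp]; rfl)⟩ (e.trans e'.symm)
    subst this
    exact ⟨.inl n, ⟨⟨l, _, _, ht⟩, k, _, _, hp⟩, congrArg Sum.inl e⟩
  · obtain ⟨l, hl⟩ := f.exists_of_not_isWeak (l := c.bang) (by rw [c.bang_eq]; exact id)
    obtain ⟨_ | n, m, hb, e, -⟩ := Link.map_eq_bang.1 ((f.link_onL l).symm.trans (hl ▸ c.bang_eq))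
    · cases e
    have e := Sum.inr.inj e
    refine ⟨.inr n, ⟨⟨l, m, hb⟩, ?_, fun k hk => ?_⟩, congrArg Sum.inr e⟩
    · rintro rfl
      exact h.eCut_node_ne_root c (e.symm.trans f.root_eq)
    · have := c.principal (f.onL k) (by
        rw [f.link_onL, Link.eTarget_map]
        exact ⟨_, hk, congrArg _ e.symm⟩)
      rwa [f.link_onL, Link.eTargetPrincipal_map] at this

/-- The targets among the free variables do not change in a proper step. -/
theorem Cut.Proper.target_free {G : Net} {c : G.Cut} (hc : c.Proper)
    (hf : ∀ l x, ¬ (G.link l).ESource (.inl x))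
    {x : ℕ} {l : c.contract.L} (h : (c.contract.link l).ETarget (.inl x)) :
    ∃ l, (G.link l).ETarget (.inl x) := by
  rcases c with c | c
  · obtain ⟨n, hn, e⟩ := Link.eTarget_map.1 ((c.link_contract l).symm ▸ h)
    by_cases hx : n = c.x
    · rw [c.relabel_of_eq_x hx] at e
      exact ⟨c.tens, by rw [c.tens_eq]; exact e⟩
    · by_cases hb : n = c.body
      · rw [c.relabel_of_eq_body hx hb] at e
        exact absurd (by rw [c.tens_eq]; exact e) (hf c.tens x)
      · rw [c.relabel_of_ne hx hb] at e
        exact ⟨l.1, e ▸ hn⟩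
  · change ((c.contract ∅).link l).ETarget _ at h
    induction l using BangCut.contract_cases with
    | h₁ l hl =>
      obtain ⟨_ | _, hn, e⟩ := Link.eTarget_map.1 h <;> cases e
      exact ⟨l, hn⟩
    | h₂ d l hl =>
      obtain ⟨_ | _, hn, e⟩ := Link.eTarget_map.1 h <;> cases e
      exact ⟨l, hn⟩
    | h₃ n hn => exact hn.elim

end Net

namespace Term

/-- If the root of the net of `t` is on a `bang`, then `t` has the form `vL`. -/
theorem eq_subs_of_bang_root (t : Term) {l m} (h : t.skel.link l = .bang (.inr t.skel.root) m) :
    ∃ (v : Value) (L : List Term), t = v.toTerm.subs L := by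
  induction t with
  | var x => exact ⟨.var x, [], rfl⟩
  | lam t => exact ⟨.lam t, [], rfl⟩
  | appVar x s =>
    rcases l with (_ | _) | l
    · cases h
    · cases h
    · obtain ⟨n | n, _, _, e, _⟩ := Link.map_eq_bang.1 h <;> cases e
  | appLam t s =>
    rcases l with (_ | _) | l | l
    · cases h
    · cases h
    · obtain ⟨(_ | n) | n, _, _, e, _⟩ := Link.map_eq_bang.1 h <;> cases e
    · obtain ⟨n | n, _, _, e, _⟩ := Link.map_eq_bang.1 h <;> cases e
  | sub t u ih _ =>
    rcases l with l | l
    · obtain ⟨(_ | n) | n, m, hl, e, _⟩ := Link.map_eq_bang.1 h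
      · cases e
      · cases e
      · cases e
        obtain ⟨v, L, rfl⟩ := ih hl
        exact ⟨v, L ++ [u], (subs_concat _ _ _).symm⟩
    · obtain ⟨n | n, _, _, e, _⟩ := Link.map_eq_bang.1 h <;> cases e

/-- The decomposition of a term as `vL` is unique. -/
theorem subs_injective {v v' : Value} {L L' : List Term}
    (h : v.toTerm.subs L = v'.toTerm.subs L') : v = v' ∧ L = L' := by
  induction L using List.reverseRecOn generalizing L' with
  | nil =>
    rcases L'.eq_nil_or_concat' with rfl | ⟨L', w', rfl⟩
    · cases v <;> cases v' <;> cases h <;> exact ⟨rfl, rfl⟩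
    · rw [subs_concat] at h
      cases v <;> cases h
  | append_singleton L w ih =>
    rcases L'.eq_nil_or_concat' with rfl | ⟨L', w', rfl⟩
    · rw [subs_concat] at h
      cases v' <;> cases h
    · rw [subs_concat, subs_concat] at h
      obtain ⟨e, rfl⟩ := Term.sub.inj h
      obtain ⟨hv, rfl⟩ := ih e
      exact ⟨hv, rfl⟩

/-- The free variables can be read off the skeleton. -/
theorem mem_fv_iff (t : Term) {x : ℕ} : x ∈ t.fv ↔ ∃ l, (t.skel.link l).ETarget (.inl x) := by
  rw [← t.wf_net.target_free]
  constructor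
  · rintro ⟨l, hl⟩
    obtain ⟨k, rfl⟩ := t.skelEmb.exists_of_not_isWeak
      fun hw => hw.not_isDer (t.isDer_of_target_free hl)
    rw [t.skelEmb.link_onL] at hl
    obtain ⟨_ | _, hn, e⟩ := Link.eTarget_map.1 hl <;> cases e
    exact ⟨k, hn⟩
  · rintro ⟨l, hl⟩
    exact ⟨t.skelEmb.onL l, by rw [t.skelEmb.link_onL]; exact Link.eTarget_map.2 ⟨_, hl, rfl⟩⟩

namespace Redex

theorem node_ne_root {t : Term} (R : t.Redex) : R.node ≠ .inr t.net.root := by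
  induction R with
  | mRoot t u => rintro ⟨⟩
  | eRoot t u v L h => rintro ⟨⟩
  | subLeft u R ih =>
    intro e
    refine ih ?_
    change Sum.map Sum.inl Sum.inl R.node = _ at e
    rcases hR : R.node with a | p <;> rw [hR] at e <;> cases e
    rfl
  | lam R | appVar _ R | appLamLeft _ R | appLamRight _ R | subRight _ R =>
    intro e
    change Sum.map _ _ R.node = _ at e
    rcases hR : R.node with a | p <;> rw [hR] at e <;> cases e

theorem sumMap_inj {A B C D : Type} {f : A → C} {g : B → D} (hf : Function.Injective f)
    (hg : Function.Injective g) {a b} (h : Sum.map f g a = Sum.map f g b) : a = b :=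
  Sum.map_injective.2 ⟨hf, hg⟩ h

theorem node_injective (t : Term) : Function.Injective (node : t.Redex → _) := by
  intro R
  induction R with
  | mRoot t u =>
    intro R' e
    cases R' with
    | mRoot => rfl
    | appLamLeft _ R' | appLamRight _ R' =>
      change _ = Sum.map _ _ R'.node at e
      rcases hR : R'.node with a | p <;> rw [hR] at e <;> cases e
  | eRoot t u v L h =>
    intro R' e
    cases R' with
    | eRoot _ _ v' L' h' =>
      obtain ⟨rfl, rfl⟩ := subs_injective (h.symm.trans h')
      rfl
    | subLeft _ R' =>
      change _ = Sum.map _ _ R'.node at e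
      rcases hR : R'.node with a | p <;> rw [hR] at e <;> cases e
    | subRight _ R' =>
      refine absurd ?_ R'.node_ne_root
      change _ = Sum.map _ _ R'.node at e
      rcases hR : R'.node with a | p <;> rw [hR] at e <;> cases e
      rfl
  | lam R ih =>
    intro R' e
    cases R' with
    | lam R' => rw [ih (sumMap_inj Sum.inr_injective Sum.inr_injective e)]
  | appVar x R ih =>
    intro R' e
    cases R' with
    | appVar _ R' => rw [ih (sumMap_inj Sum.inr_injective Sum.inr_injective e)]
  | appLamLeft s R ih =>
    intro R' e
    cases R' with
    | appLamLeft _ R' =>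
      rw [ih (sumMap_inj (Sum.inr_injective.comp Sum.inl_injective)
        (Sum.inr_injective.comp Sum.inl_injective) e)]
    | mRoot =>
      change Sum.map _ _ R.node = _ at e
      rcases hR : R.node with a | p <;> rw [hR] at e <;> cases e
    | appLamRight _ R' =>
      change Sum.map _ _ R.node = Sum.map _ _ R'.node at e
      rcases hR : R.node with a | p <;> rcases hR' : R'.node with a' | p' <;> rw [hR, hR'] at e <;>
        cases e
  | appLamRight t R ih =>
    intro R' e
    cases R' with
    | appLamRight _ R' =>
      rw [ih (sumMap_inj (Sum.inr_injective.comp Sum.inr_injective)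
        (Sum.inr_injective.comp Sum.inr_injective) e)]
    | mRoot =>
      change Sum.map _ _ R.node = _ at e
      rcases hR : R.node with a | p <;> rw [hR] at e <;> cases e
    | appLamLeft _ R' =>
      change Sum.map _ _ R.node = Sum.map _ _ R'.node at e
      rcases hR : R.node with a | p <;> rcases hR' : R'.node with a' | p' <;> rw [hR, hR'] at e <;>
        cases e
  | subLeft u R ih =>
    intro R' e
    cases R' with
    | subLeft _ R' => rw [ih (sumMap_inj Sum.inl_injective Sum.inl_injective e)]
    | eRoot =>
      change Sum.map _ _ R.node = _ at e
      rcases hR : R.node with a | p <;> rw [hR] at e <;> cases e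
    | subRight _ R' =>
      change Sum.map _ _ R.node = Sum.map _ _ R'.node at e
      rcases hR : R.node with a | p <;> rcases hR' : R'.node with a' | p' <;> rw [hR, hR'] at e <;>
        cases e
  | subRight t R ih =>
    intro R' e
    cases R' with
    | subRight _ R' => rw [ih (sumMap_inj Sum.inr_injective Sum.inr_injective e)]
    | eRoot =>
      refine absurd ?_ R.node_ne_root
      change Sum.map _ _ R.node = _ at e
      rcases hR : R.node with a | p <;> rw [hR] at e <;> cases e
      rfl
    | subLeft _ R' =>
      change Sum.map _ _ R.node = Sum.map _ _ R'.node at e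
      rcases hR : R.node with a | p <;> rcases hR' : R'.node with a' | p' <;> rw [hR, hR'] at e <;>
        cases e

/-- Every possible redex of the skeleton comes from a redex of the term. The root of an explicit
substituend is on a `bang` only if the substituend has the form `vL`. -/
theorem exists_node_eq (t : Term) {n} (h : t.skel.IsCutNode n) :
    ∃ R : t.Redex, R.node = Sum.map t.skelEmb.onM t.skelEmb.onE n := by
  induction t with
  | var x =>
    rcases n with a | p
    · obtain ⟨⟨_ | _, _, _, h⟩, _⟩ := h <;> cases h
    · exact absurd rfl h.2.1
  | lam t ih =>
    suffices ∃ n', t.skel.IsCutNode n' ∧ n = Sum.map .inr .inr n' by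
      obtain ⟨n', hn, rfl⟩ := this
      obtain ⟨R, hR⟩ := ih hn
      refine ⟨.lam R, (congrArg (Sum.map _ _) hR).trans ?_⟩
      rcases n' with _ | _ <;> rfl
    rcases n with a | p
    · obtain ⟨⟨(_ | _) | l, _, _, h₁⟩, ⟨k, _, _, h₂⟩⟩ := h
      · cases h₁
      · cases h₁
      obtain ⟨_, a, _, g₁, -, rfl, -⟩ := Link.map_eq_tens.1 h₁
      rcases k with (_ | _) | k
      · cases h₂
      · cases h₂
      obtain ⟨_, _, _, g₂, e, -, -⟩ := Link.map_eq_par.1 h₂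
      cases e
      exact ⟨.inl a, ⟨⟨_, _, _, g₁⟩, _, _, _, g₂⟩, rfl⟩
    · obtain ⟨⟨(_ | _) | l, m, h₁⟩, h₂, h₃⟩ := h
      · cases h₁
      · cases h₁
        exact absurd rfl h₂
      obtain ⟨(_ | _) | p, m, g₁, e, -⟩ := Link.map_eq_bang.1 h₁
      · exact absurd (by rw [g₁]; rfl) (t.skel_no_free (l := l) (x := 0))
      · cases e
      · cases e
        refine ⟨.inr p, ⟨⟨l, m, g₁⟩, ?_, fun k hk => ?_⟩, rfl⟩
        -- The root of the body is the target of a `par`.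
        · rintro rfl
          exact h₃ (.inl false) rfl
        · exact Link.eTargetPrincipal_map.1 (h₃ (.inr k) (Link.eTarget_map.2 ⟨_, hk, rfl⟩))
  | appVar x t ih =>
    suffices ∃ n', t.skel.IsCutNode n' ∧ n = Sum.map .inr .inr n' by
      obtain ⟨n', hn, rfl⟩ := this
      obtain ⟨R, hR⟩ := ih hn
      refine ⟨.appVar x R, (congrArg (Sum.map _ _) hR).trans ?_⟩
      rcases n' with _ | _ <;> rfl
    rcases n with a | p
    · obtain ⟨⟨l, _, _, h₁⟩, ⟨(_ | _) | k, _, _, h₂⟩⟩ := h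
      · cases h₂
      · cases h₂
      obtain ⟨a, _, _, g₂, rfl, -, -⟩ := Link.map_eq_par.1 h₂
      rcases l with (_ | _) | l
      · cases h₁
      · cases h₁
      obtain ⟨_, _, _, g₁, -, e, -⟩ := Link.map_eq_tens.1 h₁
      cases e
      exact ⟨.inl a, ⟨⟨_, _, _, g₁⟩, _, _, _, g₂⟩, rfl⟩
    · obtain ⟨⟨(_ | _) | l, m, h₁⟩, h₂, h₃⟩ := h
      · cases h₁
      · cases h₁
      obtain ⟨_ | p, m, g₁, e, -⟩ := Link.map_eq_bang.1 h₁
      · cases e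
      · cases e
        refine ⟨.inr p, ⟨⟨l, m, g₁⟩, ?_, fun k hk => ?_⟩, rfl⟩
        -- The root of the argument is the target of a `tens`.
        · rintro rfl
          exact h₃ (.inl true) rfl
        · exact Link.eTargetPrincipal_map.1 (h₃ (.inr k) (Link.eTarget_map.2 ⟨_, hk, rfl⟩))
  | appLam t s iht ihs =>
    suffices n = .inl (.inl ()) ∨
        (∃ n', t.skel.IsCutNode n' ∧ n = Sum.map (.inr ∘ .inl) (.inr ∘ .inl) n') ∨
        ∃ n', s.skel.IsCutNode n' ∧ n = Sum.map (.inr ∘ .inr) (.inr ∘ .inr) n' by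
      rcases this with rfl | ⟨n', hn, rfl⟩ | ⟨n', hn, rfl⟩
      · refine ⟨.mRoot t s, ?_⟩
        rw [(skelEmb_appLam t s).1, (skelEmb_appLam t s).2]
        rfl
      · obtain ⟨R, hR⟩ := iht hn
        refine ⟨.appLamLeft s R, (congrArg (Sum.map _ _) hR).trans ?_⟩
        rcases n' with _ | _ <;> rfl
      · obtain ⟨R, hR⟩ := ihs hn
        refine ⟨.appLamRight t R, (congrArg (Sum.map _ _) hR).trans ?_⟩
        rcases n' with _ | _ <;> rfl
    rcases n with (_ | a | a) | p
    · exact .inl rfl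
    · obtain ⟨⟨l, _, _, h₁⟩, ⟨k, _, _, h₂⟩⟩ := h
      rcases l with (_ | _) | l | l
      · cases h₁
      · cases h₁
      · obtain ⟨_, _, _, g₁, -, e, -⟩ := Link.map_eq_tens.1 h₁
        cases e
        rcases k with (_ | _) | k | k
        · cases h₂
        · cases h₂
        · obtain ⟨_, _, _, g₂, e, -, -⟩ := Link.map_eq_par.1 h₂
          cases e
          exact .inr (.inl ⟨.inl a, ⟨⟨_, _, _, g₁⟩, _, _, _, g₂⟩, rfl⟩)
        · obtain ⟨_, _, _, -, e, -, -⟩ := Link.map_eq_par.1 h₂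
          cases e
      · obtain ⟨_, _, _, -, -, e, -⟩ := Link.map_eq_tens.1 h₁
        cases e
    · obtain ⟨⟨l, _, _, h₁⟩, ⟨k, _, _, h₂⟩⟩ := h
      rcases l with (_ | _) | l | l
      · cases h₁
      · cases h₁
      · obtain ⟨_, _, _, -, -, e, -⟩ := Link.map_eq_tens.1 h₁
        cases e
      · obtain ⟨_, _, _, g₁, -, e, -⟩ := Link.map_eq_tens.1 h₁
        cases e
        rcases k with (_ | _) | k | k
        · cases h₂
        · cases h₂
        · obtain ⟨_, _, _, -, e, -, -⟩ := Link.map_eq_par.1 h₂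
          cases e
        · obtain ⟨_, _, _, g₂, e, -, -⟩ := Link.map_eq_par.1 h₂
          cases e
          exact .inr (.inr ⟨.inl a, ⟨⟨_, _, _, g₁⟩, _, _, _, g₂⟩, rfl⟩)
    · obtain ⟨⟨(_ | _) | l | l, m, h₁⟩, h₂, h₃⟩ := h
      · cases h₁
      · cases h₁
      · obtain ⟨(_ | _) | p, m, g₁, e, -⟩ := Link.map_eq_bang.1 h₁
        · exact absurd (by rw [g₁]; rfl) (t.skel_no_free (l := l) (x := 0))
        · cases e
        · cases e
          refine .inr (.inl ⟨.inr p, ⟨⟨l, m, g₁⟩, ?_, fun k hk => ?_⟩, rfl⟩)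
          · rintro rfl
            exact h₃ (.inl false) rfl
          · exact Link.eTargetPrincipal_map.1 (h₃ (.inr (.inl k)) (Link.eTarget_map.2 ⟨_, hk, rfl⟩))
      · obtain ⟨_ | p, m, g₁, e, -⟩ := Link.map_eq_bang.1 h₁
        · cases e
        · cases e
          refine .inr (.inr ⟨.inr p, ⟨⟨l, m, g₁⟩, ?_, fun k hk => ?_⟩, rfl⟩)
          · rintro rfl
            exact h₃ (.inl true) rfl
          · exact Link.eTargetPrincipal_map.1 (h₃ (.inr (.inr k)) (Link.eTarget_map.2 ⟨_, hk, rfl⟩))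
  | sub t s iht ihs =>
    suffices ((∃ v L, s = (Value.toTerm v).subs L) ∧ n = .inr (.inr s.skel.root)) ∨
        (∃ n', t.skel.IsCutNode n' ∧ n = Sum.map .inl .inl n') ∨
        ∃ n', s.skel.IsCutNode n' ∧ n = Sum.map .inr .inr n' by
      rcases this with ⟨⟨v, L, hs⟩, rfl⟩ | ⟨n', hn, rfl⟩ | ⟨n', hn, rfl⟩
      · refine ⟨.eRoot t s v L hs, ?_⟩
        rw [(skelEmb_sub t s).1, (skelEmb_sub t s).2]
        exact congrArg (fun p => Sum.inr (Sum.inr p)) s.skelEmb.root_eq.symm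
      · obtain ⟨R, hR⟩ := iht hn
        refine ⟨.subLeft s R, (congrArg (Sum.map _ _) hR).trans ?_⟩
        rcases n' with _ | _ <;> rfl
      · obtain ⟨R, hR⟩ := ihs hn
        refine ⟨.subRight t R, (congrArg (Sum.map _ _) hR).trans ?_⟩
        rcases n' with _ | _ <;> rfl
    rcases n with (a | a) | p
    · obtain ⟨⟨l | l, _, _, h₁⟩, ⟨k | k, _, _, h₂⟩⟩ := h
      all_goals
        obtain ⟨_, _, _, g₁, -, e, -⟩ := Link.map_eq_tens.1 h₁
        cases e
        try
          obtain ⟨_, _, _, g₂, e, -, -⟩ := Link.map_eq_par.1 h₂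
          cases e
      exact .inr (.inl ⟨.inl a, ⟨⟨_, _, _, g₁⟩, _, _, _, g₂⟩, rfl⟩)
    · obtain ⟨⟨l | l, _, _, h₁⟩, ⟨k | k, _, _, h₂⟩⟩ := h
      all_goals
        obtain ⟨_, _, _, g₁, -, e, -⟩ := Link.map_eq_tens.1 h₁
        cases e
        try
          obtain ⟨_, _, _, g₂, e, -, -⟩ := Link.map_eq_par.1 h₂
          cases e
      exact .inr (.inr ⟨.inl a, ⟨⟨_, _, _, g₁⟩, _, _, _, g₂⟩, rfl⟩)
    · obtain ⟨⟨l | l, m, h₁⟩, h₂, h₃⟩ := h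
      · obtain ⟨(_ | _) | p, m, g₁, e, -⟩ := Link.map_eq_bang.1 h₁
        · exact absurd (by rw [g₁]; rfl) (t.skel_no_free (l := l) (x := 0))
        · cases e
        · cases e
          refine .inr (.inl ⟨.inr p, ⟨⟨l, m, g₁⟩, ?_, fun k hk => ?_⟩, rfl⟩)
          · rintro rfl
            exact h₂ rfl
          · exact Link.eTargetPrincipal_map.1 (h₃ (.inl k) (Link.eTarget_map.2 ⟨_, hk, rfl⟩))
      · obtain ⟨_ | p, m, g₁, e, -⟩ := Link.map_eq_bang.1 h₁
        · cases e
        · cases e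
          by_cases hp : p = s.skel.root
          · subst hp
            exact .inl ⟨s.eq_subs_of_bang_root g₁, rfl⟩
          · refine .inr (.inr ⟨.inr p, ⟨⟨l, m, g₁⟩, hp, fun k hk => ?_⟩, rfl⟩)
            exact Link.eTargetPrincipal_map.1 (h₃ (.inr k) (Link.eTarget_map.2 ⟨_, hk, rfl⟩))

theorem fv_contract_subset {t : Term} (R : t.Redex) : R.contract.fv ⊆ t.fv := by
  obtain ⟨c, hc, -, -, ⟨f⟩⟩ := R.simulated
  intro x hx
  obtain ⟨l, hl⟩ := (mem_fv_iff _).1 hx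
  refine (mem_fv_iff _).2 (hc.target_free (fun _ _ => t.skel_no_free) (l := f.onL l) ?_)
  rw [f.link_onL]
  exact Link.eTarget_map.2 ⟨_, hl, rfl⟩

end Redex

/-! ### The bijection -/

section

variable {t : Term} {X : Finset ℕ}

/-- The skeleton of a term embeds into its net with free variables `X`. -/
def skelEmbX (t : Term) (X : Finset ℕ) : Emb t.skel (t.netX X) := t.skelEmb.trans (weakenEmb _ _)

/-- Each redex of a term has a redex of the net on the corresponding node, and contracting the two
gives the same net: both nets are made of the skeleton of the contracted term and of
the weakenings that it forces. -/
theorem exists_net_redex (hX : t.fv ⊆ X) (R : t.Redex) :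
    ∃ S : (t.netX X).Redex, S.node = R.node ∧ S.kind = R.kind ∧
      (R.contract.netX X).Equal S.contract ∧ S.contract.Equal (R.contract.netX X) := by
  have h := t.wf_netX hX
  obtain ⟨c, hc, hk, hn, ⟨f⟩⟩ := R.simulated
  obtain ⟨S, hS, hSk, ⟨g⟩⟩ := h.exists_redex (t.skelEmbX X) t.skel_root_mem hc
  have hs := (R.contract.wf_netX ((R.fv_contract_subset).trans hX)).toSat
  exact ⟨S, hS.trans hn, hSk.trans hk,
    Sat.equal (R.contract.skelEmbX X) (f.trans g) (skel_not_isWeak _) (skel_root_mem _) hs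
      (h.sat_contract S),
    Sat.equal (f.trans g) (R.contract.skelEmbX X) (skel_not_isWeak _) (skel_root_mem _)
      (h.sat_contract S) hs⟩

/-- The bijection between the redexes of a term and those of its net. -/
theorem exists_redex_equiv (hX : t.fv ⊆ X) :
    ∃ φ : t.Redex ≃ (t.netX X).Redex, ∀ R, (φ R).node = R.node ∧ (φ R).kind = R.kind ∧
      (R.contract.netX X).Equal (φ R).contract ∧ (φ R).contract.Equal (R.contract.netX X) := by
  choose φ hφ using fun R => exists_net_redex (R := R) hX
  refine ⟨.ofBijective φ ⟨fun R R' e => ?_, fun S => ?_⟩, hφ⟩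
  · exact Redex.node_injective t ((hφ R).1.symm.trans ((congrArg _ e).trans (hφ R').1))
  · obtain ⟨n, hn, e⟩ := (t.wf_netX hX).exists_isCutNode (t.skelEmbX X) S
    obtain ⟨R, hR⟩ := Redex.exists_node_eq t hn
    exact ⟨R, (t.wf_netX hX).redex_ext ((hφ R).1.trans (hR.trans e))⟩

end

end Term

theorem mainTheorem3 (t : Term) (X : Finset ℕ) (hX : t.fv ⊆ X) :
    (∃ φ : t.Redex ≃ (t.netX X).Redex,
      (∀ R : t.Redex, (φ R).node = R.node) ∧
      ∀ (R : t.Redex) (a : Kind) (G' : Net),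
        (φ R).Reduces a G' ↔ ∃ t' : Term, R.Reduces a t' ∧ (t'.netX X).Equal G') ∧
    UnfoldingsIso X t (t.netX X) := by
  constructor
  · obtain ⟨φ, hφ⟩ := Term.exists_redex_equiv hX
    refine ⟨φ, fun R => (hφ R).1, fun R a G' => ⟨?_, ?_⟩⟩
    · rintro ⟨hk, h⟩
      exact ⟨_, ⟨(hφ R).2.1.symm.trans hk, rfl⟩, (hφ R).2.2.1.trans h⟩
    · rintro ⟨_, ⟨hk, rfl⟩, h⟩
      exact ⟨(hφ R).2.1.trans hk, (hφ R).2.2.2.trans h⟩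
  -- The vertices of the unfolding of the net correspond to the terms up to isomorphism of nets,
  -- along which redexes are transported.
  · refine ⟨fun s H => s.fv ⊆ X ∧ (s.netX X).Equal H, ⟨hX, .refl _⟩, ?_⟩
    rintro s H ⟨hs, ⟨f⟩⟩
    refine ⟨hs, ⟨f⟩, ?_⟩
    obtain ⟨φ, hφ⟩ := Term.exists_redex_equiv hs
    have hf : Function.Surjective f.toEmb.onL := f.onL.surjective
    let ψ : (s.netX X).Redex ≃ H.Redex := .ofBijective (f.toEmb.mapRedex hf)
      ⟨f.toEmb.mapRedex_injective hf (s.wf_netX hs), f.toEmb.mapRedex_surjective hf⟩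
    exact ⟨φ.trans ψ, fun R => ⟨(f.toEmb.kind_mapRedex hf _).trans (hφ R).2.1,
      R.fv_contract_subset.trans hs, (hφ R).2.2.1.trans (f.toEmb.equal_mapRedex hf _)⟩⟩
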